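/- **Notation.** Let $n\ge 0$, $\lambda\in\mathbb R$, $\varepsilon\in\{0,1\}$, and $|t|_\varepsilon^\alpha=|t|^\alpha(\operatorname{sign}t)^\varepsilon$ for $t\in\mathbb R\setminus\{0\}$, $\alpha\in\mathbb C$. Let $(\mathcal Fv)(\xi)=\int v(x)e^{-2i\pi\langle x,\xi\rangle}dx$ on $\mathbb R^{n+1}$, let $\mathcal S=\mathcal S(\mathbb R^{n+1})$, and let $\mathcal S_{\rm flat}\subset\mathcal S$ consist of the functions all of whose derivatives are $O(|x|^N)$ at $0$ for every $N$. For a function $v$ on $\mathbb R^{n+1}$ put $$v_{i\lambda,\varepsilon}(x)=\frac1{4\pi}\int_{-\infty}^\infty|t|_\varepsilon^{\frac{n-1}2+i\lambda}v(tx)\,dt\quad(x\ne0),\qquad v^\flat_{i\lambda,\varepsilon}(s)=v_{i\lambda,\varepsilon}(s,1)\quad(s\in\mathbb R^n),$$ $$C_{i\lambda,\varepsilon}=(-i)^\varepsilon\pi^{-\frac n2+i\lambda}\,\frac{\Gamma(\frac{1+n}4-\frac{i\lambda}2+\frac\varepsilon2)}{\Gamma(\frac{1-n}4+\frac{i\lambda}2+\frac\varepsilon2)}$$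 ($=0$ if the denominator has a pole, which happens only for $\lambda=0$ and $n\equiv1+2\varepsilon$ mod $4$). On the space $E_{i\lambda,\varepsilon}=\{v^\flat_{i\lambda,\varepsilon}:v\in\mathcal S\}$ the operator $\theta_{i\lambda,\varepsilon}$ is defined by $\theta_{i\lambda,\varepsilon}v^\flat_{i\lambda,\varepsilon}=(\mathcal Fv)^\flat_{-i\lambda,\varepsilon}$. Functions $f$ of the classes $(x,\xi)^\bullet$ of pairs with $\langle x,\xi\rangle=1$ under $(x,\xi)\sim(tx,t^{-1}\xi)$, $t\ne0$, are written $f(s,\sigma)$ at the class of $\big((s,1),\frac{(\sigma,1)}{1+\langle s,\sigma\rangle}\big)$, and $$(\mathrm{Op}_{i\lambda,\varepsilon}(f)u)(s)=(-1)^\varepsilon C_{-i\lambda,\varepsilon}\int_{\mathbb R^n} f(s,\sigma)\,|1+\langle s,\sigma\rangle|_\varepsilon^{-\frac{n+1}2-i\lambda}(\theta_{i\lambda,\varepsilon}u)(\sigma)\,d\sigma,$$ $$(\theta_{i\lambda,\varepsilon}\mathrm{Op}^\vee_{i\lambda,\varepsilon}(h)u)(\sigma)=C_{i\lambda,\varepsilon}\int_{\mathbb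 R^n} h(s,\sigma)\,|1+\langle s,\sigma\rangle|_\varepsilon^{-\frac{n+1}2+i\lambda}u(s)\,ds.$$ An integral $\int F$ marked "osc" is the limit of $\int\chi(\delta y)F(y)\,dy$ as $\delta\to0^+$, which has to exist and be the same for all Schwartz functions $\chi$ with $\chi(0)=1$. **Proposition 2.2.** Let $H=H(x,\xi)\in C^\infty(\mathbb R^{n+1}\times\mathbb R^{n+1})$ be invariant under $(x,\xi)\mapsto(tx,t^{-1}\xi)$, $t\ne0$, and bounded, and assume that it remains bounded after any operator in the algebra generated by all $x_j\partial_{x_k}$ and $\xi_j\partial_{\xi_k}$ has been applied. Let $$(\mathrm{Op}_0(H)v)(x)=\int H(x,\xi)e^{2i\pi\langle x,\xi\rangle}(\mathcal Fv)(\xi)\,d\xi,\qquad(\mathcal F\,\mathrm{Op}_1(H)v)(\xi)=\int H(x,\xi)e^{-2i\pi\langle x,\xi\rangle}v(x)\,dx.$$ 1. $\mathrm{Op}_0(H)$ maps $\mathcal F\mathcal S_{\rm flat}$ to $L^2(\mathbb R^{n+1})$, and $\mathrm{Op}_1(H)$ maps $\mathcal S_{\rm flat}$ to $L^2(\mathbb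 R^{n+1})$; for $v\in\mathcal S_{\rm flat}$ the function $\mathcal F\,\mathrm{Op}_1(H)v$ is integrable. 2. For all $(\lambda,\varepsilon)$ one has $(\mathrm{Op}_0(H)v)_{i\lambda,\varepsilon}=\mathrm{Op}_0(H)v_{i\lambda,\varepsilon}$ for $v\in\mathcal S$, and $(\mathrm{Op}_1(H)v)_{i\lambda,\varepsilon}=\mathrm{Op}_1(H)v_{i\lambda,\varepsilon}$ for $v\in\mathcal S_{\rm flat}$. Here the integrals that define the left-hand sides at $x\neq0$ converge absolutely; on the right-hand sides Fourier transforms are those of tempered distributions (and are functions), and the integrals that define $\mathrm{Op}_0(H)$, at $x\ne0$, and $\mathcal F\,\mathrm{Op}_1(H)$, at $\xi\ne0$, are osc. 3. For all $(\lambda,\varepsilon)$ there is an operator $A_{i\lambda,\varepsilon}$ such that $(\mathrm{Op}_0(H)v)^\flat_{i\lambda,\varepsilon}=A_{i\lambda,\varepsilon}v^\flat_{i\lambda,\varepsilon}$ for all $v\in\mathcal S$. If $C_{-i\lambda,\varepsilon}\ne0$, then $A_{i\lambda,\varepsilon}=\mathrm{Op}_{i\lambda,\varepsilon}(f)$ on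 $E_{i\lambda,\varepsilon}$, where $$f((x,\xi)^\bullet)=(-1)^\varepsilon C_{-i\lambda,\varepsilon}^{-1}\int_{-\infty}^\infty H(x,t\xi)\,e^{2i\pi t}|t|_\varepsilon^{\frac{n-1}2+i\lambda}\,dt\quad(\text{osc}).$$ 4. For all $(\lambda,\varepsilon)$ there is an operator $B_{i\lambda,\varepsilon}$ such that $(\mathrm{Op}_1(H)v)^\flat_{i\lambda,\varepsilon}=B_{i\lambda,\varepsilon}v^\flat_{i\lambda,\varepsilon}$ for all $v\in\mathcal S_{\rm flat}$. If $C_{i\lambda,\varepsilon}\ne0$, then $B_{i\lambda,\varepsilon}=\mathrm{Op}^\vee_{i\lambda,\varepsilon}(h)$ on $E_{i\lambda,\varepsilon}$, with values in $E_{i\lambda,\varepsilon}$, where $$h((x,\xi)^\bullet)=C_{i\lambda,\varepsilon}^{-1}\int_{-\infty}^\infty H(tx,\xi)\,e^{-2i\pi t}|t|_\varepsilon^{\frac{n-1}2-i\lambda}\,dt\quad(\text{osc}).$$ In 3 and 4 the integrals over $\mathbb R^n$ that define $\mathrm{Op}_{i\lambda,\varepsilon}(f)$ and $\mathrm{Op}^\vee_{i\lambda,\varepsilon}(h)$,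 whose kernels are singular along $1+\langle s,\sigma\rangle=0$, are understood as follows. For every $\chi\in\mathcal S(\mathbb R)$ with $\chi(0)=1$ let $f_\delta,h_\delta$ be the functions obtained from $H_\delta(x,\xi)=\chi(\delta|x|^2|\xi|^2)H(x,\xi)$ in place of $H$; for them, all integrals converge absolutely. Then $f_\delta\to f$ and $h_\delta\to h$ pointwise, and, for every $u\in E_{i\lambda,\varepsilon}$, every $s$ and every $\sigma$, $(\mathrm{Op}_{i\lambda,\varepsilon}(f_\delta)u)(s)\to(A_{i\lambda,\varepsilon}u)(s)$ and $C_{i\lambda,\varepsilon}\int h_\delta(s,\sigma)|1+\langle s,\sigma\rangle|_\varepsilon^{-\frac{n+1}2+i\lambda}u(s)\,ds\to(\theta_{i\lambda,\varepsilon}B_{i\lambda,\varepsilon}u)(\sigma)$ as $\delta\to0^+$. Moreover, at every point $s$ for which $\theta_{i\lambda,\varepsilon}u$ vanishes on $\{\sigma:|1+\langle s,\sigma\rangle|<c\,|(\sigma,1)|\}$ for some $c>0$, the integral with $f$ itself converges absolutely and gives $(A_{i\lambda,\varepsilon}u)(s)$; likewise at every $\sigma$ for which $u$ vanishes on $\{s:|1+\langle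 s,\sigma\rangle|<c\,|(s,1)|\}$ for some $c>0$, the integral with $h$ itself converges absolutely and gives $(\theta_{i\lambda,\varepsilon}B_{i\lambda,\varepsilon}u)(\sigma)$. -/

import Mathlib

open MeasureTheory Filter Topology Complex
open scoped ContDiff FourierTransform SchwartzMap

noncomputable section

namespace ProjPseudo

/-- Euclidean space `ℝ^m`. -/
abbrev E (m : ℕ) : Type := EuclideanSpace ℝ (Fin m)

/-! ### Powers and constants -/

/-- The function `|t|_ε^α = |t|^α (sign t)^ε` on `ℝ \ {0}`. -/
def absPow (ε : Fin 2) (α : ℂ) (t : ℝ) : ℂ :=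
  ((|t| : ℝ) : ℂ) ^ α * ((Real.sign t : ℝ) : ℂ) ^ (ε : ℕ)

/-- The constant `C_{iλ,ε}`. If the Gamma function in the denominator has a pole, the true value of
the quotient is `0`; this is also its value here, since Mathlib sets `Γ = 0` at the poles. -/
def intertwiningConst (n : ℕ) (lam : ℝ) (ε : Fin 2) : ℂ :=
  (-I) ^ (ε : ℕ) * (Real.pi : ℂ) ^ (-(n : ℂ) / 2 + I * lam)
    * (Complex.Gamma ((1 + n) / 4 - I * lam / 2 + ((ε : ℕ) : ℂ) / 2)
      / Complex.Gamma ((1 - n) / 4 + I * lam / 2 + ((ε : ℕ) : ℂ) / 2))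

/-! ### Oscillatory integrals and Fourier transforms of functions as tempered distributions -/

/-- `J` is the value of the oscillatory integral `∫ F(y) dy`: after insertion of a convergence
factor `χ(δ y)`, with `χ` an arbitrary Schwartz function such that `χ(0) = 1`, the integral
converges absolutely, and it tends to `J` as `δ → 0+`. -/
def HasOscIntegral {V : Type*} [NormedAddCommGroup V] [NormedSpace ℝ V] [MeasureSpace V]
    (F : V → ℂ) (J : ℂ) : Prop :=
  ∀ χ : 𝓢(V, ℂ), χ 0 = 1 →
    (∀ δ : ℝ, 0 < δ → Integrable (fun y => χ (δ • y) * F y)) ∧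
    Tendsto (fun δ : ℝ => ∫ y, χ (δ • y) * F y) (𝓝[>] 0) (𝓝 J)

/-- `W = 𝓕 U` in the sense of tempered distributions, for two functions `U`, `W` which define
tempered distributions by integration. -/
def IsFourierTransform {m : ℕ} (U W : E m → ℂ) : Prop :=
  (∀ φ : 𝓢(E m, ℂ), Integrable (fun x => U x * φ x)) ∧
  (∀ φ : 𝓢(E m, ℂ), Integrable (fun x => W x * φ x)) ∧
  ∀ φ : 𝓢(E m, ℂ), ∫ x, U x * 𝓕 (φ : E m → ℂ) x = ∫ ξ, W ξ * φ ξ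

/-- Schwartz functions which are flat at the origin. -/
def IsFlat {m : ℕ} (v : 𝓢(E m, ℂ)) : Prop :=
  ∀ k N : ℕ, ∃ c : ℝ, ∀ x : E m, ‖x‖ ≤ 1 → ‖iteratedFDeriv ℝ k (v : E m → ℂ) x‖ ≤ c * ‖x‖ ^ N

/-! ### Symbols on `ℝ^m × ℝ^m` -/

/-- The operator `x_j ∂/∂x_k`. -/
def xD {m : ℕ} (j k : Fin m) (G : E m × E m → ℂ) : E m × E m → ℂ :=
  fun p => (p.1 j : ℂ) * fderiv ℝ G p (EuclideanSpace.single k (1 : ℝ), 0)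

/-- The operator `ξ_j ∂/∂ξ_k`. -/
def xiD {m : ℕ} (j k : Fin m) (G : E m × E m → ℂ) : E m × E m → ℂ :=
  fun p => (p.2 j : ℂ) * fderiv ℝ G p (0, EuclideanSpace.single k (1 : ℝ))

/-- Membership in the algebra of operators generated by all `x_j ∂/∂x_k` and `ξ_j ∂/∂ξ_k`. -/
inductive InEulerAlgebra {m : ℕ} : ((E m × E m → ℂ) → (E m × E m → ℂ)) → Prop
  | one : InEulerAlgebra id
  | x (j k : Fin m) : InEulerAlgebra (xD j k)
  | xi (j k : Fin m) : InEulerAlgebra (xiD j k)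
  | mul {D D' : (E m × E m → ℂ) → (E m × E m → ℂ)} :
      InEulerAlgebra D → InEulerAlgebra D' → InEulerAlgebra (fun G => D (D' G))
  | add {D D' : (E m × E m → ℂ) → (E m × E m → ℂ)} :
      InEulerAlgebra D → InEulerAlgebra D' → InEulerAlgebra (fun G => D G + D' G)
  | smul (c : ℂ) {D : (E m × E m → ℂ) → (E m × E m → ℂ)} :
      InEulerAlgebra D → InEulerAlgebra (fun G => c • D G)

/-- The symbols under consideration: smooth, invariant under `(x,ξ) ↦ (tx, t⁻¹ξ)`, and bounded,
also after application of any operator of the algebra above. -/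
structure IsInvariantSymbol {m : ℕ} (H : E m × E m → ℂ) : Prop where
  smooth : ContDiff ℝ ∞ H
  invariant : ∀ (t : ℝ), t ≠ 0 → ∀ x ξ : E m, H (t • x, t⁻¹ • ξ) = H (x, ξ)
  bounded : ∀ D : (E m × E m → ℂ) → (E m × E m → ℂ), InEulerAlgebra D →
    ∃ c : ℝ, ∀ p, ‖D H p‖ ≤ c

/-! ### The standard and antistandard calculi on `ℝ^m` -/

/-- `(Op₀(H) v)(x) = ∫ H(x,ξ) e^{2iπ⟨x,ξ⟩} (𝓕 v)(ξ) dξ`. -/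
def op0 {m : ℕ} (H : E m × E m → ℂ) (v : E m → ℂ) (x : E m) : ℂ :=
  ∫ ξ, H (x, ξ) * exp (2 * Real.pi * I * (inner ℝ x ξ : ℝ)) * 𝓕 v ξ

/-- `∫ H(x,ξ) e^{-2iπ⟨x,ξ⟩} v(x) dx`, which is to be the Fourier transform of `Op₁(H) v`. -/
def fourierOp1 {m : ℕ} (H : E m × E m → ℂ) (v : E m → ℂ) (ξ : E m) : ℂ :=
  ∫ x, H (x, ξ) * exp (-2 * Real.pi * I * (inner ℝ x ξ : ℝ)) * v x

/-- `Op₁(H) v`. -/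
def op1 {m : ℕ} (H : E m × E m → ℂ) (v : E m → ℂ) : E m → ℂ :=
  𝓕⁻ (fourierOp1 H v)

/-- `G = Op₀(H) U` on `ℝ^m \ {0}`, for a function `U` (a homogeneous one, say) whose Fourier
transform as a tempered distribution is a function `W`; the integral
`∫ H(x,ξ) e^{2iπ⟨x,ξ⟩} W(ξ) dξ` is oscillatory. -/
def IsOp0 {m : ℕ} (H : E m × E m → ℂ) (U G : E m → ℂ) : Prop :=
  ∃ W : E m → ℂ, IsFourierTransform U W ∧ ∀ x : E m, x ≠ 0 →
    HasOscIntegral (fun ξ => H (x, ξ) * exp (2 * Real.pi * I * (inner ℝ x ξ : ℝ)) * W ξ) (G x)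

/-- `G = Op₁(H) U`: the Fourier transform of `G`, as a tempered distribution, is the function
given on `ℝ^m \ {0}` by the oscillatory integral `∫ H(x,ξ) e^{-2iπ⟨x,ξ⟩} U(x) dx`. -/
def IsOp1 {m : ℕ} (H : E m × E m → ℂ) (U G : E m → ℂ) : Prop :=
  ∃ W : E m → ℂ, IsFourierTransform G W ∧ ∀ ξ : E m, ξ ≠ 0 →
    HasOscIntegral (fun x => H (x, ξ) * exp (-2 * Real.pi * I * (inner ℝ x ξ : ℝ)) * U x) (W ξ)

/-! ### Homogeneous components -/

/-- Integrand of `v_{iλ,ε}(x)` without the factor `1/4π`: `|t|_ε^{(n-1)/2+iλ} v(tx)`. -/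
def homIntegrand {n : ℕ} (lam : ℝ) (ε : Fin 2) (v : E (n + 1) → ℂ) (x : E (n + 1)) (t : ℝ) : ℂ :=
  absPow ε (((n : ℂ) - 1) / 2 + I * lam) t * v (t • x)

/-- `v_{iλ,ε}`, the part of `v` homogeneous of degree `-(n+1)/2 - iλ` and parity `ε`. -/
def homPart {n : ℕ} (lam : ℝ) (ε : Fin 2) (v : E (n + 1) → ℂ) (x : E (n + 1)) : ℂ :=
  1 / (4 * Real.pi) * ∫ t : ℝ, homIntegrand lam ε v x t

/-- The point `(s,1)` of `ℝ^{n+1}`. -/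
def emb {n : ℕ} (s : E n) : E (n + 1) :=
  WithLp.toLp 2 (Fin.snoc (α := fun _ => ℝ) s.ofLp 1)

/-- `v^♭_{iλ,ε}(s) = v_{iλ,ε}(s,1)`. -/
def flatPart {n : ℕ} (lam : ℝ) (ε : Fin 2) (v : E (n + 1) → ℂ) (s : E n) : ℂ :=
  homPart lam ε v (emb s)

/-- The functions `v^♭_{iλ,ε}`, `v` a Schwartz function. -/
def flatClass (n : ℕ) (lam : ℝ) (ε : Fin 2) : Set (E n → ℂ) :=
  Set.range (fun v : 𝓢(E (n + 1), ℂ) => flatPart lam ε (v : E (n + 1) → ℂ))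

open Classical in
/-- The intertwining operator: `θ_{iλ,ε} v^♭_{iλ,ε} = (𝓕 v)^♭_{-iλ,ε}`. -/
def theta {n : ℕ} (lam : ℝ) (ε : Fin 2) (u : E n → ℂ) : E n → ℂ :=
  if h : u ∈ flatClass n lam ε then
    flatPart (-lam) ε (𝓕 (h.choose : E (n + 1) → ℂ))
  else 0

/-! ### The calculi on projective space

A function `f` on the space of classes `(x,ξ)^•`, `⟨x,ξ⟩ = 1`, is given as a function of `(x,ξ)`.
In inhomogeneous coordinates, `(s,σ)` stands for the class of
`((s,1), (σ,1)/(1+⟨s,σ⟩))`. -/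

/-- The function `f` in the coordinates `(s,σ)`. -/
def inCoord {n : ℕ} (f : E (n + 1) → E (n + 1) → ℂ) (s σ : E n) : ℂ :=
  f (emb s) ((1 + inner ℝ s σ : ℝ)⁻¹ • emb σ)

/-- Integrand, with respect to `σ`, of the standard calculus. -/
def opStdIntegrand {n : ℕ} (lam : ℝ) (ε : Fin 2) (f : E (n + 1) → E (n + 1) → ℂ) (u : E n → ℂ)
    (s σ : E n) : ℂ :=
  inCoord f s σ * absPow ε (-((n : ℂ) + 1) / 2 - I * lam) (1 + inner ℝ s σ) * theta lam ε u σ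

/-- The standard calculus `Op_{iλ,ε}(f)`. -/
def opStd {n : ℕ} (lam : ℝ) (ε : Fin 2) (f : E (n + 1) → E (n + 1) → ℂ) (u : E n → ℂ)
    (s : E n) : ℂ :=
  (-1) ^ (ε : ℕ) * intertwiningConst n (-lam) ε * ∫ σ, opStdIntegrand lam ε f u s σ

/-- Integrand, with respect to `s`, of the antistandard calculus. -/
def opAntiIntegrand {n : ℕ} (lam : ℝ) (ε : Fin 2) (h : E (n + 1) → E (n + 1) → ℂ) (u : E n → ℂ)
    (σ s : E n) : ℂ :=
  inCoord h s σ * absPow ε (-((n : ℂ) + 1) / 2 + I * lam) (1 + inner ℝ s σ) * u s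

/-- The function `θ_{iλ,ε} Op^∨_{iλ,ε}(h) u`, by which the antistandard calculus is defined. -/
def thetaOpAnti {n : ℕ} (lam : ℝ) (ε : Fin 2) (h : E (n + 1) → E (n + 1) → ℂ) (u : E n → ℂ)
    (σ : E n) : ℂ :=
  intertwiningConst n lam ε * ∫ s, opAntiIntegrand lam ε h u σ s

/-! ### The symbols `f` and `h` -/

/-- The integrand `H(x,tξ) e^{2iπt} |t|_ε^{(n-1)/2+iλ}`. -/
def fIntegrand {n : ℕ} (lam : ℝ) (ε : Fin 2) (H : E (n + 1) × E (n + 1) → ℂ)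
    (x ξ : E (n + 1)) (t : ℝ) : ℂ :=
  H (x, t • ξ) * exp (2 * Real.pi * I * t) * absPow ε (((n : ℂ) - 1) / 2 + I * lam) t

/-- The integrand `H(tx,ξ) e^{-2iπt} |t|_ε^{(n-1)/2-iλ}`. -/
def hIntegrand {n : ℕ} (lam : ℝ) (ε : Fin 2) (H : E (n + 1) × E (n + 1) → ℂ)
    (x ξ : E (n + 1)) (t : ℝ) : ℂ :=
  H (t • x, ξ) * exp (-2 * Real.pi * I * t) * absPow ε (((n : ℂ) - 1) / 2 - I * lam) t

/-- `f` is the function on the set of classes `(x,ξ)^•`, `⟨x,ξ⟩ = 1`, given by the oscillatory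
integral `(-1)^ε C_{-iλ,ε}⁻¹ ∫ H(x,tξ) e^{2iπt} |t|_ε^{(n-1)/2+iλ} dt`. -/
def IsStdSymbol {n : ℕ} (lam : ℝ) (ε : Fin 2) (H : E (n + 1) × E (n + 1) → ℂ)
    (f : E (n + 1) → E (n + 1) → ℂ) : Prop :=
  ∀ x ξ : E (n + 1), inner ℝ x ξ = 1 →
    (∀ t : ℝ, t ≠ 0 → f (t • x) (t⁻¹ • ξ) = f x ξ) ∧
    ∃ J : ℂ, HasOscIntegral (fIntegrand lam ε H x ξ) J ∧
      f x ξ = (-1) ^ (ε : ℕ) * (intertwiningConst n (-lam) ε)⁻¹ * J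

/-- `h` is the function on the set of classes `(x,ξ)^•`, `⟨x,ξ⟩ = 1`, given by the oscillatory
integral `C_{iλ,ε}⁻¹ ∫ H(tx,ξ) e^{-2iπt} |t|_ε^{(n-1)/2-iλ} dt`. -/
def IsAntiSymbol {n : ℕ} (lam : ℝ) (ε : Fin 2) (H : E (n + 1) × E (n + 1) → ℂ)
    (h : E (n + 1) → E (n + 1) → ℂ) : Prop :=
  ∀ x ξ : E (n + 1), inner ℝ x ξ = 1 →
    (∀ t : ℝ, t ≠ 0 → h (t • x) (t⁻¹ • ξ) = h x ξ) ∧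
    ∃ J : ℂ, HasOscIntegral (hIntegrand lam ε H x ξ) J ∧
      h x ξ = (intertwiningConst n lam ε)⁻¹ * J

/-- Invariant truncation of a symbol: `H_δ(x,ξ) = χ(δ |x|² |ξ|²) H(x,ξ)`. -/
def truncSymbol {m : ℕ} (χ : 𝓢(ℝ, ℂ)) (δ : ℝ) (H : E m × E m → ℂ) : E m × E m → ℂ :=
  fun p => χ (δ * (‖p.1‖ ^ 2 * ‖p.2‖ ^ 2)) * H p

/-- The function `f_δ` which corresponds to `H_δ`; its integral converges absolutely. -/
def fTrunc {n : ℕ} (lam : ℝ) (ε : Fin 2) (χ : 𝓢(ℝ, ℂ)) (H : E (n + 1) × E (n + 1) → ℂ) (δ : ℝ)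
    (x ξ : E (n + 1)) : ℂ :=
  (-1) ^ (ε : ℕ) * (intertwiningConst n (-lam) ε)⁻¹
    * ∫ t : ℝ, fIntegrand lam ε (truncSymbol χ δ H) x ξ t

/-- The function `h_δ` which corresponds to `H_δ`; its integral converges absolutely. -/
def hTrunc {n : ℕ} (lam : ℝ) (ε : Fin 2) (χ : 𝓢(ℝ, ℂ)) (H : E (n + 1) × E (n + 1) → ℂ) (δ : ℝ)
    (x ξ : E (n + 1)) : ℂ :=
  (intertwiningConst n lam ε)⁻¹ * ∫ t : ℝ, hIntegrand lam ε (truncSymbol χ δ H) x ξ t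

/-- `w = Op_{iλ,ε}(f) u`, for the symbol `f` given by an oscillatory integral in terms of `H`.
The kernel `f(s,σ) |1+⟨s,σ⟩|_ε^{-(n+1)/2-iλ}` is not integrable near `1+⟨s,σ⟩ = 0`, and is a
distribution in `σ`: the limit of the kernels associated with the functions `f_δ`, which tend
to `f` pointwise. Where `θ_{iλ,ε} u` vanishes in a projective neighbourhood of the
hyperplane `1+⟨s,σ⟩ = 0`, the integral that defines `Op_{iλ,ε}(f) u` is an ordinary one. -/
structure IsOpStd {n : ℕ} (lam : ℝ) (ε : Fin 2) (H : E (n + 1) × E (n + 1) → ℂ)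
    (f : E (n + 1) → E (n + 1) → ℂ) (u w : E n → ℂ) : Prop where
  pointwise : ∀ χ : 𝓢(ℝ, ℂ), χ 0 = 1 → ∀ x ξ : E (n + 1), inner ℝ x ξ = 1 →
    (∀ δ : ℝ, 0 < δ → Integrable (fIntegrand lam ε (truncSymbol χ δ H) x ξ)) ∧
    Tendsto (fun δ : ℝ => fTrunc lam ε χ H δ x ξ) (𝓝[>] 0) (𝓝 (f x ξ))
  regularized : ∀ χ : 𝓢(ℝ, ℂ), χ 0 = 1 → ∀ s : E n,
    (∀ δ : ℝ, 0 < δ → Integrable (opStdIntegrand lam ε (fTrunc lam ε χ H δ) u s)) ∧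
    Tendsto (fun δ : ℝ => opStd lam ε (fTrunc lam ε χ H δ) u s) (𝓝[>] 0) (𝓝 (w s))
  literal : ∀ s : E n,
    (∃ c : ℝ, 0 < c ∧ ∀ σ : E n, |1 + inner ℝ s σ| < c * ‖emb σ‖ → theta lam ε u σ = 0) →
    Integrable (opStdIntegrand lam ε f u s) ∧ w s = opStd lam ε f u s

/-- `w = Op^∨_{iλ,ε}(h) u`, in the same sense: `w` is in the domain of `θ_{iλ,ε}`, and
`θ_{iλ,ε} w` is given by the integral, with respect to `s`, of the definition. -/
structure IsOpAnti {n : ℕ} (lam : ℝ) (ε : Fin 2) (H : E (n + 1) × E (n + 1) → ℂ)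
    (h : E (n + 1) → E (n + 1) → ℂ) (u w : E n → ℂ) : Prop where
  mem : w ∈ flatClass n lam ε
  pointwise : ∀ χ : 𝓢(ℝ, ℂ), χ 0 = 1 → ∀ x ξ : E (n + 1), inner ℝ x ξ = 1 →
    (∀ δ : ℝ, 0 < δ → Integrable (hIntegrand lam ε (truncSymbol χ δ H) x ξ)) ∧
    Tendsto (fun δ : ℝ => hTrunc lam ε χ H δ x ξ) (𝓝[>] 0) (𝓝 (h x ξ))
  regularized : ∀ χ : 𝓢(ℝ, ℂ), χ 0 = 1 → ∀ σ : E n,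
    (∀ δ : ℝ, 0 < δ → Integrable (opAntiIntegrand lam ε (hTrunc lam ε χ H δ) u σ)) ∧
    Tendsto (fun δ : ℝ => thetaOpAnti lam ε (hTrunc lam ε χ H δ) u σ) (𝓝[>] 0)
      (𝓝 (theta lam ε w σ))
  literal : ∀ σ : E n,
    (∃ c : ℝ, 0 < c ∧ ∀ s : E n, |1 + inner ℝ s σ| < c * ‖emb s‖ → u s = 0) →
    Integrable (opAntiIntegrand lam ε h u σ) ∧ theta lam ε w σ = thetaOpAnti lam ε h u σ

end ProjPseudo

end

/-!
The two calculi are treated at once, through the operator `∫ H(x,ξ) e^{2iπκ⟨x,ξ⟩} w(ξ) dξ`, `κ = ±1`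
(`stdOp`): with `κ = 1` and `w = 𝓕 v` it is `Op₀(H) v`; with `κ = -1`, the two variables of `H`
exchanged, and `w = v`, it is `𝓕 (Op₁(H) v)`.

The assumptions on `H` say that, for `x ≠ 0`, the function `H(x,·)` is a symbol of order `0`, with
estimates that by invariance depend only on `|x|` and are uniform on the unit sphere
(`IsInvariantSymbol.exists_isSymb`). By invariance again, replacing `x` by `tx` amounts to replacing
`w` by `w(·/t)`; so the homogeneous component of `stdOp κ H w` at `x` is the integral
`∫ |r|_ε^{(n-1)/2-iλ} K(r) dr`, with `K(r) = ∫ H(x,ξ) e^{2iπκ⟨x,ξ⟩} w(rξ) dξ` bounded for small `r`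
by non-stationary phase (`exists_kernel_bound`). Exchanging the integrals gives the oscillatory integral
of `H(x,ξ) e^{2iπκ⟨x,ξ⟩}` against the homogeneous component of `w`
(`hasOscIntegral_symbol_mul_phase_mul_homogeneous`, `integrable_and_hasOscIntegral_stdOp`). Since
`𝓕 v_{iλ,ε} = (𝓕 v)_{-iλ,ε}` (`isFourierTransform_homPart`), both calculi commute with taking
homogeneous components. The result depends only on the component of `w`, so that operators are induced
on the spaces of the functions `v^♭`.

In homogeneous coordinates `ξ = τ(σ,1)`, the integral with respect to `τ` is, up to the factor
`|1+⟨s,σ⟩|_ε^{-(n+1)/2-iλ}`, the radial integral of `H` which defines the symbol `f` or `h`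
(`integral_line_eq`). The invariant truncation `χ(δ|x|²|ξ|²)` is, for fixed `x`, a radial cutoff in
`ξ`, and, on a ray, an even cutoff in `t`: so it computes the oscillatory integrals on both sides
(`integrable_and_tendsto_projective`). Away from `1+⟨s,σ⟩ = 0` the truncated radial integrals are
uniformly bounded, and the limit can be taken under the integral sign
(`integrable_and_integral_projective`). The existence of the radial integrals is the case of the line of
the same analysis, `|t|_ε^α` being a superposition of dilated test functions
(`exists_hasOscIntegral_absPow`).

For the antistandard calculus it remains to invert the Fourier transform. If `v` is flat, then
`H(x,ξ) v(x)` and its derivatives are rapidly decreasing in `x` uniformly in `ξ`, since the singularity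
of the estimates at `x = 0` is compensated; hence `𝓕 (Op₁(H) v)` is a Schwartz function
(`exists_schwartz_fourierOp1`). Every homogeneous component of a Schwartz function is one of a flat
Schwartz function (`exists_flat_homPart_eq`), so the induced operator is defined on the whole space.
-/

noncomputable section

namespace ProjPseudo

/-! ### Symbols and dilated Schwartz functions -/

section Symbols

variable {V V' : Type*} [NormedAddCommGroup V] [NormedSpace ℝ V] [NormedAddCommGroup V']
  [NormedSpace ℝ V']

theorem norm_iteratedFDeriv_comp_clm_le {F : Type*} [NormedAddCommGroup F] [NormedSpace ℝ F]
    {a : V → F} (ha : ContDiff ℝ ∞ a) (L : V' →L[ℝ] V) (k : ℕ) (x : V') :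
    ‖iteratedFDeriv ℝ k (fun y => a (L y)) x‖ ≤ ‖L‖ ^ k * ‖iteratedFDeriv ℝ k a (L x)‖ := by
  have := L.iteratedFDeriv_comp_right (f := a) ha x (i := k) (mod_cast le_top)
  rw [show (fun y => a (L y)) = a ∘ L from rfl, this]
  refine (ContinuousMultilinearMap.norm_compContinuousLinearMap_le _ _).trans ?_
  simp [mul_comm]

/-- `a` is a symbol of order `N` on `V`: its derivatives satisfy
`|∂^k a(ξ)| ≤ C_k (1+|ξ|)^{N-k}`. The constants `C` are part of the notion, because the estimates of
oscillatory integrals below have to be uniform with respect to the symbol. The negative powers are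
written on the left-hand side. -/
structure IsSymb (N : ℕ) (C : ℕ → ℝ) (a : V → ℂ) : Prop where
  smooth : ContDiff ℝ ∞ a
  bound : ∀ (k : ℕ) (ξ : V),
    (1 + ‖ξ‖) ^ k * ‖iteratedFDeriv ℝ k a ξ‖ ≤ C k * (1 + ‖ξ‖) ^ N

theorem IsSymb.nonneg {N : ℕ} {C : ℕ → ℝ} {a : V → ℂ} (h : IsSymb N C a) (k : ℕ) : 0 ≤ C k := by
  have := h.bound k 0
  simp only [norm_zero, add_zero, one_pow, one_mul, mul_one] at this
  exact (norm_nonneg _).trans this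

theorem IsSymb.norm_le {C : ℕ → ℝ} {a : V → ℂ} (h : IsSymb 0 C a) (x : V) : ‖a x‖ ≤ C 0 := by
  simpa using h.bound 0 x

/-- The constants for the product of two symbols. -/
def mulConst (C C' : ℕ → ℝ) (k : ℕ) : ℝ :=
  ∑ i ∈ Finset.range (k + 1), (k.choose i : ℝ) * C i * C' (k - i)

theorem IsSymb.mul {N : ℕ} {C C' : ℕ → ℝ} {a b : V → ℂ} (ha : IsSymb 0 C a) (hb : IsSymb N C' b) :
    IsSymb N (mulConst C C') (fun ξ => a ξ * b ξ) := by
  refine ⟨ha.smooth.mul hb.smooth, fun k ξ => ?_⟩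
  have h := norm_iteratedFDeriv_mul_le (N := ∞) ha.smooth hb.smooth ξ (n := k) (mod_cast le_top)
  calc (1 + ‖ξ‖) ^ k * ‖iteratedFDeriv ℝ k (fun ξ => a ξ * b ξ) ξ‖
      ≤ (1 + ‖ξ‖) ^ k * ∑ i ∈ Finset.range (k + 1), (k.choose i : ℝ) *
          ‖iteratedFDeriv ℝ i a ξ‖ * ‖iteratedFDeriv ℝ (k - i) b ξ‖ := by gcongr
    _ = ∑ i ∈ Finset.range (k + 1), (k.choose i : ℝ) *
          ((1 + ‖ξ‖) ^ i * ‖iteratedFDeriv ℝ i a ξ‖) *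
          ((1 + ‖ξ‖) ^ (k - i) * ‖iteratedFDeriv ℝ (k - i) b ξ‖) := by
        rw [Finset.mul_sum]
        refine Finset.sum_congr rfl fun i hi => ?_
        rw [show (1 + ‖ξ‖) ^ k = (1 + ‖ξ‖) ^ i * (1 + ‖ξ‖) ^ (k - i) by
          rw [← pow_add, Nat.add_sub_cancel' (Finset.mem_range_succ_iff.mp hi)]]
        ring
    _ ≤ ∑ i ∈ Finset.range (k + 1), (k.choose i : ℝ) * (C i * (1 + ‖ξ‖) ^ 0) *
          (C' (k - i) * (1 + ‖ξ‖) ^ N) := by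
        refine Finset.sum_le_sum fun i _ => ?_
        have := ha.nonneg i
        refine mul_le_mul (mul_le_mul_of_nonneg_left (ha.bound i ξ) (by positivity))
          (hb.bound (k - i) ξ) (by positivity) (by positivity)
    _ = _ := by
        rw [mulConst, Finset.sum_mul]
        exact Finset.sum_congr rfl fun i _ => by ring

/-- Symbols of order `0` can be composed with similarities. -/
theorem IsSymb.comp_similitude {C : ℕ → ℝ} {a : V → ℂ} (ha : IsSymb 0 C a) (L : V' →L[ℝ] V)
    {ρ M : ℝ} (hρ : 0 ≤ ρ) (hL : ∀ v, ‖L v‖ = ρ * ‖v‖) (hM : 1 ≤ M) (hρM : ρ ≤ M) :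
    IsSymb 0 (fun k => M ^ k * C k) (fun v => a (L v)) := by
  refine ⟨ha.smooth.comp L.contDiff, fun k v => ?_⟩
  have hLn : ‖L‖ ≤ ρ := L.opNorm_le_bound hρ fun v => (hL v).le
  have h1 := norm_iteratedFDeriv_comp_clm_le ha.smooth L k v
  have h2 := ha.bound k (L v)
  simp only [pow_zero, mul_one] at h2 ⊢
  have h3 : (1 + ‖v‖) * ρ ≤ M * (1 + ‖L v‖) := by
    rw [hL]; nlinarith [mul_nonneg hρ (norm_nonneg v)]
  calc (1 + ‖v‖) ^ k * ‖iteratedFDeriv ℝ k (fun v => a (L v)) v‖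
      ≤ (1 + ‖v‖) ^ k * (ρ ^ k * ‖iteratedFDeriv ℝ k a (L v)‖) := by
        gcongr
        exact h1.trans (by gcongr)
    _ = ((1 + ‖v‖) * ρ) ^ k * ‖iteratedFDeriv ℝ k a (L v)‖ := by rw [mul_pow]; ring
    _ ≤ (M * (1 + ‖L v‖)) ^ k * ‖iteratedFDeriv ℝ k a (L v)‖ := by gcongr
    _ = M ^ k * ((1 + ‖L v‖) ^ k * ‖iteratedFDeriv ℝ k a (L v)‖) := by rw [mul_pow]; ring
    _ ≤ M ^ k * C k := by gcongr

theorem IsSymb.hasTemperateGrowth {C : ℕ → ℝ} {a : V → ℂ} (ha : IsSymb 0 C a) :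
    a.HasTemperateGrowth := by
  refine ⟨ha.smooth, fun k => ⟨0, C k, fun x => ?_⟩⟩
  have h := ha.bound k x
  simp only [pow_zero, mul_one] at h ⊢
  refine le_trans ?_ h
  exact le_mul_of_one_le_left (norm_nonneg _) (one_le_pow₀ (by simp))

/-- `w` vanishes at least to the order `N` at the origin, and so do its derivatives accordingly; the
estimates are global, as they can be for bounded derivatives. -/
def VanishesToOrder (N : ℕ) (w : V → ℂ) : Prop :=
  ∀ j ≤ N, ∃ C : ℝ, ∀ y : V, ‖iteratedFDeriv ℝ j w y‖ ≤ C * ‖y‖ ^ (N - j)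

theorem vanishesToOrder_zero (w : 𝓢(V, ℂ)) : VanishesToOrder 0 (w : V → ℂ) := by
  intro j hj
  obtain ⟨C, hC⟩ := w.decay 0 j
  exact ⟨C, fun y => by simpa using hC.2 y⟩

theorem schwartz_one_add_norm_pow_mul_le {F : Type*} [NormedAddCommGroup F] [NormedSpace ℝ F]
    (w : 𝓢(V, F)) (m k : ℕ) :
    ∃ C, 0 ≤ C ∧ ∀ y, (1 + ‖y‖) ^ m * ‖iteratedFDeriv ℝ k w y‖ ≤ C := by
  refine ⟨_, ?_, fun y => SchwartzMap.one_add_le_sup_seminorm_apply (𝕜 := ℝ) (m := (m, k))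
    le_rfl le_rfl w y⟩
  positivity

/-- The family of dilated functions `w(r ·)`, `|r| ≤ 1`, for a Schwartz function `w` vanishing to
the order `N`: all are symbols of order `N`, with constants `O(|r|^N)`. -/
theorem exists_isSymb_dilation {N : ℕ} (w : 𝓢(V, ℂ)) (hw : VanishesToOrder N (w : V → ℂ)) :
    ∃ C : ℕ → ℝ, ∀ r : ℝ, |r| ≤ 1 → IsSymb N (fun k => |r| ^ N * C k) (fun ξ => w (r • ξ)) := by
  have key : ∀ k : ℕ, ∃ C, 0 ≤ C ∧ ∀ r : ℝ, |r| ≤ 1 → ∀ ξ : V, (1 + ‖ξ‖) ^ k *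
      (|r| ^ k * ‖iteratedFDeriv ℝ k w (r • ξ)‖) ≤ |r| ^ N * C * (1 + ‖ξ‖) ^ N := by
    intro k
    rcases le_or_gt k N with hk | hk
    · obtain ⟨C, hC⟩ := hw k hk
      refine ⟨|C|, abs_nonneg _, fun r hr ξ => ?_⟩
      calc (1 + ‖ξ‖) ^ k * (|r| ^ k * ‖iteratedFDeriv ℝ k w (r • ξ)‖)
          ≤ (1 + ‖ξ‖) ^ k * (|r| ^ k * (|C| * ‖r • ξ‖ ^ (N - k))) := by
            gcongr
            exact (hC _).trans (by gcongr; exact le_abs_self C)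
        _ ≤ (1 + ‖ξ‖) ^ k * (|r| ^ k * (|C| * (|r| * (1 + ‖ξ‖)) ^ (N - k))) := by
            rw [norm_smul, Real.norm_eq_abs]
            gcongr
            simp
        _ = (|r| ^ k * |r| ^ (N - k)) * |C| * ((1 + ‖ξ‖) ^ k * (1 + ‖ξ‖) ^ (N - k)) := by
            rw [mul_pow]; ring
        _ = _ := by rw [← pow_add, ← pow_add, Nat.add_sub_cancel' hk]
    · obtain ⟨C, hC0, hC⟩ := schwartz_one_add_norm_pow_mul_le w (k - N) k
      refine ⟨C, hC0, fun r hr ξ => ?_⟩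
      have h1 : (1 + ‖ξ‖) * |r| ≤ 1 + ‖r • ξ‖ := by
        rw [norm_smul, Real.norm_eq_abs]; nlinarith
      have h2 : ((1 + ‖ξ‖) * |r|) ^ k = ((1 + ‖ξ‖) * |r|) ^ N * ((1 + ‖ξ‖) * |r|) ^ (k - N) := by
        rw [← pow_add, Nat.add_sub_cancel' hk.le]
      calc (1 + ‖ξ‖) ^ k * (|r| ^ k * ‖iteratedFDeriv ℝ k w (r • ξ)‖)
          = ((1 + ‖ξ‖) * |r|) ^ N *
            (((1 + ‖ξ‖) * |r|) ^ (k - N) * ‖iteratedFDeriv ℝ k w (r • ξ)‖) := by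
            rw [← mul_assoc, ← mul_assoc, ← h2, mul_pow]
        _ ≤ ((1 + ‖ξ‖) * |r|) ^ N *
            ((1 + ‖r • ξ‖) ^ (k - N) * ‖iteratedFDeriv ℝ k w (r • ξ)‖) := by gcongr
        _ ≤ ((1 + ‖ξ‖) * |r|) ^ N * C := by gcongr; exact hC _
        _ = _ := by rw [mul_pow]; ring
  choose C hC0 hC using key
  refine ⟨C, fun r hr => ⟨(w.smooth ⊤).comp (contDiff_const_smul r), fun k ξ => ?_⟩⟩
  refine le_trans ?_ (hC k r hr ξ)
  gcongr
  have h := norm_iteratedFDeriv_comp_clm_le (w.smooth ⊤) (r • ContinuousLinearMap.id ℝ V) k ξ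
  have h2 : ‖r • ContinuousLinearMap.id ℝ V‖ ≤ |r| :=
    ContinuousLinearMap.opNorm_le_bound _ (abs_nonneg r) fun v => by simp [norm_smul]
  exact h.trans (mul_le_mul_of_nonneg_right (by gcongr) (norm_nonneg _))

end Symbols

/-! ### Decay of Fourier transforms -/

section Fourier

variable {V : Type*} [NormedAddCommGroup V] [InnerProductSpace ℝ V] [FiniteDimensional ℝ V]
  [MeasurableSpace V] [BorelSpace V]

/-- The decay of a Fourier transform, in terms of the derivatives of one given order. -/
theorem pow_mul_norm_fourier_le (f : 𝓢(V, ℂ)) (k : ℕ) (y : V) :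
    ‖y‖ ^ k * ‖𝓕 (f : V → ℂ) y‖ ≤ ∫ ξ, ‖iteratedFDeriv ℝ k f ξ‖ := by
  rcases eq_or_ne y 0 with rfl | hy
  · rcases Nat.eq_zero_or_pos k with rfl | hk
    · simp only [pow_zero, one_mul, norm_iteratedFDeriv_zero]
      exact VectorFourier.norm_fourierIntegral_le_integral_norm _ _ _ _ _
    · rw [norm_zero, zero_pow hk.ne', zero_mul]
      positivity
  have hm : ∀ n : ℕ, AEStronglyMeasurable (iteratedFDeriv ℝ n (f : V → ℂ)) volume := fun n => by
    have : SecondCountableTopologyEither V (V [×n]→L[ℝ] ℂ) := secondCountableTopologyEither_of_left _ _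
    exact ((f.smooth ⊤).continuous_iteratedFDeriv (mod_cast le_top)).aestronglyMeasurable
  have h := congrFun (Real.fourier_iteratedFDeriv (f := (f : V → ℂ)) (N := ⊤) (f.smooth ⊤)
    (fun n _ => (integrable_norm_iff (hm n)).mp
        (by simpa using f.integrable_pow_mul_iteratedFDeriv volume 0 n)) (n := k)
    (mod_cast le_top)) y
  have h1 : ‖𝓕 (iteratedFDeriv ℝ k f) y‖ ≤ ∫ ξ, ‖iteratedFDeriv ℝ k f ξ‖ :=
    VectorFourier.norm_fourierIntegral_le_integral_norm _ _ _ _ _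
  have h2 := ContinuousMultilinearMap.le_opNorm (𝓕 (iteratedFDeriv ℝ k f) y) (fun _ => y)
  rw [h] at h1 h2
  simp only [VectorFourier.fourierPowSMulRight_apply, neg_apply, Finset.prod_const, Finset.card_univ,
    Fintype.card_fin, norm_smul, norm_pow, norm_neg, norm_mul, Complex.norm_I, Complex.norm_ofNat,
    Complex.norm_real, Real.norm_eq_abs, abs_of_pos Real.pi_pos, mul_one,
    show innerSL ℝ y y = ‖y‖ ^ 2 from real_inner_self_eq_norm_sq y, abs_norm] at h2
  have hy' : 0 < ‖y‖ ^ k := by positivity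
  have h3 : (2 * Real.pi) ^ k * ((‖y‖ ^ 2) ^ k * ‖𝓕 (f : V → ℂ) y‖) ≤
      (∫ ξ, ‖iteratedFDeriv ℝ k f ξ‖) * ‖y‖ ^ k := by
    refine h2.trans ?_
    gcongr
  have h4 : (1 : ℝ) ≤ (2 * Real.pi) ^ k := one_le_pow₀ (by nlinarith [Real.pi_gt_three])
  have h5 : (‖y‖ ^ 2) ^ k * ‖𝓕 (f : V → ℂ) y‖ ≤
      (∫ ξ, ‖iteratedFDeriv ℝ k f ξ‖) * ‖y‖ ^ k :=
    (le_mul_of_one_le_left (by positivity) h4).trans h3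
  rw [← pow_mul, two_mul, pow_add, mul_assoc, mul_comm _ (‖y‖ ^ k)] at h5
  exact le_of_mul_le_mul_left h5 hy'

end Fourier

/-! ### The functions `|t|_ε^α` -/

section Powers

theorem measurable_absPow (ε : Fin 2) (α : ℂ) : Measurable (absPow ε α) := by
  have hs : Measurable Real.sign := by
    unfold Real.sign
    exact Measurable.ite measurableSet_Iio measurable_const
      (Measurable.ite measurableSet_Ioi measurable_const measurable_const)
  unfold absPow
  refine Measurable.mul ?_ ?_
  · exact (Complex.measurable_ofReal.comp measurable_abs).pow_const α
  · exact (Complex.measurable_ofReal.comp hs).pow_const _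

theorem norm_sign_pow {t : ℝ} (ht : t ≠ 0) (ε : Fin 2) :
    ‖((Real.sign t : ℝ) : ℂ) ^ (ε : ℕ)‖ = 1 := by
  rcases Real.sign_apply_eq_of_ne_zero t ht with h | h <;> simp [h]

theorem norm_absPow (ε : Fin 2) (α : ℂ) {t : ℝ} (ht : t ≠ 0) : ‖absPow ε α t‖ = |t| ^ α.re := by
  rw [absPow, norm_mul, norm_sign_pow ht, mul_one,
    Complex.norm_cpow_eq_rpow_re_of_pos (abs_pos.mpr ht)]

theorem absPow_ne_zero (ε : Fin 2) (α : ℂ) {t : ℝ} (ht : t ≠ 0) : absPow ε α t ≠ 0 := by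
  rw [← norm_ne_zero_iff, norm_absPow ε α ht]
  exact (Real.rpow_pos_of_pos (abs_pos.mpr ht) _).ne'

theorem absPow_mul (ε : Fin 2) (α : ℂ) (s t : ℝ) :
    absPow ε α (s * t) = absPow ε α s * absPow ε α t := by
  have h : Real.sign (s * t) = Real.sign s * Real.sign t := by
    rcases lt_trichotomy s 0 with hs | rfl | hs <;> rcases lt_trichotomy t 0 with ht | rfl | ht <;>
      simp [Real.sign_of_neg, Real.sign_of_pos, mul_pos_of_neg_of_neg, mul_neg_of_neg_of_pos,
        mul_neg_of_pos_of_neg, *]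
  rw [absPow, absPow, absPow, abs_mul, h, Complex.ofReal_mul, Complex.ofReal_mul,
    Complex.mul_cpow_ofReal_nonneg (abs_nonneg _) (abs_nonneg _), mul_pow]
  ring

theorem absPow_sign_mul_self (ε : Fin 2) (α α' : ℂ) {t : ℝ} (ht : t ≠ 0) :
    absPow ε α t * absPow ε α' t = ((|t| : ℝ) : ℂ) ^ (α + α') := by
  have h : (((Real.sign t : ℝ) : ℂ) ^ (ε : ℕ)) * (((Real.sign t : ℝ) : ℂ) ^ (ε : ℕ)) = 1 := by
    rw [← mul_pow]
    rcases Real.sign_apply_eq_of_ne_zero t ht with h | h <;> simp [h]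
  have h0 : ((|t| : ℝ) : ℂ) ≠ 0 := by simpa using ht
  rw [Complex.cpow_add _ _ h0, absPow, absPow]
  linear_combination ((|t| : ℝ) : ℂ) ^ α * ((|t| : ℝ) : ℂ) ^ α' * h

theorem absPow_add (ε : Fin 2) (α α' : ℂ) {t : ℝ} (ht : t ≠ 0) :
    absPow ε (α + α') t = ((|t| : ℝ) : ℂ) ^ α' * absPow ε α t := by
  have h0 : ((|t| : ℝ) : ℂ) ≠ 0 := by simpa using ht
  rw [absPow, absPow, Complex.cpow_add _ _ h0]
  ring

theorem absPow_inv (ε : Fin 2) (α : ℂ) (t : ℝ) :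
    absPow ε α t⁻¹ = absPow ε (-α) t := by
  have hs : Real.sign t⁻¹ = Real.sign t := Real.sign_inv ..
  rw [absPow, absPow, hs, abs_inv, Complex.ofReal_inv, Complex.inv_cpow, Complex.cpow_neg]
  rw [Complex.arg_ofReal_of_nonneg (abs_nonneg _)]
  exact Real.pi_ne_zero.symm

/-- A majorant on the line: `|t|^a` for small `t`, `|t|^b` for large `t`. -/
def twoPow (a b t : ℝ) : ℝ := if |t| ≤ 1 then |t| ^ a else |t| ^ b

theorem twoPow_nonneg (a b t : ℝ) : 0 ≤ twoPow a b t := by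
  unfold twoPow; split_ifs <;> positivity

theorem integrable_twoPow {a b : ℝ} (ha : -1 < a) (hb : b < -1) : Integrable (twoPow a b) := by
  have h : IntegrableOn (twoPow a b) (Set.Ioi 0) := by
    rw [← Set.Ioc_union_Ioi_eq_Ioi zero_le_one]
    refine IntegrableOn.union ?_ ?_
    · have := (intervalIntegral.intervalIntegrable_rpow' (a := 0) (b := 1) ha).1
      refine this.congr_fun (fun t ht => ?_) measurableSet_Ioc
      simp [twoPow, abs_of_pos ht.1, ht.2]
    · refine (integrableOn_Ioi_rpow_of_lt hb zero_lt_one).congr_fun (fun t ht => ?_)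
        measurableSet_Ioi
      have : (1 : ℝ) < t := ht
      have h0 : 0 < t := by linarith
      simp [twoPow, abs_of_pos h0, this.not_ge]
  have h' : IntegrableOn (twoPow a b) (Set.Iio 0) := by
    have := (show IntegrableOn (twoPow a b) (Set.Ioi (-0)) by rwa [neg_zero]).comp_neg_Iio
    exact this.congr_fun (fun t _ => by simp [twoPow]) measurableSet_Iio
  rw [← integrableOn_univ, ← Set.Iic_union_Ioi (a := (0 : ℝ))]
  refine IntegrableOn.union ?_ h
  rwa [integrableOn_Iic_iff_integrableOn_Iio]

theorem rpow_mul_twoPow (c a b : ℝ) {t : ℝ} (ht : t ≠ 0) :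
    |t| ^ c * twoPow a b t = twoPow (c + a) (c + b) t := by
  unfold twoPow
  split_ifs <;> rw [Real.rpow_add (abs_pos.mpr ht)]

theorem ae_ne_zero_real : ∀ᵐ t : ℝ, t ≠ 0 := by
  rw [ae_iff]; simp

/-- A function dominated by `|t|^a` as well as by `|t|^b` is integrable if `b < -1 < a`. -/
theorem integrable_of_le_rpow {F : Type*} [NormedAddCommGroup F] {f : ℝ → F}
    (hf : AEStronglyMeasurable f volume) {a b : ℝ} (ha : -1 < a) (hb : b < -1) {C₁ C₂ : ℝ}
    (h₁ : ∀ t, t ≠ 0 → |t| ≤ 1 → ‖f t‖ ≤ C₁ * |t| ^ a)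
    (h₂ : ∀ t, 1 ≤ |t| → ‖f t‖ ≤ C₂ * |t| ^ b) :
    Integrable f ∧ ∀ t, t ≠ 0 → ‖f t‖ ≤ max C₁ C₂ * twoPow a b t := by
  have key : ∀ t, t ≠ 0 → ‖f t‖ ≤ max C₁ C₂ * twoPow a b t := by
    intro t ht
    unfold twoPow
    split_ifs with h
    · exact (h₁ t ht h).trans (by gcongr; exact le_max_left _ _)
    · exact (h₂ t (not_le.mp h).le).trans (by gcongr; exact le_max_right _ _)
  refine ⟨((integrable_twoPow ha hb).const_mul (max C₁ C₂)).mono' hf ?_, key⟩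
  filter_upwards [ae_ne_zero_real] with t ht using key t ht

end Powers

/-! ### Oscillatory integrals of symbols against homogeneous functions -/

section Kernel

variable {V : Type*} [NormedAddCommGroup V] [InnerProductSpace ℝ V]

/-- The exponential `e^{2iπ⟨y,ξ⟩}`. -/
def phase (y ξ : V) : ℂ := exp (2 * Real.pi * I * (inner ℝ y ξ : ℝ))

theorem norm_phase (y ξ : V) : ‖phase y ξ‖ = 1 := by
  rw [phase, show (2 * Real.pi * I * (inner ℝ y ξ : ℝ) : ℂ) = ((2 * Real.pi * inner ℝ y ξ : ℝ) : ℂ) * I by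
    push_cast; ring]
  exact Complex.norm_exp_ofReal_mul_I _

theorem continuous_phase (y : V) : Continuous (phase y) := by
  unfold phase; fun_prop

/-- The dilated Schwartz function `w(r ·)`, as a Schwartz function. -/
def dilate (r : ℝ) (hr : r ≠ 0) (w : 𝓢(V, ℂ)) : 𝓢(V, ℂ) :=
  SchwartzMap.compCLMOfContinuousLinearEquiv ℂ
    (ContinuousLinearEquiv.smulLeft (Units.mk0 r hr) : V ≃L[ℝ] V) w

theorem dilate_apply (r : ℝ) (hr : r ≠ 0) (w : 𝓢(V, ℂ)) (ξ : V) : dilate r hr w ξ = w (r • ξ) := rfl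

theorem VanishesToOrder.norm_le {N : ℕ} {w : V → ℂ} (hw : VanishesToOrder N w) :
    ∃ C, 0 ≤ C ∧ ∀ y, ‖w y‖ ≤ C * ‖y‖ ^ N := by
  obtain ⟨C, hC⟩ := hw 0 (Nat.zero_le N)
  refine ⟨|C|, abs_nonneg _, fun y => ?_⟩
  have := hC y
  simp only [norm_iteratedFDeriv_zero, Nat.sub_zero] at this
  exact this.trans (by gcongr; exact le_abs_self C)

theorem continuous_mul_phase {g : V → ℂ} (hg : Continuous g) (y : V) :
    Continuous fun ξ => g ξ * phase y ξ := hg.mul (continuous_phase y)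

theorem IsSymb.norm_mul_phase_le {C : ℕ → ℝ} {g : V → ℂ} (hg : IsSymb 0 C g) (y ξ : V) :
    ‖g ξ * phase y ξ‖ ≤ C 0 := by
  rw [norm_mul, norm_phase, mul_one]
  exact hg.norm_le ξ

variable [FiniteDimensional ℝ V] [MeasurableSpace V] [BorelSpace V]

theorem integral_mul_phase_eq_fourier (f : V → ℂ) (y : V) :
    ∫ ξ, f ξ * phase y ξ = 𝓕 f (-y) := by
  rw [Real.fourier_eq']
  congr 1 with ξ
  rw [smul_eq_mul, mul_comm, phase, inner_neg_right, real_inner_comm]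
  congr 2
  push_cast; ring

theorem mulConst_smul (C C' : ℕ → ℝ) (s : ℝ) (k : ℕ) :
    mulConst C (fun k => s * C' k) k = s * mulConst C C' k := by
  simp only [mulConst, Finset.mul_sum]
  exact Finset.sum_congr rfl fun i _ => by ring

/-- Non-stationary phase: `N + d + 1` integrations by parts, `d` the dimension, produce the factor
`|r|^N` on account of the vanishing of `w` at the origin, and an integrand `O(|ξ|^{-d-1})`. The bound
is uniform with respect to the dilation parameters `δ` and `r`, and to the symbol `g`. -/
theorem exists_kernel_bound {N : ℕ} (ψ w : 𝓢(V, ℂ)) (hw : VanishesToOrder N (w : V → ℂ))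
    (Cg : ℕ → ℝ) :
    ∃ C : ℝ, ∀ g : V → ℂ, IsSymb 0 Cg g → ∀ (y : V) (δ r : ℝ), |δ| ≤ 1 → r ≠ 0 → |r| ≤ 1 →
      ‖y‖ ^ (N + (Module.finrank ℝ V + 1)) *
        ‖∫ ξ, ψ (δ • ξ) * (g ξ * phase y ξ) * w (r • ξ)‖ ≤ C * |r| ^ N := by
  obtain ⟨Cψ, hψ⟩ := exists_isSymb_dilation ψ (vanishesToOrder_zero ψ)
  obtain ⟨Cw, hCw⟩ := exists_isSymb_dilation w hw
  set k := N + (Module.finrank ℝ V + 1) with hk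
  set d : ℝ := Module.finrank ℝ V + 1 with hd
  have hint : Integrable (fun ξ : V => (1 + ‖ξ‖) ^ (-d)) :=
    integrable_one_add_norm (by rw [hd]; linarith)
  set M := mulConst (mulConst Cψ Cg) Cw k
  refine ⟨M * ∫ ξ : V, (1 + ‖ξ‖) ^ (-d), fun g hg y δ r hδ hr hr1 => ?_⟩
  have hψδ : IsSymb 0 Cψ (fun ξ => ψ (δ • ξ)) := by simpa using hψ δ hδ
  have ha := hψδ.mul hg
  have hs := ha.mul (hCw r hr1)
  have hag : (fun ξ => ψ (δ • ξ) * g ξ).HasTemperateGrowth := ha.hasTemperateGrowth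
  set f : 𝓢(V, ℂ) := SchwartzMap.smulLeftCLM ℂ (fun ξ => ψ (δ • ξ) * g ξ) (dilate r hr w) with hf
  have hfa : (f : V → ℂ) = fun ξ => ψ (δ • ξ) * g ξ * w (r • ξ) := by
    ext ξ
    rw [hf, SchwartzMap.smulLeftCLM_apply_apply hag, dilate_apply, smul_eq_mul]
  have h1 := pow_mul_norm_fourier_le f k (-y)
  rw [← integral_mul_phase_eq_fourier, norm_neg] at h1
  have h2 : ∫ ξ, ψ (δ • ξ) * (g ξ * phase y ξ) * w (r • ξ) = ∫ ξ, f ξ * phase y ξ := by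
    congr 1 with ξ
    rw [hfa]; ring
  rw [h2]
  refine h1.trans ?_
  have h3 : ∀ ξ : V, ‖iteratedFDeriv ℝ k f ξ‖ ≤ |r| ^ N * M * (1 + ‖ξ‖) ^ (-d) := by
    intro ξ
    have := hs.bound k ξ
    rw [mulConst_smul, ← hfa] at this
    have hpos : 0 < 1 + ‖ξ‖ := by positivity
    rw [Real.rpow_neg hpos.le, hd, show ((Module.finrank ℝ V : ℝ) + 1) =
      ((Module.finrank ℝ V + 1 : ℕ) : ℝ) by push_cast; ring, Real.rpow_natCast,
      ← div_eq_mul_inv, le_div_iff₀ (by positivity)]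
    rw [hk, pow_add] at this
    refine le_of_mul_le_mul_left ?_ (show 0 < (1 + ‖ξ‖) ^ N by positivity)
    linarith
  calc ∫ ξ, ‖iteratedFDeriv ℝ k f ξ‖ ≤ ∫ ξ, |r| ^ N * M * (1 + ‖ξ‖) ^ (-d) :=
        integral_mono (by simpa using f.integrable_pow_mul_iteratedFDeriv volume 0 k)
          (hint.const_mul _) h3
    _ = _ := by rw [integral_const_mul]; ring

/-- The integral `∫ g(ξ) e^{2iπ⟨y,ξ⟩} w(rξ) dξ`. -/
def kernelInt (g : V → ℂ) (y : V) (w : V → ℂ) (r : ℝ) : ℂ := ∫ ξ, g ξ * phase y ξ * w (r • ξ)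

theorem integral_norm_dilate (w : 𝓢(V, ℂ)) (r : ℝ) :
    ∫ ξ, ‖w (r • ξ)‖ = (|r| ^ Module.finrank ℝ V)⁻¹ * ∫ ξ, ‖w ξ‖ := by
  rw [Measure.integral_comp_smul volume (fun ξ => ‖w ξ‖) r, smul_eq_mul, abs_inv, abs_pow]

/-- Absolute convergence of the double integral which is the pairing of the homogeneous function
`∫ |r|_ε^β w(rξ) dr` with a rapidly decreasing function. -/
theorem integrable_absPow_mul_dilate {N : ℕ} (w φ : 𝓢(V, ℂ))
    (hw : VanishesToOrder N (w : V → ℂ)) (ε : Fin 2) (β : ℂ) (h₁ : -1 < N + β.re)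
    (h₂ : β.re - Module.finrank ℝ V < -1) {b : V → ℂ} (hb : Continuous b) {M : ℝ}
    (hM : ∀ ξ, ‖b ξ‖ ≤ M) :
    Integrable (fun p : ℝ × V => absPow ε β p.1 * (φ p.2 * b p.2 * w (p.1 • p.2)))
      (volume.prod volume) := by
  have hM0 : 0 ≤ M := (norm_nonneg _).trans (hM 0)
  obtain ⟨C, hC0, hC⟩ := hw.norm_le
  obtain ⟨Cφ, hCφ0, hCφ⟩ := (vanishesToOrder_zero φ).norm_le
  simp only [pow_zero, mul_one] at hCφ
  have hmeas : AEStronglyMeasurable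
      (fun p : ℝ × V => absPow ε β p.1 * (φ p.2 * b p.2 * w (p.1 • p.2)))
      (volume.prod volume) := by
    refine AEStronglyMeasurable.mul ?_ (Continuous.aestronglyMeasurable ?_)
    · exact ((measurable_absPow ε β).comp measurable_fst).aestronglyMeasurable
    · have := w.continuous
      have := φ.continuous
      fun_prop
  have hpt : ∀ (r : ℝ) (ξ : V), ‖φ ξ * b ξ * w (r • ξ)‖ ≤ (C * |r| ^ N * M) * (‖ξ‖ ^ N * ‖φ ξ‖) := by
    intro r ξ
    rw [norm_mul, norm_mul]
    calc ‖φ ξ‖ * ‖b ξ‖ * ‖w (r • ξ)‖ ≤ ‖φ ξ‖ * M * (C * ‖r • ξ‖ ^ N) := by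
          gcongr
          · exact hM ξ
          · exact hC _
      _ = _ := by rw [norm_smul, mul_pow, Real.norm_eq_abs]; ring
  have hpt2 : ∀ (r : ℝ) (ξ : V), ‖φ ξ * b ξ * w (r • ξ)‖ ≤ (Cφ * M) * ‖w (r • ξ)‖ := by
    intro r ξ
    rw [norm_mul, norm_mul]
    gcongr
    · exact hCφ ξ
    · exact hM ξ
  have hintφ := φ.integrable_pow_mul volume N
  have hintr : ∀ r : ℝ, Integrable (fun ξ => φ ξ * b ξ * w (r • ξ)) := fun r => by
    refine (hintφ.const_mul (C * |r| ^ N * M)).mono' ?_ (Eventually.of_forall (hpt r))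
    have := w.continuous
    have := φ.continuous
    exact Continuous.aestronglyMeasurable (by fun_prop)
  refine (integrable_prod_iff hmeas).mpr ⟨Eventually.of_forall fun r =>
    (hintr r).const_mul (absPow ε β r), ?_⟩
  refine (integrable_of_le_rpow (hmeas.norm.integral_prod_right') h₁ h₂
    (C₁ := C * M * ∫ ξ, ‖ξ‖ ^ N * ‖φ ξ‖) (C₂ := Cφ * M * ∫ ξ, ‖w ξ‖) ?_ ?_).1
  · intro r hr _
    have h0 : 0 < |r| := abs_pos.mpr hr
    rw [Real.norm_of_nonneg (by positivity)]
    calc ∫ ξ, ‖absPow ε β r * (φ ξ * b ξ * w (r • ξ))‖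
        ≤ ∫ ξ, |r| ^ β.re * ((C * |r| ^ N * M) * (‖ξ‖ ^ N * ‖φ ξ‖)) := by
          refine integral_mono ((hintr r).const_mul _).norm ((hintφ.const_mul _).const_mul _)
            fun ξ => ?_
          simp only
          rw [norm_mul, norm_absPow ε β hr]
          gcongr
          exact hpt r ξ
      _ = _ := by
          rw [integral_const_mul, integral_const_mul, Real.rpow_add h0, Real.rpow_natCast]; ring
  · intro r hr
    have h0 : 0 < |r| := by linarith
    have hr0 : r ≠ 0 := abs_pos.mp h0
    rw [Real.norm_of_nonneg (by positivity)]
    calc ∫ ξ, ‖absPow ε β r * (φ ξ * b ξ * w (r • ξ))‖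
        ≤ ∫ ξ, |r| ^ β.re * ((Cφ * M) * ‖w (r • ξ)‖) := by
          refine integral_mono ((hintr r).const_mul _).norm
            (((w.integrable.norm.comp_smul hr0).const_mul _).const_mul _) fun ξ => ?_
          simp only
          rw [norm_mul, norm_absPow ε β hr0]
          gcongr
          exact hpt2 r ξ
      _ = _ := by
          rw [integral_const_mul, integral_const_mul, integral_norm_dilate, Real.rpow_sub h0,
            Real.rpow_natCast]; ring

/-- The truncated kernels `∫ ψ(δξ) g(ξ) e^{2iπ⟨y,ξ⟩} w(rξ) dξ` have a majorant which is
integrable with respect to `|r|^{Re β} dr`, and uniform with respect to `δ`, to `g`, and to `y` on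
the unit sphere. -/
theorem exists_majorant {N : ℕ} (w ψ : 𝓢(V, ℂ)) (hw : VanishesToOrder N (w : V → ℂ)) (ε : Fin 2)
    (β : ℂ) (Cg : ℕ → ℝ) : ∃ C, ∀ g : V → ℂ, IsSymb 0 Cg g → ∀ y : V, y ≠ 0 →
    ∀ δ : ℝ, |δ| ≤ 1 → ∀ r : ℝ, r ≠ 0 →
    ‖absPow ε β r * ∫ ξ, ψ (δ • ξ) * (g ξ * phase y ξ) * w (r • ξ)‖ ≤
      max (C / ‖y‖ ^ (N + (Module.finrank ℝ V + 1))) C *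
        twoPow (N + β.re) (β.re - Module.finrank ℝ V) r := by
  obtain ⟨C, hC⟩ := exists_kernel_bound ψ w hw Cg
  obtain ⟨Cψ, hCψ0, hCψ⟩ := (vanishesToOrder_zero ψ).norm_le
  simp only [pow_zero, mul_one] at hCψ
  set D := Cψ * Cg 0 * ∫ ξ, ‖w ξ‖ with hD
  refine ⟨max C D, fun g hg y hy δ hδ r hr => ?_⟩
  have hy0 : 0 < ‖y‖ ^ (N + (Module.finrank ℝ V + 1)) := by positivity
  have h0 : 0 < |r| := abs_pos.mpr hr
  have hCg := hg.nonneg 0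
  rw [norm_mul, norm_absPow ε β hr]
  unfold twoPow
  split_ifs with h
  · have h1 := hC g hg y δ r hδ hr h
    rw [← le_div_iff₀' hy0] at h1
    calc _ ≤ |r| ^ β.re * (C * |r| ^ N / ‖y‖ ^ (N + (Module.finrank ℝ V + 1))) := by gcongr
      _ = (C / ‖y‖ ^ (N + (Module.finrank ℝ V + 1))) * |r| ^ (N + β.re) := by
          rw [Real.rpow_add h0, Real.rpow_natCast]; ring
      _ ≤ _ := by
          gcongr
          refine le_trans ?_ (le_max_left _ _)
          gcongr
          exact le_max_left _ _
  · have h1 : ‖∫ ξ, ψ (δ • ξ) * (g ξ * phase y ξ) * w (r • ξ)‖ ≤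
        ∫ ξ, Cψ * Cg 0 * ‖w (r • ξ)‖ := by
      refine norm_integral_le_of_norm_le ((w.integrable.norm.comp_smul hr).const_mul _)
        (Eventually.of_forall fun ξ => ?_)
      rw [norm_mul, norm_mul, norm_mul, norm_phase, mul_one]
      gcongr
      · exact hCψ _
      · exact hg.norm_le ξ
    rw [integral_const_mul, integral_norm_dilate] at h1
    calc _ ≤ |r| ^ β.re * (Cψ * Cg 0 * ((|r| ^ Module.finrank ℝ V)⁻¹ * ∫ ξ, ‖w ξ‖)) := by gcongr
      _ = D * |r| ^ (β.re - Module.finrank ℝ V) := by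
          rw [Real.rpow_sub h0, Real.rpow_natCast, hD]; ring
      _ ≤ _ := by
          gcongr
          exact (le_max_right _ _).trans (le_max_right _ _)

/-- Pairing with the homogeneous function `∫ |r|_ε^β w(rξ) dr`. -/
theorem integrable_and_integral_pairing {N : ℕ} {w : 𝓢(V, ℂ)}
    (hw : VanishesToOrder N (w : V → ℂ)) (ε : Fin 2) {β : ℂ} (h₁ : -1 < N + β.re)
    (h₂ : β.re - Module.finrank ℝ V < -1) (φ : 𝓢(V, ℂ)) {b : V → ℂ} (hb : Continuous b) {M : ℝ}
    (hM : ∀ ξ, ‖b ξ‖ ≤ M) :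
    Integrable (fun ξ => φ ξ * (b ξ * ∫ r : ℝ, absPow ε β r * w (r • ξ))) ∧
    ∫ ξ, φ ξ * (b ξ * ∫ r : ℝ, absPow ε β r * w (r • ξ)) =
      ∫ r : ℝ, absPow ε β r * ∫ ξ, φ ξ * b ξ * w (r • ξ) := by
  have hint := integrable_absPow_mul_dilate w φ hw ε β h₁ h₂ hb hM
  have he : (fun ξ => φ ξ * (b ξ * ∫ r : ℝ, absPow ε β r * w (r • ξ))) =
      fun ξ => ∫ r : ℝ, absPow ε β r * (φ ξ * b ξ * w (r • ξ)) := by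
    ext ξ
    rw [← mul_assoc, ← integral_const_mul]
    congr 1 with r
    ring
  constructor
  · rw [he]
    exact hint.swap.integral_prod_left
  · rw [he, ← integral_integral_swap hint]
    congr 1 with r
    rw [integral_const_mul]

/-- The truncated integral of a symbol times an exponential times a homogeneous function. -/
theorem integral_truncated_eq {N : ℕ} {w : 𝓢(V, ℂ)}
    (hw : VanishesToOrder N (w : V → ℂ)) (ε : Fin 2) {β : ℂ}
    (h₁ : -1 < N + β.re) (h₂ : β.re - Module.finrank ℝ V < -1) {Cg : ℕ → ℝ} {g : V → ℂ}
    (hg : IsSymb 0 Cg g) (y : V) (ψ : 𝓢(V, ℂ)) {δ : ℝ} (hδ : 0 < δ) :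
    Integrable (fun ξ => ψ (δ • ξ) * (g ξ * phase y ξ * ∫ r : ℝ, absPow ε β r * w (r • ξ))) ∧
    ∫ ξ, ψ (δ • ξ) * (g ξ * phase y ξ * ∫ r : ℝ, absPow ε β r * w (r • ξ)) =
      ∫ r : ℝ, absPow ε β r * ∫ ξ, ψ (δ • ξ) * (g ξ * phase y ξ) * w (r • ξ) :=
  integrable_and_integral_pairing hw ε h₁ h₂ (dilate δ hδ.ne' ψ)
    (continuous_mul_phase hg.smooth.continuous y) (hg.norm_mul_phase_le y)

theorem aestronglyMeasurable_kernel {N : ℕ} {w : 𝓢(V, ℂ)}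
    (hw : VanishesToOrder N (w : V → ℂ)) (ε : Fin 2) {β : ℂ}
    (h₁ : -1 < N + β.re) (h₂ : β.re - Module.finrank ℝ V < -1) {Cg : ℕ → ℝ} {g : V → ℂ}
    (hg : IsSymb 0 Cg g) (y : V) (ψ : 𝓢(V, ℂ)) {δ : ℝ} (hδ : 0 < δ) :
    AEStronglyMeasurable
      (fun r => absPow ε β r * ∫ ξ, ψ (δ • ξ) * (g ξ * phase y ξ) * w (r • ξ)) volume := by
  have h := (integrable_absPow_mul_dilate w (dilate δ hδ.ne' ψ) hw ε β h₁ h₂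
    (continuous_mul_phase hg.smooth.continuous y)
    (hg.norm_mul_phase_le y)).integral_prod_left.aestronglyMeasurable
  simpa only [integral_const_mul, dilate_apply] using h

/-- The oscillatory integral of a symbol times an exponential times a homogeneous function. The
homogeneous function is a superposition of dilated Schwartz functions `w(r ·)`; after an exchange of
integrals the inner one converges absolutely, and dominated convergence applies to the outer one. -/
theorem hasOscIntegral_symbol_mul_phase_mul_homogeneous {N : ℕ} {w : 𝓢(V, ℂ)}
    (hw : VanishesToOrder N (w : V → ℂ)) (ε : Fin 2) {β : ℂ}
    (h₁ : -1 < N + β.re) (h₂ : β.re - Module.finrank ℝ V < -1) {Cg : ℕ → ℝ} {g : V → ℂ}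
    (hg : IsSymb 0 Cg g) {y : V} (hy : y ≠ 0) :
    HasOscIntegral (fun ξ => g ξ * phase y ξ * ∫ r : ℝ, absPow ε β r * w (r • ξ))
      (∫ r, absPow ε β r * kernelInt g y w r) := by
  have hlim : ∀ ψ : 𝓢(V, ℂ), ψ 0 = 1 → ∀ r : ℝ, r ≠ 0 →
      Tendsto (fun δ : ℝ => absPow ε β r * ∫ ξ, ψ (δ • ξ) * (g ξ * phase y ξ) * w (r • ξ))
        (𝓝[>] 0) (𝓝 (absPow ε β r * kernelInt g y w r)) := by
    intro ψ hψ r hr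
    obtain ⟨Cψ, hCψ0, hCψ⟩ := (vanishesToOrder_zero ψ).norm_le
    simp only [pow_zero, mul_one] at hCψ
    refine Tendsto.const_mul _ (tendsto_integral_filter_of_dominated_convergence
      (fun ξ => Cψ * Cg 0 * ‖w (r • ξ)‖) ?_ ?_ ?_ ?_)
    · have := w.continuous
      have := ψ.continuous
      have := continuous_mul_phase hg.smooth.continuous y
      exact Eventually.of_forall fun δ => Continuous.aestronglyMeasurable (by fun_prop)
    · refine Eventually.of_forall fun δ => Eventually.of_forall fun ξ => ?_
      rw [norm_mul, norm_mul]
      gcongr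
      · exact hCψ _
      · exact hg.norm_mul_phase_le y ξ
    · exact (w.integrable.norm.comp_smul hr).const_mul _
    · refine Eventually.of_forall fun ξ => ?_
      have h1 : Tendsto (fun δ : ℝ => ψ (δ • ξ)) (𝓝[>] 0) (𝓝 1) := by
        have : Continuous fun δ : ℝ => ψ (δ • ξ) := ψ.continuous.comp (by fun_prop)
        have h2 := this.tendsto 0
        rw [zero_smul, hψ] at h2
        exact h2.mono_left nhdsWithin_le_nhds
      simpa using (h1.mul_const (g ξ * phase y ξ)).mul_const (w (r • ξ))
  intro ψ hψ
  refine ⟨fun δ hδ => (integral_truncated_eq hw ε h₁ h₂ hg y ψ hδ).1, ?_⟩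
  obtain ⟨C, hC⟩ := exists_majorant w ψ hw ε β Cg
  have hev : ∀ᶠ δ : ℝ in 𝓝[>] 0, 0 < δ ∧ δ ≤ 1 := by
    filter_upwards [Ioc_mem_nhdsGT (zero_lt_one' ℝ)] with δ hδ using hδ
  have : Tendsto (fun δ : ℝ =>
      ∫ r : ℝ, absPow ε β r * ∫ ξ, ψ (δ • ξ) * (g ξ * phase y ξ) * w (r • ξ))
      (𝓝[>] 0) (𝓝 (∫ r, absPow ε β r * kernelInt g y w r)) := by
    refine tendsto_integral_filter_of_dominated_convergence _ ?_ ?_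
      ((integrable_twoPow h₁ h₂).const_mul
        (max (C / ‖y‖ ^ (N + (Module.finrank ℝ V + 1))) C)) ?_
    · filter_upwards [hev] with δ hδ using aestronglyMeasurable_kernel hw ε h₁ h₂ hg y ψ hδ.1
    · filter_upwards [hev] with δ hδ
      filter_upwards [ae_ne_zero_real] with r hr
      exact hC g hg y hy δ (by rw [abs_of_pos hδ.1]; exact hδ.2) r hr
    · filter_upwards [ae_ne_zero_real] with r hr using hlim ψ hψ r hr
  refine this.congr' ?_
  filter_upwards [hev] with δ hδ using (integral_truncated_eq hw ε h₁ h₂ hg y ψ hδ.1).2.symm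

/-- A bound for truncated oscillatory integrals which is uniform with respect to the symbol. -/
theorem exists_truncated_bound {N : ℕ} {w : 𝓢(V, ℂ)}
    (hw : VanishesToOrder N (w : V → ℂ)) (ε : Fin 2) {β : ℂ}
    (h₁ : -1 < N + β.re) (h₂ : β.re - Module.finrank ℝ V < -1) (Cg : ℕ → ℝ) {y : V} (hy : y ≠ 0)
    (ψ : 𝓢(V, ℂ)) :
    ∃ M, ∀ g : V → ℂ, IsSymb 0 Cg g → ∀ δ : ℝ, 0 < δ → δ ≤ 1 →
      ‖∫ ξ, ψ (δ • ξ) * (g ξ * phase y ξ * ∫ r : ℝ, absPow ε β r * w (r • ξ))‖ ≤ M := by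
  obtain ⟨C, hC⟩ := exists_majorant w ψ hw ε β Cg
  refine ⟨∫ r, max (C / ‖y‖ ^ (N + (Module.finrank ℝ V + 1))) C *
    twoPow (N + β.re) (β.re - Module.finrank ℝ V) r, fun g hg δ hδ hδ1 => ?_⟩
  rw [(integral_truncated_eq hw ε h₁ h₂ hg y ψ hδ).2]
  refine norm_integral_le_of_norm_le ((integrable_twoPow h₁ h₂).const_mul _) ?_
  filter_upwards [ae_ne_zero_real] with r hr
  exact hC g hg y hy δ (by rwa [abs_of_pos hδ]) r hr

theorem exists_schwartz_apply_zero_eq_one (V : Type*) [NormedAddCommGroup V]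
    [InnerProductSpace ℝ V] [FiniteDimensional ℝ V] : ∃ ψ : 𝓢(V, ℂ), ψ 0 = 1 := by
  let b : ContDiffBump (0 : V) := ⟨1, 2, zero_lt_one, one_lt_two⟩
  have h1 : HasCompactSupport (fun x => ((b x : ℝ) : ℂ)) :=
    b.hasCompactSupport.comp_left (g := Complex.ofReal) Complex.ofReal_zero
  have h2 : ContDiff ℝ ∞ (fun x => ((b x : ℝ) : ℂ)) := Complex.ofRealCLM.contDiff.comp b.contDiff
  refine ⟨h1.toSchwartzMap h2, ?_⟩
  change ((b 0 : ℝ) : ℂ) = 1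
  rw [b.one_of_mem_closedBall (Metric.mem_closedBall_self zero_le_one)]
  simp

theorem HasOscIntegral.unique {F : V → ℂ} {J J' : ℂ} (h : HasOscIntegral F J)
    (h' : HasOscIntegral F J') : J = J' := by
  obtain ⟨ψ, hψ⟩ := exists_schwartz_apply_zero_eq_one V
  exact tendsto_nhds_unique (h ψ hψ).2 (h' ψ hψ).2

theorem HasOscIntegral.const_mul {F : V → ℂ} {J : ℂ} (h : HasOscIntegral F J) (c : ℂ) :
    HasOscIntegral (fun y => c * F y) (c * J) := by
  intro ψ hψ
  have h1 : ∀ δ : ℝ, (fun y => ψ (δ • y) * (c * F y)) = fun y => c * (ψ (δ • y) * F y) :=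
    fun δ => by ext y; ring
  simp only [h1, integral_const_mul]
  exact ⟨fun δ hδ => ((h ψ hψ).1 δ hδ).const_mul c, (h ψ hψ).2.const_mul c⟩

/-- The majorant for the kernels without truncation. -/
theorem exists_majorant_kernelInt {N : ℕ} (w : 𝓢(V, ℂ)) (hw : VanishesToOrder N (w : V → ℂ))
    (ε : Fin 2) (β : ℂ) (Cg : ℕ → ℝ) : ∃ C, ∀ g : V → ℂ, IsSymb 0 Cg g → ∀ y : V, y ≠ 0 →
    ∀ r : ℝ, r ≠ 0 → ‖absPow ε β r * kernelInt g y w r‖ ≤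
      max (C / ‖y‖ ^ (N + (Module.finrank ℝ V + 1))) C *
        twoPow (N + β.re) (β.re - Module.finrank ℝ V) r := by
  obtain ⟨ψ, hψ⟩ := exists_schwartz_apply_zero_eq_one V
  obtain ⟨C, hC⟩ := exists_majorant w ψ hw ε β Cg
  refine ⟨C, fun g hg y hy r hr => ?_⟩
  -- no truncation is the truncation with `δ = 0`
  simpa [hψ, kernelInt] using hC g hg y hy 0 (by simp) r hr

end Kernel

/-! ### Homogeneous components -/

section HomPart

variable {n : ℕ}

/-- The exponent `(n-1)/2 + iλ`. -/
def homExp (n : ℕ) (lam : ℝ) : ℂ := ((n : ℂ) - 1) / 2 + I * lam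

theorem homExp_re (n : ℕ) (lam : ℝ) : (homExp n lam).re = ((n : ℝ) - 1) / 2 := by
  simp [homExp]

theorem neg_one_lt_homExp_re (n : ℕ) (lam : ℝ) : -1 < (homExp n lam).re := by
  rw [homExp_re]
  have : (0 : ℝ) ≤ n := n.cast_nonneg
  linarith

theorem homExp_re_sub_lt (n : ℕ) (lam : ℝ) : (homExp n lam).re - ((n : ℝ) + 1) < -1 := by
  rw [homExp_re]
  have : (0 : ℝ) ≤ n := n.cast_nonneg
  linarith

theorem integrable_homIntegrand_of_le {v : E (n + 1) → ℂ} (hv : Continuous v) {C₀ C₁ : ℝ}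
    (h₀ : ∀ y, ‖v y‖ ≤ C₀) (h₁ : ∀ y, ‖y‖ ^ (n + 1) * ‖v y‖ ≤ C₁) (lam : ℝ) (ε : Fin 2)
    {x : E (n + 1)} (hx : x ≠ 0) : Integrable (homIntegrand lam ε v x) := by
  have hx0 : 0 < ‖x‖ := norm_pos_iff.mpr hx
  refine (integrable_of_le_rpow (a := (homExp n lam).re)
    (b := (homExp n lam).re - ((n : ℝ) + 1)) ?_ (neg_one_lt_homExp_re n lam)
    (homExp_re_sub_lt n lam) (C₁ := C₀) (C₂ := C₁ / ‖x‖ ^ (n + 1)) ?_ ?_).1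
  · exact (measurable_absPow _ _).aestronglyMeasurable.mul
      (hv.comp (by fun_prop : Continuous fun t : ℝ => t • x)).aestronglyMeasurable
  · intro t ht _
    rw [homIntegrand, norm_mul, norm_absPow _ _ ht, mul_comm C₀]
    exact mul_le_mul_of_nonneg_left (h₀ _) (by positivity)
  · intro t ht
    have h0 : 0 < |t| := by linarith
    rw [homIntegrand, norm_mul, norm_absPow _ _ (abs_pos.mp h0), Real.rpow_sub h0]
    have h2 : ‖v (t • x)‖ ≤ C₁ / ‖x‖ ^ (n + 1) / |t| ^ (n + 1) := by
      rw [div_div, le_div_iff₀' (by positivity), ← mul_pow, mul_comm ‖x‖, ← Real.norm_eq_abs,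
        ← norm_smul]
      exact h₁ _
    rw [show ((n : ℝ) + 1) = ((n + 1 : ℕ) : ℝ) by push_cast; ring, Real.rpow_natCast]
    calc _ ≤ |t| ^ (homExp n lam).re * (C₁ / ‖x‖ ^ (n + 1) / |t| ^ (n + 1)) :=
          mul_le_mul_of_nonneg_left h2 (by positivity)
      _ = _ := by ring

theorem integrable_homIntegrand (v : 𝓢(E (n + 1), ℂ)) (lam : ℝ) (ε : Fin 2)
    {x : E (n + 1)} (hx : x ≠ 0) : Integrable (homIntegrand lam ε v x) := by
  obtain ⟨C₀, _, h₀⟩ := v.decay 0 0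
  obtain ⟨C₁, _, h₁⟩ := v.decay (n + 1) 0
  simp only [pow_zero, one_mul, norm_iteratedFDeriv_zero] at h₀ h₁
  exact integrable_homIntegrand_of_le v.continuous h₀ h₁ lam ε hx

/-- `v_{iλ,ε}` is homogeneous of degree `-(n+1)/2 - iλ` and of parity `ε`. -/
theorem homPart_smul (lam : ℝ) (ε : Fin 2) (v : E (n + 1) → ℂ) {t : ℝ} (ht : t ≠ 0)
    (x : E (n + 1)) :
    homPart lam ε v (t • x) = absPow ε (-((n : ℂ) + 1) / 2 - I * lam) t * homPart lam ε v x := by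
  have h : ∀ r : ℝ, homIntegrand lam ε v (t • x) r =
      absPow ε (homExp n lam) t⁻¹ * homIntegrand lam ε v x (r * t) := by
    intro r
    rw [homIntegrand, homIntegrand, ← homExp, smul_smul, ← mul_assoc, ← absPow_mul]
    congr 2
    field_simp
  have h0 : ((|t| : ℝ) : ℂ) ≠ 0 := by simpa using ht
  rw [homPart, homPart, integral_congr_ae (Eventually.of_forall h), integral_const_mul,
    Measure.integral_comp_mul_right, absPow_inv,
    show -((n : ℂ) + 1) / 2 - I * lam = -homExp n lam + (-1) by rw [homExp]; ring,
    absPow_add _ _ _ ht, Complex.cpow_neg_one, abs_inv, Complex.real_smul, Complex.ofReal_inv]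
  ring

end HomPart

/-! ### Smoothness of homogeneous components -/

section Smoothness

variable {V F : Type} [NormedAddCommGroup V] [NormedSpace ℝ V]
    [NormedAddCommGroup F] [NormedSpace ℝ F]

theorem exists_norm_dilate_le_twoPow (v : 𝓢(V, F)) (M : ℕ) {ρ : ℝ} (hρ : 0 < ρ) :
    ∃ D, 0 ≤ D ∧ ∀ t : ℝ, ∀ x : V, ρ ≤ ‖x‖ → ‖v (t • x)‖ ≤ D * twoPow 0 (-M) t := by
  obtain ⟨C₀, hC₀, h₀⟩ := v.decay 0 0
  obtain ⟨C₁, hC₁, h₁⟩ := v.decay M 0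
  simp only [pow_zero, one_mul, norm_iteratedFDeriv_zero] at h₀ h₁
  refine ⟨max C₀ (C₁ / ρ ^ M), le_max_of_le_left hC₀.le, fun t x hx => ?_⟩
  unfold twoPow
  split_ifs with h
  · rw [Real.rpow_zero, mul_one]
    exact (h₀ _).trans (le_max_left _ _)
  · have h0 : 0 < |t| := by linarith
    refine le_trans ?_ (mul_le_mul_of_nonneg_right (le_max_right _ _) (by positivity))
    rw [Real.rpow_neg h0.le, Real.rpow_natCast, div_mul_eq_mul_div, le_div_iff₀' (by positivity),
      ← div_eq_mul_inv, le_div_iff₀ (by positivity)]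
    calc ρ ^ M * ‖v (t • x)‖ * |t| ^ M ≤ ‖x‖ ^ M * ‖v (t • x)‖ * |t| ^ M := by gcongr
      _ = ‖t • x‖ ^ M * ‖v (t • x)‖ := by rw [norm_smul, mul_pow, Real.norm_eq_abs]; ring
      _ ≤ C₁ := h₁ _

theorem continuous_smul_const_real (x : V) : Continuous fun t : ℝ => t • x := by fun_prop

variable {k : ℝ → ℝ} {b : ℝ}

theorem exists_norm_le_twoPow_of_lt (b : ℝ) : ∃ M : ℕ, b - M < -1 := by
  obtain ⟨M, hM⟩ := exists_nat_gt (b + 1)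
  exact ⟨M, by linarith⟩

/-- Differentiation under the integral sign in `∫ k(t) v(tx) dt`. -/
theorem hasFDerivAt_integral_dilate (hk : Measurable k) (hb : -1 < b)
    (hkb : ∀ t, t ≠ 0 → |k t| ≤ |t| ^ b) (v : 𝓢(V, F)) {x₀ : V} (hx₀ : x₀ ≠ 0) :
    HasFDerivAt (fun x => ∫ t : ℝ, k t • v (t • x))
      (∫ t : ℝ, (k t * t) • SchwartzMap.fderivCLM ℝ V F v (t • x₀)) x₀ := by
  have hx0 : 0 < ‖x₀‖ := norm_pos_iff.mpr hx₀
  set Dv := SchwartzMap.fderivCLM ℝ V F v with hDv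
  obtain ⟨M, hM⟩ := exists_norm_le_twoPow_of_lt (b + 1)
  obtain ⟨D, hD0, hD⟩ := exists_norm_dilate_le_twoPow v M (half_pos hx0)
  obtain ⟨D', hD'0, hD'⟩ := exists_norm_dilate_le_twoPow Dv M (half_pos hx0)
  have hmeas : ∀ x, AEStronglyMeasurable (fun t : ℝ => k t • v (t • x)) volume := fun x =>
    hk.aestronglyMeasurable.smul (v.continuous.comp (continuous_smul_const_real x)).aestronglyMeasurable
  have hball : ∀ x ∈ Metric.ball x₀ (‖x₀‖ / 2), ‖x₀‖ / 2 ≤ ‖x‖ := by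
    intro x hx
    have h1 : ‖x₀‖ ≤ ‖x‖ + ‖x - x₀‖ := by
      have := norm_sub_le x (x - x₀)
      simpa using this
    have h2 : ‖x - x₀‖ < ‖x₀‖ / 2 := by simpa [dist_eq_norm] using hx
    linarith
  refine hasFDerivAt_integral_of_dominated_of_fderiv_le (Metric.ball_mem_nhds x₀ (half_pos hx0))
    (F := fun x t => k t • v (t • x)) (F' := fun x t => (k t * t) • Dv (t • x))
    (bound := fun t => D' * twoPow (b + 1) (b + 1 - M) t) (Eventually.of_forall hmeas) ?_ ?_ ?_ ?_ ?_
  · refine ((integrable_twoPow hb (show b - M < -1 by linarith)).const_mul D).mono'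
      (hmeas x₀) ?_
    filter_upwards [ae_ne_zero_real] with t ht
    rw [norm_smul, Real.norm_eq_abs]
    calc |k t| * ‖v (t • x₀)‖ ≤ |t| ^ b * (D * twoPow 0 (-M) t) :=
          mul_le_mul (hkb t ht) (hD t x₀ (by linarith)) (norm_nonneg _) (by positivity)
      _ = D * (|t| ^ b * twoPow 0 (-M) t) := by ring
      _ = _ := by rw [rpow_mul_twoPow _ _ _ ht, add_zero, ← sub_eq_add_neg]
  · exact (hk.mul measurable_id).aestronglyMeasurable.smul
      (Dv.continuous.comp (continuous_smul_const_real x₀)).aestronglyMeasurable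
  · filter_upwards [ae_ne_zero_real] with t ht x hx
    rw [norm_smul, Real.norm_eq_abs, abs_mul]
    calc |k t| * |t| * ‖Dv (t • x)‖ ≤ |t| ^ b * |t| * (D' * twoPow 0 (-M) t) := by
          have := twoPow_nonneg 0 (-(M : ℝ)) t
          gcongr
          · exact hkb t ht
          · exact hD' t x (hball x hx)
      _ = D' * (|t| ^ (b + 1) * twoPow 0 (-M) t) := by
          rw [Real.rpow_add (abs_pos.mpr ht), Real.rpow_one]; ring
      _ = _ := by rw [rpow_mul_twoPow _ _ _ ht, add_zero, ← sub_eq_add_neg]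
  · exact (integrable_twoPow (by linarith) hM).const_mul D'
  · refine Eventually.of_forall fun t x _ => ?_
    have h1 : HasFDerivAt (fun x : V => t • x) (t • ContinuousLinearMap.id ℝ V) x :=
      (hasFDerivAt_id x).const_smul t
    have h2 := ((v.differentiableAt (x := t • x)).hasFDerivAt.comp x h1).const_smul (k t)
    refine h2.congr_fderiv ?_
    rw [hDv, SchwartzMap.fderivCLM_apply]
    ext z
    simp [mul_smul]

theorem contDiffOn_integral_dilate (m : ℕ) : ∀ {F : Type} [NormedAddCommGroup F] [NormedSpace ℝ F]
    {k : ℝ → ℝ} {b : ℝ} (_ : Measurable k) (_ : -1 < b)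
    (_ : ∀ t, t ≠ 0 → |k t| ≤ |t| ^ b) (v : 𝓢(V, F)),
    ContDiffOn ℝ m (fun x => ∫ t : ℝ, k t • v (t • x)) {0}ᶜ := by
  induction m with
  | zero =>
    intro F _ _ k b hk hb hkb v
    exact contDiffOn_zero.mpr fun x hx =>
      (hasFDerivAt_integral_dilate hk hb hkb v hx).continuousAt.continuousWithinAt
  | succ m ih =>
    intro F _ _ k b hk hb hkb v
    rw [Nat.cast_succ, contDiffOn_succ_iff_fderiv_of_isOpen isOpen_compl_singleton]
    refine ⟨fun x hx => (hasFDerivAt_integral_dilate hk hb hkb v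
      hx).differentiableAt.differentiableWithinAt, by simp, ?_⟩
    refine (ih (k := fun t => k t * t) (b := b + 1) (hk.mul measurable_id) (by linarith)
      (fun t ht => ?_) (SchwartzMap.fderivCLM ℝ V F v)).congr fun x hx => ?_
    · rw [abs_mul, Real.rpow_add (abs_pos.mpr ht), Real.rpow_one]
      gcongr
      exact hkb t ht
    · exact (hasFDerivAt_integral_dilate hk hb hkb v hx).fderiv

end Smoothness

section HomPart

variable {n : ℕ}

/-- The homogeneous components of a Schwartz function are smooth away from the origin. -/
theorem contDiffOn_homPart (lam : ℝ) (ε : Fin 2) (v : 𝓢(E (n + 1), ℂ)) :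
    ContDiffOn ℝ ∞ (homPart lam ε v) {0}ᶜ := by
  rw [contDiffOn_infty]
  intro m
  have hk := measurable_absPow ε (homExp n lam)
  have hb : ∀ t : ℝ, t ≠ 0 → ‖absPow ε (homExp n lam) t‖ ≤ |t| ^ (homExp n lam).re :=
    fun t ht => (norm_absPow ε _ ht).le
  -- real and imaginary parts of the kernel are treated separately: derivatives take values in spaces
  -- of real-linear maps
  have h1 := contDiffOn_integral_dilate (V := E (n + 1)) m
    (k := fun t => (absPow ε (homExp n lam) t).re)
    (Complex.measurable_re.comp hk) (neg_one_lt_homExp_re n lam)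
    (fun t ht => (Complex.abs_re_le_norm _).trans (hb t ht)) v
  have h2 := contDiffOn_integral_dilate (V := E (n + 1)) m
    (k := fun t => (absPow ε (homExp n lam) t).im)
    (Complex.measurable_im.comp hk) (neg_one_lt_homExp_re n lam)
    (fun t ht => (Complex.abs_im_le_norm _).trans (hb t ht)) v
  refine ((contDiffOn_const (c := (1 / (4 * Real.pi) : ℂ))).mul
    (h1.add ((contDiffOn_const (c := I)).mul h2))).congr fun x hx => ?_
  have hint := integrable_homIntegrand v lam ε hx
  have hre : Integrable (fun t : ℝ => (absPow ε (homExp n lam) t).re • v (t • x)) := by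
    refine hint.mono ((Complex.measurable_re.comp hk).aestronglyMeasurable.smul
      (v.continuous.comp (continuous_smul_const_real x)).aestronglyMeasurable)
      (Eventually.of_forall fun t => ?_)
    rw [homIntegrand, norm_mul, norm_smul]
    gcongr
    exact Complex.abs_re_le_norm _
  have him : Integrable (fun t : ℝ => (absPow ε (homExp n lam) t).im • v (t • x)) := by
    refine hint.mono ((Complex.measurable_im.comp hk).aestronglyMeasurable.smul
      (v.continuous.comp (continuous_smul_const_real x)).aestronglyMeasurable)
      (Eventually.of_forall fun t => ?_)
    rw [homIntegrand, norm_mul, norm_smul]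
    gcongr
    exact Complex.abs_im_le_norm _
  rw [homPart, ← integral_const_mul I, ← integral_add hre (him.const_mul I)]
  congr 2 with t
  rw [homIntegrand, ← homExp, Complex.real_smul, Complex.real_smul]
  linear_combination (-v (t • x)) * Complex.re_add_im (absPow ε (homExp n lam) t)

theorem continuousOn_homPart (lam : ℝ) (ε : Fin 2) (v : 𝓢(E (n + 1), ℂ)) :
    ContinuousOn (homPart lam ε v) {0}ᶜ := (contDiffOn_homPart lam ε v).continuousOn

end HomPart

/-! ### The change of variable `t ↦ 1/t` -/

section ChangeOfVariables

/-- The change of variable `t ↦ 1/t`. -/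
theorem integrable_and_integral_comp_inv (f : ℝ → ℂ) :
    (Integrable (fun t : ℝ => ((|t| : ℝ) : ℂ) ^ (-2 : ℂ) * f t⁻¹) ↔ Integrable f) ∧
    ∫ t : ℝ, ((|t| : ℝ) : ℂ) ^ (-2 : ℂ) * f t⁻¹ = ∫ t, f t := by
  have hd : ∀ t ∈ ({0}ᶜ : Set ℝ), HasDerivWithinAt (fun t : ℝ => t⁻¹) (-(t ^ 2)⁻¹) {0}ᶜ t :=
    fun t ht => (hasDerivAt_inv ht).hasDerivWithinAt
  have hinj : Set.InjOn (fun t : ℝ => t⁻¹) {0}ᶜ := inv_injective.injOn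
  have himg : (fun t : ℝ => t⁻¹) '' {0}ᶜ = {0}ᶜ := by
    ext t
    simp only [Set.mem_image, Set.mem_compl_iff, Set.mem_singleton_iff]
    exact ⟨fun ⟨s, hs, h⟩ => h ▸ inv_ne_zero hs, fun ht => ⟨t⁻¹, inv_ne_zero ht, inv_inv t⟩⟩
  have hae : (({0}ᶜ : Set ℝ)) =ᵐ[volume] Set.univ := by
    rw [eventuallyEq_univ]
    exact ae_ne_zero_real
  have hms : MeasurableSet ({0}ᶜ : Set ℝ) := (measurableSet_singleton 0).compl
  have he : ∀ t : ℝ, |(-(t ^ 2)⁻¹)| • f t⁻¹ = ((|t| : ℝ) : ℂ) ^ (-2 : ℂ) * f t⁻¹ := by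
    intro t
    rw [Complex.real_smul, abs_neg, abs_inv, abs_pow, Complex.cpow_neg]
    push_cast
    norm_num
  have h1 := integral_image_eq_integral_abs_deriv_smul hms hd hinj f
  have h2 := integrableOn_image_iff_integrableOn_abs_deriv_smul hms hd hinj f
  simp only [he, himg] at h1 h2
  rw [integrableOn_congr_set_ae hae, integrableOn_congr_set_ae hae, integrableOn_univ,
    integrableOn_univ] at h2
  rw [setIntegral_congr_set hae, setIntegral_congr_set hae, setIntegral_univ, setIntegral_univ] at h1
  exact ⟨h2.symm, h1.symm⟩

theorem absPow_homExp_inv (n : ℕ) (lam : ℝ) (ε : Fin 2) (B : ℝ → ℂ) {t : ℝ} (ht : t ≠ 0) :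
    ((|t| : ℝ) : ℂ) ^ (-2 : ℂ) * (absPow ε (homExp n (-lam)) t⁻¹ * B t⁻¹) =
      absPow ε (homExp n lam) t * ((((|t| ^ (n + 1))⁻¹ : ℝ) : ℂ) * B t⁻¹) := by
  have h0 : ((|t| : ℝ) : ℂ) ≠ 0 := by simpa using ht
  rw [absPow_inv, show -homExp n (-lam) = homExp n lam + (-((n + 1 : ℕ) : ℂ) + 2) by
    rw [homExp, homExp]; push_cast; ring, absPow_add _ _ _ ht, Complex.cpow_add _ _ h0,
    Complex.cpow_neg _ ((n + 1 : ℕ) : ℂ), Complex.cpow_natCast, Complex.cpow_neg]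
  have h2 : ((|t| : ℝ) : ℂ) ^ (2 : ℂ) ≠ 0 := by
    rw [show (2 : ℂ) = ((2 : ℕ) : ℂ) by norm_num, Complex.cpow_natCast]
    exact pow_ne_zero _ h0
  push_cast
  field_simp

/-- The change of variable `t ↦ 1/t` in the integrals which define homogeneous components. -/
theorem integrable_and_integral_absPow_inv (n : ℕ) (lam : ℝ) (ε : Fin 2) (B : ℝ → ℂ) :
    (Integrable (fun t : ℝ => absPow ε (homExp n lam) t * ((((|t| ^ (n + 1))⁻¹ : ℝ) : ℂ) * B t⁻¹)) ↔
      Integrable (fun r : ℝ => absPow ε (homExp n (-lam)) r * B r)) ∧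
    ∫ t : ℝ, absPow ε (homExp n lam) t * ((((|t| ^ (n + 1))⁻¹ : ℝ) : ℂ) * B t⁻¹) =
      ∫ r : ℝ, absPow ε (homExp n (-lam)) r * B r := by
  obtain ⟨h1, h2⟩ := integrable_and_integral_comp_inv (fun r => absPow ε (homExp n (-lam)) r * B r)
  have hae : (fun t : ℝ => absPow ε (homExp n lam) t * ((((|t| ^ (n + 1))⁻¹ : ℝ) : ℂ) * B t⁻¹))
      =ᵐ[volume] fun t : ℝ => ((|t| : ℝ) : ℂ) ^ (-2 : ℂ) * (absPow ε (homExp n (-lam)) t⁻¹ * B t⁻¹) := by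
    filter_upwards [ae_ne_zero_real] with t ht using (absPow_homExp_inv n lam ε B ht).symm
  exact ⟨(integrable_congr hae).trans h1, (integral_congr_ae hae).trans h2⟩

end ChangeOfVariables

/-! ### Hyperplanes are negligible -/

section NullSets

variable {V : Type*} [NormedAddCommGroup V] [InnerProductSpace ℝ V] [FiniteDimensional ℝ V]
  [MeasurableSpace V] [BorelSpace V]

theorem ae_inner_ne_zero {y : V} (hy : y ≠ 0) : ∀ᵐ σ : V, (inner ℝ y σ : ℝ) ≠ 0 := by
  have h : (innerSL ℝ y).toLinearMap.ker ≠ ⊤ := by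
    intro h
    have : y ∈ (innerSL ℝ y).toLinearMap.ker := h ▸ Submodule.mem_top
    exact hy (inner_self_eq_zero.mp (LinearMap.mem_ker.mp this))
  have h0 := Measure.addHaar_submodule (volume : Measure V) _ h
  rw [ae_iff]
  refine measure_mono_null (fun σ hσ => ?_) h0
  simpa using hσ

theorem ae_one_add_inner_ne_zero (s : V) : ∀ᵐ σ : V, (1 + inner ℝ s σ : ℝ) ≠ 0 := by
  rcases eq_or_ne s 0 with rfl | hs
  · simp
  have hs0 : (inner ℝ s s : ℝ) ≠ 0 := inner_self_ne_zero.mpr hs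
  have h := ae_inner_ne_zero hs
  rw [ae_iff] at h ⊢
  set c : V := (inner ℝ s s : ℝ)⁻¹ • s
  have he : {σ : V | ¬ (1 + inner ℝ s σ : ℝ) ≠ 0} =
      (fun σ => σ + c) ⁻¹' {σ : V | ¬ (inner ℝ s σ : ℝ) ≠ 0} := by
    ext σ
    simp only [c, Set.mem_ofPred_eq, Set.mem_preimage, inner_add_right, inner_smul_right,
      inv_mul_cancel₀ hs0, add_comm]
  rw [he, measure_preimage_add_right]
  exact h

end NullSets

/-! ### Fourier transforms of homogeneous components -/

section HomPartFourier

variable {n : ℕ}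

theorem homPart_eq (lam : ℝ) (ε : Fin 2) (v : E (n + 1) → ℂ) (x : E (n + 1)) :
    homPart lam ε v x = 1 / (4 * Real.pi) * ∫ r : ℝ, absPow ε (homExp n lam) r * v (r • x) := rfl

theorem finrank_E (m : ℕ) : Module.finrank ℝ (E m) = m := by simp

theorem homExp_re_sub_finrank_lt (n : ℕ) (lam : ℝ) :
    (homExp n lam).re - Module.finrank ℝ (E (n + 1)) < -1 := by
  rw [finrank_E]; push_cast; exact homExp_re_sub_lt n lam

theorem neg_one_lt_zero_add_homExp_re (n : ℕ) (lam : ℝ) : -1 < ((0 : ℕ) : ℝ) + (homExp n lam).re := by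
  simpa using neg_one_lt_homExp_re n lam

theorem integrable_and_integral_homPart_mul (lam : ℝ) (ε : Fin 2) (v φ : 𝓢(E (n + 1), ℂ)) :
    Integrable (fun x => homPart lam ε v x * φ x) ∧
    ∫ x, homPart lam ε v x * φ x =
      1 / (4 * Real.pi) * ∫ r : ℝ, absPow ε (homExp n lam) r * ∫ x, φ x * v (r • x) := by
  obtain ⟨h1, h2⟩ := integrable_and_integral_pairing (vanishesToOrder_zero v) ε
    (neg_one_lt_zero_add_homExp_re n lam) (homExp_re_sub_finrank_lt n lam) φ
    (b := fun _ => 1) continuous_const (M := 1) (by simp)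
  simp only [one_mul, mul_one] at h1 h2
  have he : (fun x => homPart lam ε v x * φ x) = fun x => (1 / (4 * Real.pi) : ℂ) *
      (φ x * ∫ r : ℝ, absPow ε (homExp n lam) r * v (r • x)) := by
    ext x; rw [homPart_eq]; ring
  rw [he]
  refine ⟨h1.const_mul _, ?_⟩
  rw [integral_const_mul, h2]

theorem fourier_dilate (v : 𝓢(E (n + 1), ℂ)) {r : ℝ} (hr : r ≠ 0) (η : E (n + 1)) :
    𝓕 (dilate r hr v : E (n + 1) → ℂ) η =
      (((|r| ^ (n + 1))⁻¹ : ℝ) : ℂ) * 𝓕 (v : E (n + 1) → ℂ) (r⁻¹ • η) := by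
  rw [← neg_neg η, ← integral_mul_phase_eq_fourier, smul_neg, ← integral_mul_phase_eq_fourier]
  have h : ∀ ξ, dilate r hr v ξ * phase (-η) ξ =
      (fun z => v z * phase (r⁻¹ • -η) z) (r • ξ) := by
    intro ξ
    simp only [dilate_apply, phase, inner_smul_left, inner_smul_right]
    congr 4
    simp only [conj_trivial]
    field_simp
  rw [integral_congr_ae (Eventually.of_forall h)]
  refine (Measure.integral_comp_smul (volume : Measure (E (n + 1)))
    (fun z => v z * phase (r⁻¹ • -η) z) r).trans ?_
  rw [Complex.real_smul, finrank_E, abs_inv, abs_pow]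

/-- The Fourier transform exchanges the components of `v` at `iλ` with those of `𝓕 v` at `-iλ`. -/
theorem isFourierTransform_homPart (lam : ℝ) (ε : Fin 2) (v : 𝓢(E (n + 1), ℂ)) :
    IsFourierTransform (homPart lam ε v) (homPart (-lam) ε (𝓕 (v : E (n + 1) → ℂ))) := by
  refine ⟨fun φ => (integrable_and_integral_homPart_mul lam ε v φ).1,
    fun φ => (integrable_and_integral_homPart_mul (-lam) ε (𝓕 v) φ).1, fun φ => ?_⟩
  have h1 := (integrable_and_integral_homPart_mul lam ε v (𝓕 φ)).2
  have h2 := (integrable_and_integral_homPart_mul (-lam) ε (𝓕 v) φ).2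
  rw [SchwartzMap.fourier_coe] at h1 h2
  rw [h1, h2, ← (integrable_and_integral_absPow_inv n lam ε _).2]
  congr 1
  refine integral_congr_ae ?_
  filter_upwards [ae_ne_zero_real] with r hr
  congr 1
  have h3 := SchwartzMap.integral_fourier_mul_eq φ (dilate r hr v)
  rw [SchwartzMap.fourier_coe, SchwartzMap.fourier_coe] at h3
  simp only [dilate_apply, fourier_dilate] at h3
  rw [h3, ← integral_const_mul]
  congr 1 with x
  ring

/-- Functions which are continuous outside of the origin are determined there by their pairings
with Schwartz functions. -/
theorem eq_of_integral_mul_schwartz_eq {m : ℕ} {U U' : E m → ℂ} (hU : ContinuousOn U {0}ᶜ)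
    (hU' : ContinuousOn U' {0}ᶜ) (hi : ∀ φ : 𝓢(E m, ℂ), Integrable (fun x => U x * φ x))
    (hi' : ∀ φ : 𝓢(E m, ℂ), Integrable (fun x => U' x * φ x))
    (h : ∀ φ : 𝓢(E m, ℂ), ∫ x, U x * φ x = ∫ x, U' x * φ x) {x : E m} (hx : x ≠ 0) :
    U x = U' x := by
  have hc : ContinuousOn (fun x => U x - U' x) {0}ᶜ := hU.sub hU'
  have hopen : IsOpen ({0}ᶜ : Set (E m)) := isOpen_compl_singleton
  have h1 := hopen.ae_eq_zero_of_integral_contDiff_smul_eq_zero (μ := volume)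
    (hc.locallyIntegrableOn hopen.measurableSet) (fun g hg hgc _ => by
      have hs : HasCompactSupport (fun x => ((g x : ℝ) : ℂ)) :=
        hgc.comp_left (g := Complex.ofReal) Complex.ofReal_zero
      have hd : ContDiff ℝ ∞ (fun x => ((g x : ℝ) : ℂ)) := Complex.ofRealCLM.contDiff.comp hg
      have h2 := h (hs.toSchwartzMap hd)
      rw [← sub_eq_zero, ← integral_sub (hi _) (hi' _)] at h2
      rw [← h2]
      congr 1 with x
      rw [Complex.real_smul]
      change _ = U x * ((g x : ℝ) : ℂ) - U' x * ((g x : ℝ) : ℂ)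
      ring)
  have h2 : (fun x => U x - U' x) =ᵐ[volume.restrict {0}ᶜ] fun _ => 0 :=
    (ae_restrict_iff' hopen.measurableSet).mpr h1
  exact sub_eq_zero.mp (Measure.eqOn_open_of_ae_eq h2 hopen hc continuousOn_const hx)

theorem continuousOn_homPart_fourier (lam : ℝ) (ε : Fin 2) (v : 𝓢(E (n + 1), ℂ)) :
    ContinuousOn (homPart lam ε (𝓕 (v : E (n + 1) → ℂ))) {0}ᶜ :=
  continuousOn_homPart lam ε (𝓕 v)

theorem ae_ne_zero_E : ∀ᵐ x : E (n + 1), x ≠ 0 := by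
  rw [ae_iff]; simp

/-- `(𝓕 v)_{-iλ,ε}` depends only on `v_{iλ,ε}`: this makes the intertwining operator well defined. -/
theorem homPart_fourier_congr {lam : ℝ} {ε : Fin 2} {v v' : 𝓢(E (n + 1), ℂ)}
    (h : ∀ᵐ x, homPart lam ε v x = homPart lam ε v' x) {ξ : E (n + 1)} (hξ : ξ ≠ 0) :
    homPart (-lam) ε (𝓕 (v : E (n + 1) → ℂ)) ξ = homPart (-lam) ε (𝓕 (v' : E (n + 1) → ℂ)) ξ := by
  obtain ⟨-, h2, h3⟩ := isFourierTransform_homPart lam ε v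
  obtain ⟨-, h2', h3'⟩ := isFourierTransform_homPart lam ε v'
  refine eq_of_integral_mul_schwartz_eq (continuousOn_homPart_fourier _ _ _)
    (continuousOn_homPart_fourier _ _ _) h2 h2' (fun φ => ?_) hξ
  rw [← h3, ← h3']
  refine integral_congr_ae ?_
  filter_upwards [h] with x hx
  rw [hx]

theorem homPart_congr_of_fourier {lam : ℝ} {ε : Fin 2} {v v' : 𝓢(E (n + 1), ℂ)}
    (h : ∀ᵐ ξ, homPart (-lam) ε (𝓕 (v : E (n + 1) → ℂ)) ξ =
      homPart (-lam) ε (𝓕 (v' : E (n + 1) → ℂ)) ξ) {x : E (n + 1)} (hx : x ≠ 0) :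
    homPart lam ε v x = homPart lam ε v' x := by
  obtain ⟨h1, -, h3⟩ := isFourierTransform_homPart lam ε v
  obtain ⟨h1', -, h3'⟩ := isFourierTransform_homPart lam ε v'
  refine eq_of_integral_mul_schwartz_eq (continuousOn_homPart _ _ _)
    (continuousOn_homPart _ _ _) h1 h1' (fun φ => ?_) hx
  have e1 := h3 (𝓕⁻ φ)
  have e2 := h3' (𝓕⁻ φ)
  rw [← SchwartzMap.fourier_coe, FourierTransform.fourier_fourierInv_eq] at e1 e2
  rw [e1, e2]
  refine integral_congr_ae ?_
  filter_upwards [h] with ξ hξ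
  rw [hξ]

/-! ### Affine coordinates -/

theorem emb_apply_last (s : E n) : emb s (Fin.last n) = 1 := by simp [emb]

theorem emb_apply_castSucc (s : E n) (i : Fin n) : emb s i.castSucc = s i := by simp [emb]

theorem emb_ne_zero (s : E n) : emb s ≠ 0 := by
  intro h
  have := emb_apply_last s
  simp [h] at this

theorem inner_emb_emb (s σ : E n) : (inner ℝ (emb s) (emb σ) : ℝ) = 1 + inner ℝ s σ := by
  rw [PiLp.inner_apply, Fin.sum_univ_castSucc, PiLp.inner_apply]
  simp only [emb_apply_last, emb_apply_castSucc]
  simp [add_comm]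

theorem eq_smul_emb {x : E (n + 1)} (hx : x (Fin.last n) ≠ 0) :
    ∃ s : E n, x = x (Fin.last n) • emb s := by
  refine ⟨WithLp.toLp 2 fun i => (x (Fin.last n))⁻¹ * x i.castSucc, ?_⟩
  ext i
  refine Fin.lastCases ?_ (fun i => ?_) i
  · simp [emb_apply_last]
  · simp [emb_apply_castSucc, hx]

theorem ae_last_ne_zero : ∀ᵐ x : E (n + 1), x (Fin.last n) ≠ 0 := by
  have h : (EuclideanSpace.single (Fin.last n) (1 : ℝ) : E (n + 1)) ≠ 0 := by simp
  filter_upwards [ae_inner_ne_zero h] with x hx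
  simpa [EuclideanSpace.inner_single_left] using hx

theorem ae_homPart_eq_of_flatPart_eq {lam : ℝ} {ε : Fin 2} {v v' : E (n + 1) → ℂ}
    (h : flatPart lam ε v = flatPart lam ε v') :
    ∀ᵐ x, homPart lam ε v x = homPart lam ε v' x := by
  filter_upwards [ae_last_ne_zero] with x hx
  obtain ⟨s, hs⟩ := eq_smul_emb hx
  rw [hs, homPart_smul _ _ _ hx, homPart_smul _ _ _ hx]
  exact congrArg _ (congrFun h s)

theorem homPart_eq_of_flatPart_eq {lam : ℝ} {ε : Fin 2} {v v' : 𝓢(E (n + 1), ℂ)}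
    (h : flatPart lam ε (v : E (n + 1) → ℂ) = flatPart lam ε v') {x : E (n + 1)} (hx : x ≠ 0) :
    homPart lam ε v x = homPart lam ε v' x :=
  Measure.eqOn_open_of_ae_eq (ae_restrict_of_ae (ae_homPart_eq_of_flatPart_eq h))
    isOpen_compl_singleton (continuousOn_homPart lam ε v) (continuousOn_homPart lam ε v') hx

/-- The intertwining operator is well defined. -/
theorem theta_flatPart (lam : ℝ) (ε : Fin 2) (v : 𝓢(E (n + 1), ℂ)) :
    theta lam ε (flatPart lam ε (v : E (n + 1) → ℂ)) =
      flatPart (-lam) ε (𝓕 (v : E (n + 1) → ℂ)) := by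
  have hmem : flatPart lam ε (v : E (n + 1) → ℂ) ∈ flatClass n lam ε := ⟨v, rfl⟩
  rw [theta, dif_pos hmem]
  ext σ
  exact homPart_fourier_congr (ae_homPart_eq_of_flatPart_eq hmem.choose_spec) (emb_ne_zero σ)

end HomPartFourier

/-! ### Derivatives and linear factors -/

section Leibniz

variable {X F : Type*} [NormedAddCommGroup X] [NormedSpace ℝ X] [NormedAddCommGroup F]
  [NormedSpace ℝ F]

theorem norm_iteratedFDeriv_sub_const_le (ℓ : X →L[ℝ] ℝ) (hℓ : ‖ℓ‖ ≤ 1) (p : X) (i : ℕ) :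
    ‖iteratedFDeriv ℝ i (fun q => ((ℓ (q - p) : ℝ) : ℂ)) p‖ ≤ if i = 1 then 1 else 0 := by
  set L : X →L[ℝ] ℂ := Complex.ofRealCLM.comp ℓ with hL
  have hLn : ‖L‖ ≤ 1 := by
    refine ContinuousLinearMap.opNorm_le_bound _ zero_le_one fun q => ?_
    rw [hL, ContinuousLinearMap.comp_apply, Complex.ofRealCLM_apply, Complex.norm_real]
    exact (ℓ.le_opNorm q).trans (by gcongr)
  have hf : (fun q => ((ℓ (q - p) : ℝ) : ℂ)) = fun q => L (q - p) := rfl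
  rw [hf]
  rcases i with _ | i
  · simp
  have hd : fderiv ℝ (fun q => L (q - p)) = fun _ => L := by
    ext1 q
    exact (L.hasFDerivAt.comp q ((hasFDerivAt_id q).sub_const p)).fderiv
  rw [← norm_iteratedFDeriv_fderiv, hd]
  rcases i with _ | i
  · simpa using hLn
  · rw [iteratedFDeriv_const_of_ne (Nat.succ_ne_zero i)]
    simp

/-- A bound for `|ℓ(p)| |u^{(k)}(p)|` by the derivatives of the product `ℓu` and lower derivatives of
`u`. The function `ℓ(q)` is split as `ℓ(p) + ℓ(q-p)`, and the Leibniz rule at `q = p` leaves only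
the first derivative of the second term. -/
theorem abs_mul_norm_iteratedFDeriv_le (ℓ : X →L[ℝ] ℝ) (hℓ : ‖ℓ‖ ≤ 1) {u : X → ℂ}
    (hu : ContDiff ℝ ∞ u) (k : ℕ) (p : X) :
    |ℓ p| * ‖iteratedFDeriv ℝ k u p‖ ≤
      ‖iteratedFDeriv ℝ k (fun q => ((ℓ q : ℝ) : ℂ) * u q) p‖ +
        k * ‖iteratedFDeriv ℝ (k - 1) u p‖ := by
  have hℓs : ContDiff ℝ ∞ (fun q => ((ℓ q : ℝ) : ℂ)) := Complex.ofRealCLM.contDiff.comp ℓ.contDiff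
  have hℓs' : ContDiff ℝ ∞ (fun q => ((ℓ (q - p) : ℝ) : ℂ)) :=
    hℓs.comp (contDiff_id.sub contDiff_const)
  have he : (fun q => ((ℓ p : ℝ) : ℂ) • u q) =
      (fun q => ((ℓ q : ℝ) : ℂ) * u q) - fun q => ((ℓ (q - p) : ℝ) : ℂ) * u q := by
    ext q
    simp only [Pi.sub_apply, map_sub, smul_eq_mul]
    push_cast; ring
  have h1 : ‖iteratedFDeriv ℝ k (fun q => ((ℓ p : ℝ) : ℂ) • u q) p‖ =
      |ℓ p| * ‖iteratedFDeriv ℝ k u p‖ := by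
    rw [iteratedFDeriv_const_smul_apply' (hu.contDiffAt.of_le (mod_cast le_top)), norm_smul,
      Complex.norm_real, Real.norm_eq_abs]
  rw [← h1, he, iteratedFDeriv_sub_apply ((hℓs.mul hu).contDiffAt.of_le (mod_cast le_top))
    ((hℓs'.mul hu).contDiffAt.of_le (mod_cast le_top))]
  refine (norm_sub_le _ _).trans (add_le_add le_rfl ?_)
  refine (norm_iteratedFDeriv_mul_le (N := ∞) hℓs' hu p (n := k) (mod_cast le_top)).trans ?_
  calc ∑ i ∈ Finset.range (k + 1), (k.choose i : ℝ) *
        ‖iteratedFDeriv ℝ i (fun q => ((ℓ (q - p) : ℝ) : ℂ)) p‖ * ‖iteratedFDeriv ℝ (k - i) u p‖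
      ≤ ∑ i ∈ Finset.range (k + 1), (k.choose i : ℝ) * (if i = 1 then 1 else 0) *
          ‖iteratedFDeriv ℝ (k - i) u p‖ := by
        gcongr with i _
        exact norm_iteratedFDeriv_sub_const_le ℓ hℓ p i
    _ ≤ k * ‖iteratedFDeriv ℝ (k - 1) u p‖ := by
        simp only [mul_ite, mul_one, mul_zero, ite_mul, zero_mul, Finset.sum_ite_eq']
        split_ifs with h
        · simp
        · positivity

end Leibniz

/-! ### Symbols bounded under the Euler algebra -/

section SymbolClass

variable {m : ℕ}

/-- Smooth functions which are bounded after application of any operator of the algebra. -/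
def EulerBounded (G : E m × E m → ℂ) : Prop :=
  ContDiff ℝ ∞ G ∧ ∀ D : (E m × E m → ℂ) → (E m × E m → ℂ), InEulerAlgebra D →
    ∃ c : ℝ, ∀ p, ‖D G p‖ ≤ c

theorem contDiff_fderiv_apply_const {X F : Type*} [NormedAddCommGroup X] [NormedSpace ℝ X]
    [NormedAddCommGroup F] [NormedSpace ℝ F] {G : X → F} (hG : ContDiff ℝ ∞ G) (v : X) :
    ContDiff ℝ ∞ (fun p => fderiv ℝ G p v) :=
  (hG.fderiv_right (m := ∞) (by simp)).clm_apply contDiff_const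

theorem EulerBounded.xD {G : E m × E m → ℂ} (hG : EulerBounded G) (j k : Fin m) :
    EulerBounded (xD j k G) := by
  refine ⟨?_, fun D hD => hG.2 _ (hD.mul (.x j k))⟩
  have h : ContDiff ℝ ∞ (fun p : E m × E m => ((p.1 j : ℝ) : ℂ)) :=
    Complex.ofRealCLM.contDiff.comp
      ((EuclideanSpace.proj (𝕜 := ℝ) j).contDiff.comp contDiff_fst)
  exact h.mul (contDiff_fderiv_apply_const hG.1 _)

theorem EulerBounded.xiD {G : E m × E m → ℂ} (hG : EulerBounded G) (j k : Fin m) :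
    EulerBounded (xiD j k G) := by
  refine ⟨?_, fun D hD => hG.2 _ (hD.mul (.xi j k))⟩
  have h : ContDiff ℝ ∞ (fun p : E m × E m => ((p.2 j : ℝ) : ℂ)) :=
    Complex.ofRealCLM.contDiff.comp
      ((EuclideanSpace.proj (𝕜 := ℝ) j).contDiff.comp contDiff_snd)
  exact h.mul (contDiff_fderiv_apply_const hG.1 _)

theorem norm_le_sum_abs (x : E m) : ‖x‖ ≤ ∑ j, |x j| := by
  have h : x = ∑ j, x j • EuclideanSpace.single j (1 : ℝ) := by
    ext i
    simp [Finset.sum_apply, Pi.single_apply]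
  conv_lhs => rw [h]
  refine (norm_sum_le _ _).trans (le_of_eq ?_)
  simp [norm_smul]

theorem norm_iteratedFDeriv_fderiv_prod_le {G : E m × E m → ℂ} (hG : ContDiff ℝ ∞ G) (k : ℕ)
    (p : E m × E m) : ‖iteratedFDeriv ℝ (k + 1) G p‖ ≤
      ∑ l, (‖iteratedFDeriv ℝ k (fun q => fderiv ℝ G q (EuclideanSpace.single l (1 : ℝ), 0)) p‖ +
        ‖iteratedFDeriv ℝ k (fun q => fderiv ℝ G q (0, EuclideanSpace.single l (1 : ℝ))) p‖) := by
  set L : E m × E m → (E m × E m →L[ℝ] ℂ) := fderiv ℝ G with hL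
  have hLs : ContDiff ℝ ∞ L := hG.fderiv_right (m := ∞) (by simp)
  set a : Fin m → (E m × E m →L[ℝ] ℂ) := fun l =>
    Complex.ofRealCLM.comp ((EuclideanSpace.proj (𝕜 := ℝ) l).comp (ContinuousLinearMap.fst ℝ _ _))
  set b : Fin m → (E m × E m →L[ℝ] ℂ) := fun l =>
    Complex.ofRealCLM.comp ((EuclideanSpace.proj (𝕜 := ℝ) l).comp (ContinuousLinearMap.snd ℝ _ _))
  have ha : ∀ l, ‖a l‖ ≤ 1 := fun l => ContinuousLinearMap.opNorm_le_bound _ zero_le_one fun x => by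
    simpa [a] using (PiLp.norm_apply_le x.1 l).trans (norm_fst_le x)
  have hb : ∀ l, ‖b l‖ ≤ 1 := fun l => ContinuousLinearMap.opNorm_le_bound _ zero_le_one fun x => by
    simpa [b] using (PiLp.norm_apply_le x.2 l).trans (norm_snd_le x)
  have hdec : L = fun q => ∑ l, (L q (EuclideanSpace.single l (1 : ℝ), 0) • a l +
      L q (0, EuclideanSpace.single l (1 : ℝ)) • b l) := by
    ext1 q
    refine ContinuousLinearMap.ext fun p => ?_
    have hp : p = ∑ l, (p.1 l • ((EuclideanSpace.single l (1 : ℝ), 0) : E m × E m) +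
        p.2 l • ((0, EuclideanSpace.single l (1 : ℝ)) : E m × E m)) := by
      refine Prod.ext ?_ ?_ <;> ext i <;>
        simp [Prod.fst_sum, Prod.snd_sum, Finset.sum_apply, Pi.single_apply]
    conv_lhs => rw [hp, map_sum]
    rw [sum_apply]
    refine Finset.sum_congr rfl fun l _ => ?_
    rw [map_add, map_smul, map_smul]
    simp [a, b, mul_comm]
  have hterm : ∀ (v : E m × E m) (c : E m × E m →L[ℝ] ℂ), ‖c‖ ≤ 1 →
      ContDiff ℝ ∞ (fun q => L q v • c) ∧
      ‖iteratedFDeriv ℝ k (fun q => L q v • c) p‖ ≤ ‖iteratedFDeriv ℝ k (fun q => L q v) p‖ := by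
    intro v c hc
    have hu : ContDiff ℝ ∞ (fun q => L q v) := hLs.clm_apply contDiff_const
    set T : ℂ →L[ℝ] (E m × E m →L[ℝ] ℂ) :=
      ((ContinuousLinearMap.id ℂ ℂ).smulRight c).restrictScalars ℝ with hT
    have hTn : ‖T‖ ≤ 1 := ContinuousLinearMap.opNorm_le_bound _ zero_le_one fun z => by
      simp only [hT, ContinuousLinearMap.coe_restrictScalars', ContinuousLinearMap.smulRight_apply,
        ContinuousLinearMap.coe_id', id_eq, norm_smul, one_mul]
      exact mul_le_of_le_one_right (norm_nonneg _) hc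
    refine ⟨T.contDiff.comp hu, ?_⟩
    refine (T.norm_iteratedFDeriv_comp_left hu.contDiffAt (mod_cast le_top)).trans ?_
    exact mul_le_of_le_one_left (norm_nonneg _) hTn
  rw [← norm_iteratedFDeriv_fderiv, ← hL]
  conv_lhs => rw [hdec]
  rw [iteratedFDeriv_fun_sum_apply]
  refine (norm_sum_le _ _).trans (Finset.sum_le_sum fun l _ => ?_)
  · have h1 := hterm (EuclideanSpace.single l (1 : ℝ), 0) (a l) (ha l)
    have h2 := hterm (0, EuclideanSpace.single l (1 : ℝ)) (b l) (hb l)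
    refine (congrArg norm (iteratedFDeriv_add_apply (h1.1.contDiffAt.of_le (mod_cast le_top))
      (h2.1.contDiffAt.of_le (mod_cast le_top)))).le.trans ?_
    exact (norm_add_le _ _).trans (add_le_add h1.2 h2.2)
  · exact fun l _ => ((hterm _ (a l) (ha l)).1.add (hterm _ (b l) (hb l)).1).contDiffAt.of_le
      (mod_cast le_top)

theorem norm_proj_le (j : Fin m) : ‖(EuclideanSpace.proj (𝕜 := ℝ) j : E m →L[ℝ] ℝ)‖ ≤ 1 :=
  ContinuousLinearMap.opNorm_le_bound _ zero_le_one fun x => by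
    simpa using PiLp.norm_apply_le x j

/-- All derivatives are bounded where both variables are at least of size `1`. By induction on the
order: there some coordinate `x_j` is bounded below, and `x_j ∂/∂x_k` preserves the class. -/
theorem EulerBounded.exists_bound (k : ℕ) : ∀ {G : E m × E m → ℂ}, EulerBounded G →
    ∃ C, ∀ p : E m × E m, 1 ≤ ‖p.1‖ → 1 ≤ ‖p.2‖ → ‖iteratedFDeriv ℝ k G p‖ ≤ C := by
  induction k with
  | zero =>
    intro G hG
    obtain ⟨c, hc⟩ := hG.2 _ .one
    exact ⟨c, fun p _ _ => by simpa using hc p⟩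
  | succ k ih =>
    intro G hG
    obtain ⟨C, hC⟩ := ih hG
    choose Cx hCx using fun j l => ih (hG.xD j l)
    choose Cξ hCξ using fun j l => ih (hG.xiD j l)
    have hlow : ∀ (v : E m × E m), ‖v‖ ≤ 1 → ∀ p : E m × E m, 1 ≤ ‖p.1‖ → 1 ≤ ‖p.2‖ →
        (k : ℝ) * ‖iteratedFDeriv ℝ (k - 1) (fun q => fderiv ℝ G q v) p‖ ≤ k * C := by
      intro v hv p h1 h2
      rcases k with _ | k
      · simp
      · have h3 := norm_iteratedFDeriv_clm_apply_const (f := fderiv ℝ G) (c := v) (x := p) (N := ∞)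
          (n := k) (hG.1.fderiv_right (m := ∞) (by simp)).contDiffAt (mod_cast le_top)
        rw [norm_iteratedFDeriv_fderiv] at h3
        refine mul_le_mul_of_nonneg_left ?_ (by positivity)
        refine h3.trans (le_trans ?_ (hC p h1 h2))
        exact mul_le_of_le_one_left (norm_nonneg _) hv
    refine ⟨∑ l, ((∑ j, (Cx j l + k * C)) + ∑ j, (Cξ j l + k * C)), fun p h1 h2 => ?_⟩
    refine (norm_iteratedFDeriv_fderiv_prod_le hG.1 k p).trans (Finset.sum_le_sum fun l _ => ?_)
    refine add_le_add ?_ ?_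
    · set u := fun q => fderiv ℝ G q (EuclideanSpace.single l (1 : ℝ), 0) with hu
      have h3 : ∀ j, |p.1 j| * ‖iteratedFDeriv ℝ k u p‖ ≤ Cx j l + k * C := fun j => by
        have h4 := abs_mul_norm_iteratedFDeriv_le
          ((EuclideanSpace.proj (𝕜 := ℝ) j).comp (ContinuousLinearMap.fst ℝ (E m) (E m)))
          ((ContinuousLinearMap.opNorm_comp_le _ _).trans (mul_le_one₀ (norm_proj_le j)
            (norm_nonneg _) (ContinuousLinearMap.norm_fst_le ℝ _ _)))
          (contDiff_fderiv_apply_const hG.1 (EuclideanSpace.single l (1 : ℝ), 0)) k p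
        exact h4.trans (add_le_add (hCx j l p h1 h2) (hlow _ (by simp) p h1 h2))
      calc ‖iteratedFDeriv ℝ k u p‖ ≤ (∑ j, |p.1 j|) * ‖iteratedFDeriv ℝ k u p‖ :=
            le_mul_of_one_le_left (norm_nonneg _) (h1.trans (norm_le_sum_abs _))
        _ = ∑ j, |p.1 j| * ‖iteratedFDeriv ℝ k u p‖ := Finset.sum_mul _ _ _
        _ ≤ _ := Finset.sum_le_sum fun j _ => h3 j
    · set u := fun q => fderiv ℝ G q (0, EuclideanSpace.single l (1 : ℝ)) with hu
      have h3 : ∀ j, |p.2 j| * ‖iteratedFDeriv ℝ k u p‖ ≤ Cξ j l + k * C := fun j => by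
        have h4 := abs_mul_norm_iteratedFDeriv_le
          ((EuclideanSpace.proj (𝕜 := ℝ) j).comp (ContinuousLinearMap.snd ℝ (E m) (E m)))
          ((ContinuousLinearMap.opNorm_comp_le _ _).trans (mul_le_one₀ (norm_proj_le j)
            (norm_nonneg _) (ContinuousLinearMap.norm_snd_le ℝ _ _)))
          (contDiff_fderiv_apply_const hG.1 (0, EuclideanSpace.single l (1 : ℝ))) k p
        exact h4.trans (add_le_add (hCξ j l p h1 h2) (hlow _ (by simp) p h1 h2))
      calc ‖iteratedFDeriv ℝ k u p‖ ≤ (∑ j, |p.2 j|) * ‖iteratedFDeriv ℝ k u p‖ :=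
            le_mul_of_one_le_left (norm_nonneg _) (h2.trans (norm_le_sum_abs _))
        _ = ∑ j, |p.2 j| * ‖iteratedFDeriv ℝ k u p‖ := Finset.sum_mul _ _ _
        _ ≤ _ := Finset.sum_le_sum fun j _ => h3 j

end SymbolClass

/-! ### Estimates for invariant symbols -/

section InvariantSymbols

variable {m : ℕ} {H : E m × E m → ℂ}

theorem IsInvariantSymbol.eulerBounded (hH : IsInvariantSymbol H) : EulerBounded H :=
  ⟨hH.smooth, hH.bounded⟩

/-- Continuity takes care of bounded regions. -/
theorem IsInvariantSymbol.exists_bound_compact (hH : IsInvariantSymbol H) (k : ℕ) :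
    ∃ C, ∀ p : E m × E m, ‖p.1‖ ≤ 1 → ‖p.2‖ ≤ 1 → ‖iteratedFDeriv ℝ k H p‖ ≤ C := by
  obtain ⟨C, hC⟩ := (isCompact_closedBall (0 : E m × E m) 1).exists_bound_of_continuousOn
    (hH.smooth.continuous_iteratedFDeriv (m := k) (mod_cast le_top)).continuousOn
  exact ⟨C, fun p h1 h2 => hC p (by simpa [Prod.norm_def] using ⟨h1, h2⟩)⟩

/-- The derivatives of an invariant symbol are bounded where the first variable is on the unit
sphere. -/
theorem IsInvariantSymbol.exists_bound_sphere (hH : IsInvariantSymbol H) (k : ℕ) :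
    ∃ C, ∀ p : E m × E m, ‖p.1‖ = 1 → ‖iteratedFDeriv ℝ k H p‖ ≤ C := by
  obtain ⟨C₁, h₁⟩ := hH.exists_bound_compact k
  obtain ⟨C₂, h₂⟩ := hH.eulerBounded.exists_bound k
  refine ⟨max C₁ C₂, fun p hp => ?_⟩
  rcases le_total ‖p.2‖ 1 with h | h
  · exact (h₁ p hp.le h).trans (le_max_left _ _)
  · exact (h₂ p hp.ge h).trans (le_max_right _ _)

theorem norm_iteratedFDeriv_partial_le {G : E m × E m → ℂ} (hG : ContDiff ℝ ∞ G) (k : ℕ)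
    (x ξ : E m) :
    ‖iteratedFDeriv ℝ k (fun ξ => G (x, ξ)) ξ‖ ≤ ‖iteratedFDeriv ℝ k G (x, ξ)‖ := by
  have hs : ContDiff ℝ ∞ (fun p : E m × E m => G (p + (x, 0))) :=
    hG.comp (contDiff_id.add contDiff_const)
  have h := norm_iteratedFDeriv_comp_clm_le hs (ContinuousLinearMap.inr ℝ (E m) (E m)) k ξ
  have he : (fun ξ => G (x, ξ)) =
      fun ξ => G (ContinuousLinearMap.inr ℝ (E m) (E m) ξ + (x, 0)) := by
    ext ξ; simp
  rw [he]
  refine h.trans ?_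
  rw [iteratedFDeriv_comp_add_right]
  have hn : ‖ContinuousLinearMap.inr ℝ (E m) (E m)‖ ≤ 1 :=
    ContinuousLinearMap.opNorm_le_bound _ zero_le_one fun v => by simp [Prod.norm_def]
  simp only [ContinuousLinearMap.inr_apply, Prod.mk_add_mk, zero_add, add_zero]
  exact mul_le_of_le_one_left (norm_nonneg _) (pow_le_one₀ (norm_nonneg _) hn)

theorem IsInvariantSymbol.apply_smul (hH : IsInvariantSymbol H) {t : ℝ} (ht : t ≠ 0)
    (x ξ : E m) : H (t • x, ξ) = H (x, t • ξ) := by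
  have := hH.invariant t ht x (t • ξ)
  rwa [inv_smul_smul₀ ht] at this

/-- As functions of the second variable, invariant symbols are symbols of order `0`, uniformly with
respect to the first variable on the unit sphere. -/
theorem IsInvariantSymbol.exists_isSymb (hH : IsInvariantSymbol H) :
    ∃ C : ℕ → ℝ, ∀ x : E m, ‖x‖ = 1 → IsSymb 0 C (fun ξ => H (x, ξ)) := by
  choose C₁ h₁ using hH.exists_bound_compact
  choose C₂ h₂ using fun k => hH.eulerBounded.exists_bound k
  refine ⟨fun k => 2 ^ k * max (C₁ k) (C₂ k), fun x hx => ⟨?_, fun k ξ => ?_⟩⟩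
  · exact hH.smooth.comp (contDiff_const.prodMk contDiff_id)
  rw [pow_zero, mul_one]
  rcases le_total ‖ξ‖ 1 with h | h
  · have h3 := (norm_iteratedFDeriv_partial_le hH.smooth k x ξ).trans (h₁ k (x, ξ) hx.le h)
    gcongr
    · linarith
    · exact h3.trans (le_max_left _ _)
  · set t := ‖ξ‖ with ht
    have ht0 : 0 < t := by linarith
    have he : (fun ξ' => H (x, ξ')) = fun ξ' => H (t • x, (t⁻¹ • ContinuousLinearMap.id ℝ (E m)) ξ') := by
      ext ξ'
      exact (hH.invariant t ht0.ne' x ξ').symm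
    have hs : ContDiff ℝ ∞ (fun ξ' => H (t • x, ξ')) :=
      hH.smooth.comp (contDiff_const.prodMk contDiff_id)
    have hn : ‖t⁻¹ • ContinuousLinearMap.id ℝ (E m)‖ ≤ t⁻¹ :=
      ContinuousLinearMap.opNorm_le_bound _ (by positivity) fun v => by
        simp [norm_smul, abs_of_pos ht0]
    have h3 := norm_iteratedFDeriv_comp_clm_le hs (t⁻¹ • ContinuousLinearMap.id ℝ (E m)) k ξ
    have h4 := (norm_iteratedFDeriv_partial_le hH.smooth k (t • x) (t⁻¹ • ξ)).trans
      (h₂ k (t • x, t⁻¹ • ξ) (by simp [norm_smul, hx, abs_of_pos ht0, h])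
        (by simp [norm_smul, abs_of_pos ht0, ← ht, ht0.ne']))
    rw [he]
    calc (1 + t) ^ k * ‖iteratedFDeriv ℝ k
          (fun ξ' => H (t • x, (t⁻¹ • ContinuousLinearMap.id ℝ (E m)) ξ')) ξ‖
        ≤ (t + t) ^ k * ((t⁻¹) ^ k * max (C₁ k) (C₂ k)) := by
          gcongr
          refine h3.trans (mul_le_mul (by gcongr) (h4.trans (le_max_right _ _)) (norm_nonneg _)
            (by positivity))
      _ = 2 ^ k * max (C₁ k) (C₂ k) := by
          rw [← two_mul, mul_pow, inv_pow]; field_simp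

/-- Uniform symbol estimates for `v ↦ H(x, Lv)`, `L` a similarity; by invariance only the product of
`|x|` and the ratio `ρ` of `L` matters. -/
theorem IsInvariantSymbol.isSymb_comp (hH : IsInvariantSymbol H) {C : ℕ → ℝ}
    (hC : ∀ x : E m, ‖x‖ = 1 → IsSymb 0 C (fun ξ => H (x, ξ))) {V : Type*} [NormedAddCommGroup V]
    [NormedSpace ℝ V] (L : V →L[ℝ] E m) {ρ M : ℝ} (hρ : 0 ≤ ρ) (hL : ∀ v, ‖L v‖ = ρ * ‖v‖)
    (hM : 1 ≤ M) {x : E m} (hx : x ≠ 0) (hρM : ‖x‖ * ρ ≤ M) :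
    IsSymb 0 (fun k => M ^ k * C k) (fun v => H (x, L v)) := by
  have hx0 : 0 < ‖x‖ := norm_pos_iff.mpr hx
  have h1 := (hC (‖x‖⁻¹ • x) (by simp [norm_smul, hx0.ne'])).comp_similitude (‖x‖ • L)
    (ρ := ‖x‖ * ρ) (by positivity) (fun v => by simp [norm_smul, hL, mul_assoc]) hM hρM
  convert h1 using 2 with v
  rw [hH.apply_smul (inv_ne_zero hx0.ne'), _root_.smul_apply,
    inv_smul_smul₀ hx0.ne']

theorem IsInvariantSymbol.exists_isSymb_of_ne_zero (hH : IsInvariantSymbol H) {x : E m}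
    (hx : x ≠ 0) : ∃ C : ℕ → ℝ, IsSymb 0 C (fun ξ => H (x, ξ)) := by
  obtain ⟨C, hC⟩ := hH.exists_isSymb
  exact ⟨_, hH.isSymb_comp hC (ContinuousLinearMap.id ℝ (E m)) (ρ := 1) (M := max 1 ‖x‖)
    zero_le_one (fun v => by simp) (le_max_left _ _) hx (by simp)⟩

theorem IsInvariantSymbol.exists_norm_le (hH : IsInvariantSymbol H) : ∃ c, ∀ p, ‖H p‖ ≤ c :=
  hH.bounded _ .one

/-- A bound for the derivatives of an invariant symbol off `x = 0`. -/
theorem IsInvariantSymbol.exists_joint_bound (hH : IsInvariantSymbol H) (k : ℕ) :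
    ∃ C, 0 ≤ C ∧ ∀ p : E m × E m, p.1 ≠ 0 →
      ‖iteratedFDeriv ℝ k H p‖ ≤ (‖p.1‖ + ‖p.1‖⁻¹) ^ k * C := by
  obtain ⟨C, hC⟩ := hH.exists_bound_sphere k
  refine ⟨max C 0, le_max_right _ _, fun p hp => ?_⟩
  set a := ‖p.1‖ with ha
  have ha0 : 0 < a := norm_pos_iff.mpr hp
  set Φ : E m × E m →L[ℝ] E m × E m :=
    (a⁻¹ • ContinuousLinearMap.fst ℝ (E m) (E m)).prod (a • ContinuousLinearMap.snd ℝ (E m) (E m))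
    with hΦ
  have he : H = fun p => H (Φ p) := by
    ext q
    have := hH.invariant a⁻¹ (inv_ne_zero ha0.ne') q.1 q.2
    rw [inv_inv] at this
    exact this.symm
  have hn : ‖Φ‖ ≤ a + a⁻¹ := by
    refine ContinuousLinearMap.opNorm_le_bound _ (by positivity) fun q => ?_
    rw [hΦ, ContinuousLinearMap.prod_apply, Prod.norm_def]
    have h1 := norm_fst_le q
    have h2 := norm_snd_le q
    have h3 : 0 < a⁻¹ := by positivity
    simp only [_root_.smul_apply, ContinuousLinearMap.coe_fst',
      ContinuousLinearMap.coe_snd', norm_smul, norm_inv, Real.norm_eq_abs, abs_of_pos ha0]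
    refine max_le ?_ ?_
    · nlinarith [norm_nonneg q]
    · nlinarith [norm_nonneg q]
  have h1 := norm_iteratedFDeriv_comp_clm_le hH.smooth Φ k p
  rw [← he] at h1
  refine h1.trans (mul_le_mul (by gcongr) ((hC _ ?_).trans (le_max_left _ _)) (norm_nonneg _)
    (by positivity))
  simp [hΦ, norm_smul, ← ha, abs_of_pos ha0, ha0.ne']

/-! ### Exchange of the two variables -/

/-- The symbol with its two variables exchanged. -/
def swapSymbol (H : E m × E m → ℂ) : E m × E m → ℂ := fun p => H (p.2, p.1)

theorem fderiv_swapSymbol (G : E m × E m → ℂ) (p v : E m × E m) :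
    fderiv ℝ (swapSymbol G) p v = fderiv ℝ G p.swap v.swap := by
  have h := (ContinuousLinearEquiv.prodComm ℝ (E m) (E m)).comp_right_fderiv (f := G) (x := p)
  have he : swapSymbol G = G ∘ ContinuousLinearEquiv.prodComm ℝ (E m) (E m) := rfl
  rw [he, h]
  rfl

theorem InEulerAlgebra.exists_swap {D : (E m × E m → ℂ) → (E m × E m → ℂ)}
    (hD : InEulerAlgebra D) : ∃ D' : (E m × E m → ℂ) → (E m × E m → ℂ), InEulerAlgebra D' ∧
      ∀ G, D (swapSymbol G) = swapSymbol (D' G) := by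
  induction hD with
  | one => exact ⟨id, .one, fun G => rfl⟩
  | x j k =>
    refine ⟨_, .xi j k, fun G => ?_⟩
    ext p
    simp only [xD, fderiv_swapSymbol]
    rfl
  | xi j k =>
    refine ⟨_, .x j k, fun G => ?_⟩
    ext p
    simp only [xiD, fderiv_swapSymbol]
    rfl
  | mul _ _ ih ih' =>
    obtain ⟨D₁, h₁, e₁⟩ := ih
    obtain ⟨D₂, h₂, e₂⟩ := ih'
    exact ⟨_, h₁.mul h₂, fun G => by beta_reduce; rw [e₂, e₁]⟩
  | add _ _ ih ih' =>
    obtain ⟨D₁, h₁, e₁⟩ := ih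
    obtain ⟨D₂, h₂, e₂⟩ := ih'
    exact ⟨_, h₁.add h₂, fun G => by beta_reduce; rw [e₂, e₁]; rfl⟩
  | smul c _ ih =>
    obtain ⟨D₁, h₁, e₁⟩ := ih
    exact ⟨_, h₁.smul c, fun G => by beta_reduce; rw [e₁]; rfl⟩

theorem IsInvariantSymbol.swap (hH : IsInvariantSymbol H) : IsInvariantSymbol (swapSymbol H) where
  smooth := hH.smooth.comp (contDiff_snd.prodMk contDiff_fst)
  invariant t ht x ξ := by
    have := hH.invariant t⁻¹ (inv_ne_zero ht) ξ x
    rwa [inv_inv] at this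
  bounded D hD := by
    obtain ⟨D', hD', he⟩ := hD.exists_swap
    obtain ⟨c, hc⟩ := hH.bounded D' hD'
    exact ⟨c, fun p => by rw [he]; exact hc _⟩

end InvariantSymbols

/-! ### Schwartz functions vanishing near the origin -/

section FlatFunctions

variable {V : Type*} [NormedAddCommGroup V] [NormedSpace ℝ V]

theorem exists_norm_iteratedFDeriv_le_of_eq_zero (w : 𝓢(V, ℂ)) {ρ : ℝ} (hρ : 0 < ρ)
    (hw : ∀ y, ‖y‖ < ρ → w y = 0) (j N : ℕ) :
    ∃ C, ∀ y : V, ‖iteratedFDeriv ℝ j w y‖ ≤ C * ‖y‖ ^ N := by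
  obtain ⟨C, hC0, hC⟩ := w.decay 0 j
  refine ⟨C / ρ ^ N, fun y => ?_⟩
  rcases lt_or_ge ‖y‖ ρ with h | h
  · have he : (w : V → ℂ) =ᶠ[𝓝 y] fun _ => 0 := by
      filter_upwards [(isOpen_lt continuous_norm continuous_const).mem_nhds h] with z hz
      exact hw z hz
    rw [(he.iteratedFDeriv ℝ j).eq_of_nhds]
    simp only [iteratedFDeriv_fun_zero, Pi.zero_apply, norm_zero]
    positivity
  · rw [div_mul_eq_mul_div, le_div_iff₀ (by positivity)]
    have h1 := hC y
    rw [pow_zero, one_mul] at h1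
    gcongr

theorem vanishesToOrder_of_eq_zero (w : 𝓢(V, ℂ)) {ρ : ℝ} (hρ : 0 < ρ)
    (hw : ∀ y, ‖y‖ < ρ → w y = 0) (N : ℕ) : VanishesToOrder N (w : V → ℂ) :=
  fun j _ => exists_norm_iteratedFDeriv_le_of_eq_zero w hρ hw j (N - j)

/-- The function `χ(‖y‖²)`. -/
def radialSchwartz {V : Type*} [NormedAddCommGroup V] [InnerProductSpace ℝ V] (χ : 𝓢(ℝ, ℂ)) :
    𝓢(V, ℂ) :=
  SchwartzMap.compCLM ℂ (g := fun y : V => ‖y‖ ^ 2) (Function.hasTemperateGrowth_norm_sq V)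
    ⟨1, 1, fun y => by
      rw [Real.norm_of_nonneg (by positivity)]
      nlinarith [sq_nonneg (‖y‖ - 1)]⟩ χ

theorem radialSchwartz_apply {V : Type*} [NormedAddCommGroup V] [InnerProductSpace ℝ V]
    (χ : 𝓢(ℝ, ℂ)) (y : V) : radialSchwartz χ y = χ (‖y‖ ^ 2) := rfl

end FlatFunctions

/-! ### Oscillatory integrals on the line -/

section Radial

theorem HasOscIntegral.congr_ae {V : Type*} [NormedAddCommGroup V] [NormedSpace ℝ V]
    [MeasureSpace V] {F G : V → ℂ} {J : ℂ} (h : HasOscIntegral F J) (hFG : F =ᵐ[volume] G) :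
    HasOscIntegral G J := by
  intro ψ hψ
  have h1 : ∀ δ : ℝ, (fun y => ψ (δ • y) * F y) =ᵐ[volume] fun y => ψ (δ • y) * G y := fun δ => by
    filter_upwards [hFG] with y hy
    rw [hy]
  obtain ⟨h2, h3⟩ := h ψ hψ
  refine ⟨fun δ hδ => (h2 δ hδ).congr (h1 δ), h3.congr fun δ => integral_congr_ae (h1 δ)⟩

/-- A smooth function, compactly supported in `(0,∞)`, which has a non-zero integral against a
given power. -/
theorem exists_bump_integral_ne_zero {k : ℝ → ℂ} (hk : ContinuousOn k (Set.Ioi 0))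
    (hk0 : k 1 ≠ 0) : ∃ φ : ℝ → ℝ, ContDiff ℝ ∞ φ ∧ HasCompactSupport φ ∧
      tsupport φ ⊆ Set.Ioi 0 ∧ ∫ t, φ t • k t ≠ 0 := by
  by_contra! h
  have h1 := isOpen_Ioi.ae_eq_zero_of_integral_contDiff_smul_eq_zero (μ := volume)
    (hk.locallyIntegrableOn measurableSet_Ioi) (fun φ h1 h2 h3 => h φ h1 h2 h3)
  have h2 : k =ᵐ[volume.restrict (Set.Ioi 0)] fun _ => 0 :=
    (ae_restrict_iff' measurableSet_Ioi).mpr h1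
  exact hk0 (Measure.eqOn_open_of_ae_eq h2 isOpen_Ioi hk continuousOn_const
    (Set.mem_Ioi.mpr (zero_lt_one' ℝ)))

theorem exists_eq_zero_of_tsupport_subset {φ : ℝ → ℝ} (h : tsupport φ ⊆ Set.Ioi 0) :
    ∃ ρ, 0 < ρ ∧ ∀ t, |t| < ρ → φ t = 0 := by
  have h0 : (0 : ℝ) ∈ (tsupport φ)ᶜ := fun h0 => lt_irrefl _ (Set.mem_Ioi.mp (h h0))
  obtain ⟨ρ, hρ, hb⟩ := Metric.isOpen_iff.mp (isClosed_tsupport φ).isOpen_compl 0 h0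
  refine ⟨ρ, hρ, fun t ht => ?_⟩
  exact image_eq_zero_of_notMem_tsupport (hb (by simpa using ht))

theorem continuousOn_absPow (ε : Fin 2) (α : ℂ) : ContinuousOn (absPow ε α) (Set.Ioi 0) := by
  have h : ContinuousOn (fun t : ℝ => (t : ℂ) ^ α) (Set.Ioi 0) := fun t ht =>
    ((Complex.continuousAt_ofReal_cpow_const t α (Or.inr (ne_of_gt ht)))).continuousWithinAt
  refine h.congr fun t ht => ?_
  have ht' : (0 : ℝ) < t := ht
  simp [absPow, abs_of_pos ht', Real.sign_of_pos ht']

/-- A homogeneous function on the line is a superposition of dilated test functions which vanish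
near the origin. -/
theorem exists_absPow_eq_integral (ε : Fin 2) (α : ℂ) : ∃ w : 𝓢(ℝ, ℂ),
    (∀ N, VanishesToOrder N (w : ℝ → ℂ)) ∧
    ∀ t : ℝ, t ≠ 0 → absPow ε α t = ∫ r : ℝ, absPow ε (-α - 1) r * w (r • t) := by
  obtain ⟨φ, h1, h2, h3, h4⟩ := exists_bump_integral_ne_zero
    (continuousOn_absPow ε (-α - 1)) (absPow_ne_zero ε (-α - 1) one_ne_zero)
  obtain ⟨ρ, hρ, hφ⟩ := exists_eq_zero_of_tsupport_subset h3
  set c := ∫ t, φ t • absPow ε (-α - 1) t with hc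
  have hs : HasCompactSupport (fun t => ((φ t : ℝ) : ℂ)) :=
    h2.comp_left (g := Complex.ofReal) Complex.ofReal_zero
  have hd : ContDiff ℝ ∞ (fun t => ((φ t : ℝ) : ℂ)) := Complex.ofRealCLM.contDiff.comp h1
  set w : 𝓢(ℝ, ℂ) := c⁻¹ • hs.toSchwartzMap hd with hw
  have hwa : ∀ t, w t = c⁻¹ * ((φ t : ℝ) : ℂ) := fun t => rfl
  refine ⟨w, vanishesToOrder_of_eq_zero w hρ fun t ht => ?_, fun t ht => ?_⟩
  · rw [hwa, hφ t ht]; simp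
  · have he : ∀ r : ℝ, absPow ε (-α - 1) r * w (r • t) = (absPow ε (-α - 1) t⁻¹ * c⁻¹) *
        (fun r => φ r • absPow ε (-α - 1) r) (r * t) := by
      intro r
      have h5 : absPow ε (-α - 1) r = absPow ε (-α - 1) t⁻¹ * absPow ε (-α - 1) (r * t) := by
        rw [← absPow_mul]
        congr 1
        field_simp
      rw [hwa, h5, smul_eq_mul]
      simp only [Complex.real_smul]
      ring
    have h0 : ((|t| : ℝ) : ℂ) ≠ 0 := by simpa using ht
    rw [integral_congr_ae (Eventually.of_forall he), integral_const_mul,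
      Measure.integral_comp_mul_right (fun r => φ r • absPow ε (-α - 1) r), ← hc, absPow_inv,
      show -(-α - 1) = α + 1 by ring,
      absPow_add _ _ _ ht, Complex.cpow_one, Complex.real_smul, abs_inv, Complex.ofReal_inv]
    field_simp

/-- Oscillatory integrals `∫ g(t) e^{2iπκt} |t|_ε^α dt` on the line, for symbols `g` of order `0`: they
exist, and the truncated integrals are bounded uniformly with respect to `g` and to the truncation. -/
theorem exists_hasOscIntegral_absPow (ε : Fin 2) {α : ℂ} (hα : -1 < α.re) {C : ℕ → ℝ} {κ : ℝ}
    (hκ : κ ≠ 0) :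
    (∀ g : ℝ → ℂ, IsSymb 0 C g →
      ∃ J, HasOscIntegral (fun t => g t * phase κ t * absPow ε α t) J) ∧
    ∀ ψ : 𝓢(ℝ, ℂ), ∃ M, ∀ g : ℝ → ℂ, IsSymb 0 C g → ∀ δ : ℝ, 0 < δ → δ ≤ 1 →
      ‖∫ t, ψ (δ • t) * (g t * phase κ t * absPow ε α t)‖ ≤ M := by
  obtain ⟨w, hw, he⟩ := exists_absPow_eq_integral ε α
  -- `w` vanishes to all orders, so that the condition on `N` can be met for every `α`
  obtain ⟨N, hN⟩ := exists_nat_gt α.re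
  have h1 : -1 < (N : ℝ) + (-α - 1).re := by simp; linarith
  have h2 : (-α - 1).re - Module.finrank ℝ ℝ < -1 := by simp; linarith
  have hae : ∀ g : ℝ → ℂ, (fun t => g t * phase κ t * ∫ r : ℝ, absPow ε (-α - 1) r * w (r • t))
      =ᵐ[volume] fun t => g t * phase κ t * absPow ε α t := fun g => by
    filter_upwards [ae_ne_zero_real] with t ht
    rw [he t ht]
  constructor
  · intro g hg
    exact ⟨_, (hasOscIntegral_symbol_mul_phase_mul_homogeneous (hw N) ε h1 h2 hg hκ).congr_ae
      (hae g)⟩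
  · intro ψ
    obtain ⟨M, hM⟩ := exists_truncated_bound (hw N) ε h1 h2 C hκ ψ
    refine ⟨M, fun g hg δ hδ hδ1 => ?_⟩
    have h3 : ∫ t, ψ (δ • t) * (g t * phase κ t * absPow ε α t) =
        ∫ t, ψ (δ • t) * (g t * phase κ t * ∫ r : ℝ, absPow ε (-α - 1) r * w (r • t)) := by
      refine integral_congr_ae ?_
      filter_upwards [hae g] with t ht
      rw [ht]
    rw [h3]
    exact hM g hg δ hδ hδ1

end Radial

/-! ### Homogeneous coordinates on `ℝ^{n+1}` -/

section Polar

variable {n : ℕ}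

/-- The point `(y, τ)` of `ℝ^{n+1}`. -/
def snocPoint (p : ℝ × E n) : E (n + 1) :=
  WithLp.toLp 2 (Fin.snoc (α := fun _ => ℝ) p.2.ofLp p.1)

theorem snocPoint_smul (τ : ℝ) (σ : E n) : snocPoint (τ, τ • σ) = τ • emb σ := by
  ext i
  refine Fin.lastCases ?_ (fun i => ?_) i
  · simp [snocPoint, emb]
  · simp [snocPoint, emb]

theorem continuous_emb : Continuous (emb : E n → E (n + 1)) := by
  refine (PiLp.continuous_toLp 2 _).comp (continuous_pi fun i => ?_)
  refine Fin.lastCases ?_ (fun i => ?_) i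
  · simpa using continuous_const
  · simp only [Fin.snoc_castSucc]
    fun_prop

theorem measurePreserving_snocPoint : MeasurePreserving (snocPoint : ℝ × E n → E (n + 1)) := by
  have h1 := (volume_preserving_piFinSuccAbove (fun _ : Fin (n + 1) => ℝ) (Fin.last n)).symm
  have h2 : MeasurePreserving (Prod.map id WithLp.ofLp : ℝ × E n → ℝ × (Fin n → ℝ)) :=
    (MeasurePreserving.id volume).prod (PiLp.volume_preserving_ofLp (Fin n))
  have h3 := (PiLp.volume_preserving_toLp (Fin (n + 1))).comp (h1.comp h2)
  convert h3 using 1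
  ext p i
  simp only [snocPoint, Function.comp_apply]
  refine Fin.lastCases ?_ (fun i => ?_) i
  · simp
  · simp

/-- Integration in homogeneous coordinates `ξ = τ(σ,1)`. -/
theorem integrable_and_integral_polar {F : E (n + 1) → ℂ} (hF : Integrable F)
    (hFm : StronglyMeasurable F) :
    Integrable (fun σ : E n => ∫ τ : ℝ, ((|τ| ^ n : ℝ) : ℂ) * F (τ • emb σ)) ∧
    ∫ σ : E n, ∫ τ : ℝ, ((|τ| ^ n : ℝ) : ℂ) * F (τ • emb σ) = ∫ ξ, F ξ := by
  set G : ℝ × E n → ℂ := fun p => F (snocPoint p) with hG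
  have hGi : Integrable G (volume.prod volume) :=
    measurePreserving_snocPoint.integrable_comp_of_integrable hF
  have hGint : ∫ p, G p ∂(volume.prod volume) = ∫ ξ, F ξ := by
    have h1 := integral_map (μ := (volume : Measure (ℝ × E n)))
      measurePreserving_snocPoint.measurable.aemeasurable (f := F) hFm.aestronglyMeasurable
    rw [measurePreserving_snocPoint.map_eq] at h1
    exact h1.symm
  have hfin := finrank_E n
  have hsc : ∀ τ : ℝ, τ ≠ 0 → ∀ A : E n → ℂ,
      ∫ σ, ((|τ| ^ n : ℝ) : ℂ) * A (τ • σ) = ∫ σ, A σ := fun τ hτ A => by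
    rw [integral_const_mul, Measure.integral_comp_smul, hfin, Complex.real_smul, abs_inv, abs_pow,
      ← mul_assoc, ← Complex.ofReal_mul, mul_inv_cancel₀ (by positivity), Complex.ofReal_one,
      one_mul]
  have hP : Integrable (fun p : ℝ × E n => ((|p.1| ^ n : ℝ) : ℂ) * F (p.1 • emb p.2))
      (volume.prod volume) := by
    have hmeas : StronglyMeasurable
        (fun p : ℝ × E n => ((|p.1| ^ n : ℝ) : ℂ) * F (p.1 • emb p.2)) := by
      have hc : Continuous (fun p : ℝ × E n => p.1 • emb p.2) :=
        continuous_fst.smul (continuous_emb.comp continuous_snd)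
      have hc2 : Continuous (fun p : ℝ × E n => ((|p.1| ^ n : ℝ) : ℂ)) := by fun_prop
      exact hc2.stronglyMeasurable.mul (hFm.comp_measurable hc.measurable)
    refine (integrable_prod_iff hmeas.aestronglyMeasurable).mpr ⟨?_, ?_⟩
    · filter_upwards [ae_ne_zero_real, hGi.prod_right_ae] with τ hτ h
      have h1 := (h.comp_smul hτ).const_mul ((|τ| ^ n : ℝ) : ℂ)
      simpa only [hG, snocPoint_smul] using h1
    · refine hGi.integral_norm_prod_left.congr ?_
      filter_upwards [ae_ne_zero_real] with τ hτ
      have h1 := Measure.integral_comp_smul (volume : Measure (E n)) (fun σ => ‖G (τ, σ)‖) τ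
      simp only [hG, snocPoint_smul] at h1
      simp only [norm_mul, integral_const_mul, Complex.norm_real, norm_pow, Real.norm_eq_abs,
        abs_abs]
      rw [h1, hfin, smul_eq_mul, abs_inv, abs_pow, ← mul_assoc, mul_inv_cancel₀ (by positivity),
        one_mul]
  refine ⟨hP.swap.integral_prod_left, ?_⟩
  rw [← hGint, integral_prod _ hGi, ← integral_integral_swap hP]
  refine integral_congr_ae ?_
  filter_upwards [ae_ne_zero_real] with τ hτ
  have h1 := hsc τ hτ (fun σ => G (τ, σ))
  simp only [hG, snocPoint_smul] at h1
  exact h1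

end Polar

/-! ### The operator `∫ H(x,ξ) e^{2iπκ⟨x,ξ⟩} w(ξ) dξ` -/

section StandardOperator

variable {n : ℕ} {H : E (n + 1) × E (n + 1) → ℂ}

/-- The operator `w ↦ ∫ H(x,ξ) e^{2iπκ⟨x,ξ⟩} w(ξ) dξ`. With `κ = 1` it is the standard calculus; with
`κ = -1` and the variables of `H` exchanged, it is the antistandard one. -/
def stdOp {m : ℕ} (κ : ℝ) (H : E m × E m → ℂ) (w : E m → ℂ) (x : E m) : ℂ :=
  ∫ ξ, H (x, ξ) * phase (κ • x) ξ * w ξ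

theorem op0_eq_stdOp {m : ℕ} (H : E m × E m → ℂ) (v : E m → ℂ) : op0 H v = stdOp 1 H (𝓕 v) := by
  ext x
  simp [op0, stdOp, phase]

theorem fourierOp1_eq_stdOp {m : ℕ} (H : E m × E m → ℂ) (v : E m → ℂ) :
    fourierOp1 H v = stdOp (-1) (swapSymbol H) v := by
  ext x
  simp [fourierOp1, stdOp, phase, swapSymbol, real_inner_comm]

theorem continuous_smul_phase {m : ℕ} (κ : ℝ) (ξ : E m) : Continuous fun x => phase (κ • x) ξ := by
  unfold phase; fun_prop

theorem continuous_stdOp {m : ℕ} {H : E m × E m → ℂ} (hH : IsInvariantSymbol H) (κ : ℝ)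
    (w : 𝓢(E m, ℂ)) : Continuous (stdOp κ H w) := by
  obtain ⟨c, hc⟩ := hH.exists_norm_le
  have hHc := hH.smooth.continuous
  have hwc := w.continuous
  refine continuous_of_dominated (bound := fun ξ => c * ‖w ξ‖) (fun x => ?_) (fun x => ?_) ?_ ?_
  · have := continuous_phase (κ • x)
    exact Continuous.aestronglyMeasurable (by fun_prop)
  · refine Eventually.of_forall fun ξ => ?_
    rw [norm_mul, norm_mul, norm_phase, mul_one]
    gcongr
    exact hc _
  · exact w.integrable.norm.const_mul c
  · refine Eventually.of_forall fun ξ => ?_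
    have := continuous_smul_phase κ ξ
    fun_prop

/-- The behaviour of `stdOp κ H w` at large arguments, by invariance of `H`: dilating the argument
amounts to dilating `w` the opposite way. -/
theorem stdOp_smul (hH : IsInvariantSymbol H) (κ : ℝ) (w : E (n + 1) → ℂ) {t : ℝ} (ht : t ≠ 0)
    (x : E (n + 1)) : stdOp κ H w (t • x) =
      (((|t| ^ (n + 1))⁻¹ : ℝ) : ℂ) * kernelInt (fun ξ => H (x, ξ)) (κ • x) w t⁻¹ := by
  have h : ∀ ξ, H (t • x, ξ) * phase (κ • t • x) ξ * w ξ =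
      (fun η => H (x, η) * phase (κ • x) η * w (t⁻¹ • η)) (t • ξ) := by
    intro ξ
    simp only [hH.apply_smul ht, inv_smul_smul₀ ht, phase]
    congr 4
    simp only [inner_smul_left, inner_smul_right, conj_trivial]
    push_cast; ring
  rw [stdOp, integral_congr_ae (Eventually.of_forall h)]
  refine (Measure.integral_comp_smul (volume : Measure (E (n + 1)))
    (fun η => H (x, η) * phase (κ • x) η * w (t⁻¹ • η)) t).trans ?_
  rw [Complex.real_smul, finrank_E, abs_inv, abs_pow, kernelInt]

theorem stronglyMeasurable_kernelInt {V : Type*} [NormedAddCommGroup V] [InnerProductSpace ℝ V]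
    [FiniteDimensional ℝ V] [MeasurableSpace V] [BorelSpace V] {g : V → ℂ} (hg : Continuous g)
    (y : V) {w : V → ℂ} (hw : Continuous w) : StronglyMeasurable (kernelInt g y w) := by
  have hp := continuous_phase y
  have hc : Continuous (fun p : ℝ × V => g p.2 * phase y p.2 * w (p.1 • p.2)) := by fun_prop
  exact hc.stronglyMeasurable.integral_prod_right

theorem stronglyMeasurable_homPart (lam : ℝ) (ε : Fin 2) {w : E (n + 1) → ℂ} (hw : Continuous w) :
    StronglyMeasurable (homPart lam ε w) := by
  have h : StronglyMeasurable
      (fun p : E (n + 1) × ℝ => absPow ε (homExp n lam) p.2 * w (p.2 • p.1)) := by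
    have hc : Continuous (fun p : E (n + 1) × ℝ => w (p.2 • p.1)) := by fun_prop
    exact ((measurable_absPow _ _).comp measurable_snd).stronglyMeasurable.mul hc.stronglyMeasurable
  exact stronglyMeasurable_const.mul h.integral_prod_right

/-- Homogeneous components of `∫ H(x,ξ) e^{2iπκ⟨x,ξ⟩} w(ξ) dξ`: the operator commutes with taking
homogeneous components, the integral being an oscillatory one on the homogeneous side. Both sides are
equal to the same integral `∫ |r|_ε^{(n-1)/2-iλ} K(r) dr`, where `K(r)` is the kernel for `w(r ·)`. -/
theorem integrable_and_hasOscIntegral_stdOp (hH : IsInvariantSymbol H) {κ : ℝ} (hκ : κ ≠ 0)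
    (w : 𝓢(E (n + 1), ℂ)) (lam : ℝ) (ε : Fin 2) {x : E (n + 1)} (hx : x ≠ 0) :
    Integrable (homIntegrand lam ε (stdOp κ H w) x) ∧
    HasOscIntegral (fun ξ => H (x, ξ) * phase (κ • x) ξ * homPart (-lam) ε w ξ)
      (homPart lam ε (stdOp κ H w) x) := by
  obtain ⟨C, hC⟩ := hH.exists_isSymb_of_ne_zero hx
  have hy : κ • x ≠ 0 := smul_ne_zero hκ hx
  set K := kernelInt (fun ξ => H (x, ξ)) (κ • x) w with hK
  obtain ⟨h1, h2⟩ := integrable_and_integral_absPow_inv n lam ε K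
  have hae : homIntegrand lam ε (stdOp κ H w) x =ᵐ[volume] fun t : ℝ =>
      absPow ε (homExp n lam) t * ((((|t| ^ (n + 1))⁻¹ : ℝ) : ℂ) * K t⁻¹) := by
    filter_upwards [ae_ne_zero_real] with t ht
    rw [homIntegrand, stdOp_smul hH κ w ht, ← homExp]
  have hosc := hasOscIntegral_symbol_mul_phase_mul_homogeneous (vanishesToOrder_zero w) ε
    (neg_one_lt_zero_add_homExp_re n (-lam)) (homExp_re_sub_finrank_lt n (-lam)) hC hy
  obtain ⟨M, hM⟩ := exists_majorant_kernelInt w (vanishesToOrder_zero w) ε (homExp n (-lam)) C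
  have hint : Integrable (fun r : ℝ => absPow ε (homExp n (-lam)) r * K r) := by
    refine ((integrable_twoPow (neg_one_lt_zero_add_homExp_re n (-lam))
      (homExp_re_sub_finrank_lt n (-lam))).const_mul
        (max (M / ‖κ • x‖ ^ (0 + (Module.finrank ℝ (E (n + 1)) + 1))) M)).mono'
      (((measurable_absPow _ _).stronglyMeasurable.mul
        (stronglyMeasurable_kernelInt hC.smooth.continuous _ w.continuous)).aestronglyMeasurable) ?_
    filter_upwards [ae_ne_zero_real] with r hr
    exact hM _ hC _ hy r hr
  refine ⟨(integrable_congr hae).mpr (h1.mpr hint), ?_⟩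
  have hval : homPart lam ε (stdOp κ H w) x =
      1 / (4 * Real.pi) * ∫ r : ℝ, absPow ε (homExp n (-lam)) r * K r := by
    rw [homPart, integral_congr_ae hae, h2]
  rw [hval]
  refine (hosc.const_mul (1 / (4 * Real.pi))).congr_ae (Eventually.of_forall fun ξ => ?_)
  simp only [homPart_eq]
  ring

/-- `∫ H(x,ξ) e^{2iπκ⟨x,ξ⟩} w(ξ) dξ` is `O((1+|x|)^{-n-1})` for a Schwartz function `w`, hence square
integrable on `ℝ^{n+1}`. -/
theorem memLp_stdOp (hH : IsInvariantSymbol H) {κ : ℝ} (hκ : |κ| = 1) (w : 𝓢(E (n + 1), ℂ)) :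
    MemLp (stdOp κ H w) 2 := by
  obtain ⟨C, hC⟩ := hH.exists_isSymb
  obtain ⟨c, hc⟩ := hH.exists_norm_le
  obtain ⟨M, hM⟩ := exists_majorant_kernelInt w (vanishesToOrder_zero w) 0 0 C
  have hcont := continuous_stdOp hH κ w
  have hc0 : 0 ≤ c := (norm_nonneg _).trans (hc 0)
  set B := max (c * ∫ ξ, ‖w ξ‖) M with hB
  have hB0 : 0 ≤ B := le_max_of_le_left (mul_nonneg hc0 (by positivity))
  have hb : ∀ y, ‖stdOp κ H w y‖ ≤ 2 ^ (n + 1) * B * (1 + ‖y‖) ^ (-((n + 1 : ℕ) : ℝ)) := by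
    intro y
    have h0 : 0 < 1 + ‖y‖ := by positivity
    rw [Real.rpow_neg h0.le, Real.rpow_natCast, ← div_eq_mul_inv, le_div_iff₀ (by positivity)]
    rcases le_total ‖y‖ 1 with hy | hy
    · have h1 : ‖stdOp κ H w y‖ ≤ c * ∫ ξ, ‖w ξ‖ := by
        rw [← integral_const_mul]
        refine norm_integral_le_of_norm_le (w.integrable.norm.const_mul c)
          (Eventually.of_forall fun ξ => ?_)
        rw [norm_mul, norm_mul, norm_phase, mul_one]
        gcongr
        exact hc _
      calc ‖stdOp κ H w y‖ * (1 + ‖y‖) ^ (n + 1) ≤ B * (1 + 1) ^ (n + 1) := by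
            gcongr
            exact h1.trans (le_max_left _ _)
        _ = _ := by norm_num; ring
    · set t := ‖y‖ with ht
      have ht0 : 0 < t := by linarith
      set z := t⁻¹ • y with hz
      have hzn : ‖z‖ = 1 := by rw [hz, norm_smul, norm_inv, ht, norm_norm, inv_mul_cancel₀ ht0.ne']
      have hκz : ‖κ • z‖ = 1 := by rw [norm_smul, hzn, Real.norm_eq_abs, hκ, mul_one]
      have hy' : y = t • z := by rw [hz, smul_inv_smul₀ ht0.ne']
      have h1 := hM _ (hC z hzn) (κ • z) (norm_pos_iff.mp (by rw [hκz]; exact one_pos)) t⁻¹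
        (inv_ne_zero ht0.ne')
      have h2 : absPow 0 0 t⁻¹ = 1 := by simp [absPow]
      have h3 : twoPow (((0 : ℕ) : ℝ) + (0 : ℂ).re) ((0 : ℂ).re - Module.finrank ℝ (E (n + 1))) t⁻¹ = 1 := by
        rw [twoPow, if_pos (by rw [abs_inv, abs_of_pos ht0]; exact inv_le_one_of_one_le₀ hy)]
        simp
      rw [h2, one_mul, hκz, h3, one_pow, div_one, max_self, mul_one] at h1
      rw [hy', stdOp_smul hH κ _ ht0.ne', norm_mul, Complex.norm_real, Real.norm_eq_abs,
        abs_of_nonneg (by positivity), abs_of_pos ht0]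
      calc (t ^ (n + 1))⁻¹ * ‖kernelInt (fun ξ => H (z, ξ)) (κ • z) w t⁻¹‖ * (1 + t) ^ (n + 1)
          ≤ (t ^ (n + 1))⁻¹ * B * (t + t) ^ (n + 1) := by
            gcongr
            exact h1.trans (le_max_right _ _)
        _ = _ := by rw [← two_mul, mul_pow]; field_simp
  refine (memLp_two_iff_integrable_sq_norm hcont.aestronglyMeasurable).mpr ?_
  have hi : Integrable (fun y : E (n + 1) => (1 + ‖y‖) ^ (-(2 * ((n + 1 : ℕ) : ℝ)))) :=
    integrable_one_add_norm (by rw [finrank_E]; push_cast; linarith [n.cast_nonneg (α := ℝ)])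
  refine (hi.const_mul ((2 ^ (n + 1) * B) ^ 2)).mono'
    (hcont.norm.pow 2).aestronglyMeasurable (Eventually.of_forall fun y => ?_)
  rw [Real.norm_of_nonneg (by positivity)]
  refine (pow_le_pow_left₀ (norm_nonneg _) (hb y) 2).trans (le_of_eq ?_)
  rw [mul_pow, ← Real.rpow_natCast ((1 + ‖y‖) ^ _) 2, ← Real.rpow_mul (by positivity)]
  congr 2
  push_cast; ring

end StandardOperator

/-! ### The radial integral of a symbol -/

section RadialSymbol

variable {n m : ℕ}

/-- The integrand `H(x,tξ) e^{2iπκt} |t|_ε^α`, whose oscillatory integral with respect to `t` is, up to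
a constant, the symbol on projective space. -/
def radialIntegrand (κ : ℝ) (ε : Fin 2) (α : ℂ) (H : E m × E m → ℂ) (x ξ : E m) (t : ℝ) : ℂ :=
  H (x, t • ξ) * phase κ t * absPow ε α t

theorem radialIntegrand_smul_inv_smul {H : E m × E m → ℂ} {t : ℝ} (x ξ : E m)
    (hH : ∀ x ξ : E m, H (t • x, t⁻¹ • ξ) = H (x, ξ)) (κ : ℝ) (ε : Fin 2) (α : ℂ) :
    radialIntegrand κ ε α H (t • x) (t⁻¹ • ξ) = radialIntegrand κ ε α H x ξ := by
  ext r
  rw [radialIntegrand, smul_comm r, hH, radialIntegrand]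

theorem truncSymbol_invariant {H : E m × E m → ℂ} (hH : IsInvariantSymbol H) (χ : 𝓢(ℝ, ℂ)) (δ : ℝ)
    {t : ℝ} (ht : t ≠ 0) (x ξ : E m) :
    truncSymbol χ δ H (t • x, t⁻¹ • ξ) = truncSymbol χ δ H (x, ξ) := by
  have h0 : ‖t‖ ≠ 0 := norm_ne_zero_iff.mpr ht
  have h : ‖t • x‖ ^ 2 * ‖t⁻¹ • ξ‖ ^ 2 = ‖x‖ ^ 2 * ‖ξ‖ ^ 2 := by
    rw [norm_smul, norm_smul, norm_inv]; field_simp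
  simp only [truncSymbol, h, hH.invariant t ht]

/-- For fixed `x`, the invariant truncation of `H` is a radial cutoff in `ξ`, at the scale
`√δ |x|`. -/
theorem truncSymbol_eq_radialSchwartz (χ : 𝓢(ℝ, ℂ)) {δ : ℝ} (hδ : 0 ≤ δ) (H : E m × E m → ℂ)
    (x ξ : E m) : truncSymbol χ δ H (x, ξ) = radialSchwartz χ ((√δ * ‖x‖) • ξ) * H (x, ξ) := by
  rw [truncSymbol, radialSchwartz_apply, norm_smul, norm_mul, norm_norm, Real.norm_of_nonneg
    (Real.sqrt_nonneg δ), mul_pow, mul_pow, Real.sq_sqrt hδ, mul_assoc]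

/-- Along the ray through `ξ`, the invariant truncation is an even cutoff at the scale `√δ |x| |ξ|`. -/
theorem radialIntegrand_truncSymbol (κ : ℝ) (ε : Fin 2) (α : ℂ) (χ : 𝓢(ℝ, ℂ)) {δ : ℝ} (hδ : 0 ≤ δ)
    (H : E m × E m → ℂ) (x ξ : E m) (t : ℝ) :
    radialIntegrand κ ε α (truncSymbol χ δ H) x ξ t =
      radialSchwartz χ ((√δ * (‖x‖ * ‖ξ‖)) • t) * radialIntegrand κ ε α H x ξ t := by
  have h : ‖(√δ * ‖x‖) • t • ξ‖ = ‖(√δ * (‖x‖ * ‖ξ‖)) • t‖ := by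
    simp only [norm_smul, norm_mul, norm_norm]; ring
  rw [radialIntegrand, truncSymbol_eq_radialSchwartz χ hδ, radialSchwartz_apply, h, radialIntegrand,
    radialSchwartz_apply]
  ring

theorem tendsto_sqrt_mul_nhdsGT_zero {a : ℝ} (ha : 0 < a) :
    Tendsto (fun δ : ℝ => √δ * a) (𝓝[>] 0) (𝓝[>] 0) := by
  refine tendsto_nhdsWithin_iff.mpr ⟨?_, ?_⟩
  · have h : Continuous fun δ : ℝ => √δ * a := by fun_prop
    simpa using (h.tendsto 0).mono_left nhdsWithin_le_nhds
  · filter_upwards [self_mem_nhdsWithin] with δ hδ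
    exact Set.mem_Ioi.mpr (mul_pos (Real.sqrt_pos.mpr (Set.mem_Ioi.mp hδ)) ha)

/-- The function `t ↦ H(x,tξ)` is a symbol on the line, uniformly in `|x||ξ| ≤ M`. -/
theorem IsInvariantSymbol.isSymb_ray {H : E m × E m → ℂ} (hH : IsInvariantSymbol H) {C : ℕ → ℝ}
    (hC : ∀ x : E m, ‖x‖ = 1 → IsSymb 0 C (fun ξ => H (x, ξ))) {M : ℝ} (hM : 1 ≤ M) {x : E m}
    (hx : x ≠ 0) {ξ : E m} (hξ : ‖x‖ * ‖ξ‖ ≤ M) :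
    IsSymb 0 (fun k => M ^ k * C k) (fun t : ℝ => H (x, t • ξ)) :=
  hH.isSymb_comp hC (ContinuousLinearMap.toSpanSingleton ℝ ξ) (norm_nonneg ξ)
    (fun t => by simp [norm_smul, mul_comm]) hM hx hξ

theorem IsInvariantSymbol.exists_hasOscIntegral_radial {H : E m × E m → ℂ}
    (hH : IsInvariantSymbol H) {κ : ℝ} (hκ : κ ≠ 0) (ε : Fin 2) {α : ℂ} (hα : -1 < α.re) {x : E m}
    (hx : x ≠ 0) (ξ : E m) : ∃ J, HasOscIntegral (radialIntegrand κ ε α H x ξ) J := by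
  obtain ⟨C, hC⟩ := hH.exists_isSymb
  exact (exists_hasOscIntegral_absPow ε hα hκ).1 _
    (hH.isSymb_ray hC (le_max_left 1 (‖x‖ * ‖ξ‖)) hx (le_max_right _ _))

/-- The invariant truncations compute the oscillatory integral. -/
theorem integrable_and_tendsto_radial_truncSymbol {H : E m × E m → ℂ} {κ : ℝ} {ε : Fin 2} {α : ℂ}
    {x ξ : E m} (hx : x ≠ 0) (hξ : ξ ≠ 0) {J : ℂ}
    (hJ : HasOscIntegral (radialIntegrand κ ε α H x ξ) J) {χ : 𝓢(ℝ, ℂ)} (hχ : χ 0 = 1) :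
    (∀ δ : ℝ, 0 < δ → Integrable (radialIntegrand κ ε α (truncSymbol χ δ H) x ξ)) ∧
    Tendsto (fun δ : ℝ => ∫ t, radialIntegrand κ ε α (truncSymbol χ δ H) x ξ t) (𝓝[>] 0) (𝓝 J) := by
  have ha : 0 < ‖x‖ * ‖ξ‖ := mul_pos (norm_pos_iff.mpr hx) (norm_pos_iff.mpr hξ)
  obtain ⟨h1, h2⟩ := hJ (radialSchwartz χ) (by rw [radialSchwartz_apply]; simpa using hχ)
  have he : ∀ δ : ℝ, 0 ≤ δ → radialIntegrand κ ε α (truncSymbol χ δ H) x ξ =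
      fun t => radialSchwartz χ ((√δ * (‖x‖ * ‖ξ‖)) • t) * radialIntegrand κ ε α H x ξ t :=
    fun δ hδ => funext fun t => radialIntegrand_truncSymbol κ ε α χ hδ H x ξ t
  refine ⟨fun δ hδ => ?_, ?_⟩
  · rw [he δ hδ.le]
    exact h1 _ (mul_pos (Real.sqrt_pos.mpr hδ) ha)
  · refine (h2.comp (tendsto_sqrt_mul_nhdsGT_zero ha)).congr' ?_
    filter_upwards [self_mem_nhdsWithin] with δ hδ
    rw [he δ (Set.mem_Ioi.mp hδ).le]
    rfl

end RadialSymbol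

/-! ### The operator on projective space -/

section ProjectiveKernel

variable {n : ℕ} {H : E (n + 1) × E (n + 1) → ℂ}

/-- Integration along a line through the origin. The substitution `t = (1+⟨s,σ⟩)τ` turns the integral
over the line spanned by `(σ,1)` into the radial integral of the symbol; the powers of `1+⟨s,σ⟩`
collected on the way are the kernel `|1+⟨s,σ⟩|_ε^{-(n+1)/2-iλ}`. -/
theorem integral_line_eq (κ : ℝ) (ε : Fin 2) (lam : ℝ) (w : E (n + 1) → ℂ) (s σ : E n)
    (hp : (1 + inner ℝ s σ : ℝ) ≠ 0) :
    ∫ τ : ℝ, ((|τ| ^ n : ℝ) : ℂ) * (H (emb s, τ • emb σ) * phase (κ • emb s) (τ • emb σ) *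
        homPart (-lam) ε w (τ • emb σ)) =
      (∫ t, radialIntegrand κ ε (homExp n lam) H (emb s) ((1 + inner ℝ s σ : ℝ)⁻¹ • emb σ) t) *
        absPow ε (-((n : ℂ) + 1) / 2 - I * lam) (1 + inner ℝ s σ) *
        homPart (-lam) ε w (emb σ) := by
  set p : ℝ := 1 + inner ℝ s σ with hpdef
  set α := homExp n lam with hα
  have hp0 : ((|p| : ℝ) : ℂ) ≠ 0 := by simpa using hp
  -- the exponents of the kernel and of the radial integral add up to `-1`, which the Jacobian offsets
  have hpp : absPow ε (-((n : ℂ) + 1) / 2 - I * lam) p * absPow ε α p =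
      ((|p| : ℝ) : ℂ)⁻¹ := by
    rw [absPow_sign_mul_self _ _ _ hp, show -((n : ℂ) + 1) / 2 - I * lam + α = -1 by
      rw [hα, homExp]; ring, Complex.cpow_neg_one]
  have hsub := Measure.integral_comp_mul_right
    (radialIntegrand κ ε α H (emb s) (p⁻¹ • emb σ)) p
  have hpt : ∀ᵐ τ : ℝ, ((|τ| ^ n : ℝ) : ℂ) * (H (emb s, τ • emb σ) *
      phase (κ • emb s) (τ • emb σ) * homPart (-lam) ε w (τ • emb σ)) =
      ((|p| : ℝ) : ℂ) * absPow ε (-((n : ℂ) + 1) / 2 - I * lam) p * homPart (-lam) ε w (emb σ) *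
        radialIntegrand κ ε α H (emb s) (p⁻¹ • emb σ) (τ * p) := by
    filter_upwards [ae_ne_zero_real] with τ hτ
    have hτ0 : ((|τ| : ℝ) : ℂ) ≠ 0 := by simpa using hτ
    have h1 : phase (κ • emb s) (τ • emb σ) = phase κ (τ * p) := by
      simp only [phase, inner_smul_left, inner_smul_right, inner_emb_emb, conj_trivial]
      simp [hpdef]
      ring_nf
    have h2 : absPow ε α τ =
        ((|τ| ^ n : ℝ) : ℂ) * absPow ε (-((n : ℂ) + 1) / 2 - I * ((-lam : ℝ) : ℂ)) τ := by
      rw [show α = (-((n : ℂ) + 1) / 2 - I * ((-lam : ℝ) : ℂ)) + (n : ℂ) by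
        rw [hα, homExp]; push_cast; ring, absPow_add _ _ _ hτ, Complex.cpow_natCast]
      push_cast; rfl
    rw [homPart_smul _ _ _ hτ, radialIntegrand, smul_smul, mul_assoc τ, mul_inv_cancel₀ hp, mul_one,
      h1, absPow_mul, h2]
    linear_combination (-((|τ| ^ n : ℝ) : ℂ) * absPow ε (-((n : ℂ) + 1) / 2 - I * ((-lam : ℝ) : ℂ)) τ *
      H (emb s, τ • emb σ) * phase κ (τ * p) * homPart (-lam) ε w (emb σ) * ((|p| : ℝ) : ℂ)) * hpp -
      ((|τ| ^ n : ℝ) : ℂ) * absPow ε (-((n : ℂ) + 1) / 2 - I * ((-lam : ℝ) : ℂ)) τ *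
      H (emb s, τ • emb σ) * phase κ (τ * p) * homPart (-lam) ε w (emb σ) * (mul_inv_cancel₀ hp0)
  rw [integral_congr_ae hpt, integral_const_mul, hsub, Complex.real_smul, abs_inv]
  push_cast
  field_simp

/-- The integral over projective space, for the truncated symbols: in homogeneous coordinates it is
an integral over `ℝ^{n+1}` with a cutoff, and its limit is the oscillatory integral which gives a
homogeneous component of `stdOp κ H w`. -/
theorem integrable_and_tendsto_projective (hH : IsInvariantSymbol H) {κ : ℝ} (hκ : κ ≠ 0)
    (w : 𝓢(E (n + 1), ℂ)) (lam : ℝ) (ε : Fin 2) {χ : 𝓢(ℝ, ℂ)} (hχ : χ 0 = 1) (s : E n) :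
    (∀ δ : ℝ, 0 < δ → Integrable (fun σ : E n =>
      (∫ t, radialIntegrand κ ε (homExp n lam) (truncSymbol χ δ H) (emb s)
          ((1 + inner ℝ s σ : ℝ)⁻¹ • emb σ) t) *
        absPow ε (-((n : ℂ) + 1) / 2 - I * lam) (1 + inner ℝ s σ) *
        homPart (-lam) ε w (emb σ))) ∧
    Tendsto (fun δ : ℝ => ∫ σ : E n,
      (∫ t, radialIntegrand κ ε (homExp n lam) (truncSymbol χ δ H) (emb s)
          ((1 + inner ℝ s σ : ℝ)⁻¹ • emb σ) t) *
        absPow ε (-((n : ℂ) + 1) / 2 - I * lam) (1 + inner ℝ s σ) *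
        homPart (-lam) ε w (emb σ)) (𝓝[>] 0) (𝓝 (homPart lam ε (stdOp κ H w) (emb s))) := by
  have hx : 0 < ‖emb s‖ := norm_pos_iff.mpr (emb_ne_zero s)
  obtain ⟨h1, h2⟩ := (integrable_and_hasOscIntegral_stdOp hH hκ w lam ε (emb_ne_zero s)).2
    (radialSchwartz χ) (by rw [radialSchwartz_apply]; simpa using hχ)
  have hpolar : ∀ δ : ℝ, 0 < δ → _ := fun δ hδ =>
    integrable_and_integral_polar (h1 (√δ * ‖emb s‖) (mul_pos (Real.sqrt_pos.mpr hδ) hx)) (by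
      have hHc : Continuous fun ξ => H (emb s, ξ) :=
        hH.smooth.continuous.comp (continuous_const.prodMk continuous_id)
      have hpc := continuous_phase (κ • emb s)
      have hχc : Continuous fun ξ : E (n + 1) => radialSchwartz χ ((√δ * ‖emb s‖) • ξ) :=
        (radialSchwartz χ).continuous.comp (continuous_const_smul _)
      exact hχc.stronglyMeasurable.mul ((hHc.mul hpc).stronglyMeasurable.mul
        (stronglyMeasurable_homPart (-lam) ε w.continuous)))
  have hae : ∀ δ : ℝ, 0 < δ → ∀ᵐ σ : E n, _ = _ := fun δ hδ => by
    filter_upwards [ae_one_add_inner_ne_zero s] with σ hσ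
    have h3 := integral_line_eq (H := truncSymbol χ δ H) κ ε lam w s σ hσ
    simp only [truncSymbol_eq_radialSchwartz χ hδ.le, mul_assoc (radialSchwartz χ _)] at h3
    exact h3
  refine ⟨fun δ hδ => ((hpolar δ hδ).1.congr (hae δ hδ)), ?_⟩
  refine (h2.comp (tendsto_sqrt_mul_nhdsGT_zero hx)).congr' ?_
  filter_upwards [self_mem_nhdsWithin] with δ hδ
  rw [← integral_congr_ae (hae δ (Set.mem_Ioi.mp hδ))]
  exact (hpolar δ (Set.mem_Ioi.mp hδ)).2.symm

theorem exists_norm_homPart_le (lam : ℝ) (ε : Fin 2) (w : 𝓢(E (n + 1), ℂ)) :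
    ∃ C, ∀ y : E (n + 1), y ≠ 0 → ‖homPart lam ε w y‖ ≤ C * ‖y‖ ^ (-((n : ℝ) + 1) / 2) := by
  obtain ⟨C, hC⟩ := (isCompact_sphere (0 : E (n + 1)) 1).exists_bound_of_continuousOn
    ((continuousOn_homPart lam ε w).mono fun y hy => by
      rintro rfl
      simp at hy)
  refine ⟨C, fun y hy => ?_⟩
  have hy0 : 0 < ‖y‖ := norm_pos_iff.mpr hy
  have h1 := hC (‖y‖⁻¹ • y) (by simp [norm_smul, hy0.ne'])
  have h2 := homPart_smul lam ε w hy0.ne' (‖y‖⁻¹ • y)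
  rw [smul_inv_smul₀ hy0.ne'] at h2
  rw [h2, norm_mul, norm_absPow _ _ hy0.ne', abs_norm, mul_comm]
  have h3 : (-((n : ℂ) + 1) / 2 - I * (lam : ℂ)).re = -((n : ℝ) + 1) / 2 := by simp
  rw [h3]
  gcongr

theorem norm_emb_sq (σ : E n) : ‖emb σ‖ ^ 2 = 1 + ‖σ‖ ^ 2 := by
  rw [← real_inner_self_eq_norm_sq, inner_emb_emb, real_inner_self_eq_norm_sq]

theorem one_add_norm_le_norm_emb (σ : E n) : 1 + ‖σ‖ ≤ 2 * ‖emb σ‖ := by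
  have h := norm_emb_sq σ
  refine le_of_sq_le_sq ?_ (by positivity) |>.trans le_rfl
  nlinarith [sq_nonneg (‖σ‖ - 1)]

/-- The integral over projective space, for functions which vanish near the singularity of the
kernel. On the support, `|x| |ξ|` stays bounded for `ξ = (σ,1)/(1+⟨s,σ⟩)`; so the radial integrals are
uniformly bounded, and dominated convergence applies. -/
theorem integrable_and_integral_projective (hH : IsInvariantSymbol H) {κ : ℝ} (hκ : κ ≠ 0)
    (w : 𝓢(E (n + 1), ℂ)) (lam : ℝ) (ε : Fin 2) (s : E n) {J : E (n + 1) → ℂ}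
    (hJ : ∀ ξ, inner ℝ (emb s) ξ = (1 : ℝ) →
      HasOscIntegral (radialIntegrand κ ε (homExp n lam) H (emb s) ξ) (J ξ)) {c : ℝ} (hc : 0 < c)
    (hw : ∀ σ : E n, |1 + inner ℝ s σ| < c * ‖emb σ‖ → homPart (-lam) ε w (emb σ) = 0) :
    Integrable (fun σ : E n => J ((1 + inner ℝ s σ : ℝ)⁻¹ • emb σ) *
      absPow ε (-((n : ℂ) + 1) / 2 - I * lam) (1 + inner ℝ s σ) * homPart (-lam) ε w (emb σ)) ∧
    ∫ σ : E n, J ((1 + inner ℝ s σ : ℝ)⁻¹ • emb σ) *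
      absPow ε (-((n : ℂ) + 1) / 2 - I * lam) (1 + inner ℝ s σ) * homPart (-lam) ε w (emb σ) =
      homPart lam ε (stdOp κ H w) (emb s) := by
  obtain ⟨χ, hχ⟩ := exists_schwartz_apply_zero_eq_one ℝ
  obtain ⟨h1, h2⟩ := integrable_and_tendsto_projective hH hκ w lam ε hχ s
  have hx : 0 < ‖emb s‖ := norm_pos_iff.mpr (emb_ne_zero s)
  obtain ⟨C, hC⟩ := hH.exists_isSymb
  obtain ⟨Cw, hCw⟩ := exists_norm_homPart_le (-lam) ε w
  set M := max 1 (‖emb s‖ * c⁻¹) with hM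
  have hM1 : 1 ≤ M := le_max_left _ _
  obtain ⟨B, hB⟩ := (exists_hasOscIntegral_absPow ε (neg_one_lt_homExp_re n lam)
    (C := fun k => M ^ k * C k) hκ).2 (radialSchwartz χ)
  set e : ℝ := -((n : ℝ) + 1) / 2 with he
  have hbound : ∀ δ : ℝ, 0 < δ → √δ * M ≤ 1 → ∀ᵐ σ : E n,
      ‖(∫ t, radialIntegrand κ ε (homExp n lam) (truncSymbol χ δ H) (emb s)
          ((1 + inner ℝ s σ : ℝ)⁻¹ • emb σ) t) *
        absPow ε (-((n : ℂ) + 1) / 2 - I * lam) (1 + inner ℝ s σ) *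
        homPart (-lam) ε w (emb σ)‖ ≤
      |B| * c ^ e * |Cw| * 2 ^ (n + 1) * (1 + ‖σ‖) ^ (-((n : ℝ) + 1)) := by
    intro δ hδ hδM
    filter_upwards [ae_one_add_inner_ne_zero s] with σ hp
    set p : ℝ := 1 + inner ℝ s σ with hpdef
    have hσ : 0 < ‖emb σ‖ := norm_pos_iff.mpr (emb_ne_zero σ)
    rcases lt_or_ge |p| (c * ‖emb σ‖) with h | h
    · rw [hw σ h, mul_zero, norm_zero]
      positivity
    have hξ : ‖emb s‖ * ‖p⁻¹ • emb σ‖ ≤ ‖emb s‖ * c⁻¹ := by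
      rw [norm_smul, norm_inv, Real.norm_eq_abs]
      gcongr
      rw [inv_mul_le_iff₀ (abs_pos.mpr hp), ← div_eq_mul_inv, le_div_iff₀ hc]
      linarith
    have hξM : ‖emb s‖ * ‖p⁻¹ • emb σ‖ ≤ M := hξ.trans (le_max_right _ _)
    have hξ0 : 0 < ‖p⁻¹ • emb σ‖ :=
      norm_pos_iff.mpr (smul_ne_zero (inv_ne_zero hp) (emb_ne_zero σ))
    have h3 := hB _ (hH.isSymb_ray hC hM1 (emb_ne_zero s) hξM) (√δ * (‖emb s‖ * ‖p⁻¹ • emb σ‖))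
      (mul_pos (Real.sqrt_pos.mpr hδ) (mul_pos hx hξ0))
      ((mul_le_mul_of_nonneg_left hξM (Real.sqrt_nonneg δ)).trans hδM)
    rw [norm_mul, norm_mul, norm_absPow _ _ hp]
    simp only [radialIntegrand_truncSymbol _ _ _ _ hδ.le]
    have he' : (-((n : ℂ) + 1) / 2 - I * (lam : ℂ)).re = e := by simp [he]
    have he0 : e ≤ 0 := by rw [he]; linarith [n.cast_nonneg (α := ℝ)]
    have h4 : |p| ^ e ≤ (c * ‖emb σ‖) ^ e := Real.rpow_le_rpow_of_nonpos (by positivity) h he0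
    have h5 : ‖emb σ‖ ^ (-((n : ℝ) + 1)) ≤ 2 ^ (n + 1) * (1 + ‖σ‖) ^ (-((n : ℝ) + 1)) := by
      have h6 : (1 + ‖σ‖) / 2 ≤ ‖emb σ‖ := by linarith [one_add_norm_le_norm_emb σ]
      refine (Real.rpow_le_rpow_of_nonpos (by positivity) h6
        (by linarith [n.cast_nonneg (α := ℝ)])).trans (le_of_eq ?_)
      rw [Real.div_rpow (by positivity) (by norm_num), Real.rpow_neg (by norm_num : (0 : ℝ) ≤ 2),
        div_inv_eq_mul, mul_comm]
      norm_cast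
    rw [he']
    calc _ ≤ |B| * (c * ‖emb σ‖) ^ e * (|Cw| * ‖emb σ‖ ^ e) := by
          gcongr
          · exact h3.trans (le_abs_self _)
          · refine (hCw _ (emb_ne_zero σ)).trans ?_
            gcongr
            exact le_abs_self _
      _ = |B| * c ^ e * |Cw| * ‖emb σ‖ ^ (-((n : ℝ) + 1)) := by
          rw [Real.mul_rpow hc.le hσ.le, show -((n : ℝ) + 1) = e + e by rw [he]; ring,
            Real.rpow_add hσ]
          ring
      _ ≤ _ := by
          rw [mul_assoc (|B| * c ^ e * |Cw|)]
          gcongr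
  have hpt : ∀ᵐ σ : E n, Tendsto (fun δ : ℝ =>
      (∫ t, radialIntegrand κ ε (homExp n lam) (truncSymbol χ δ H) (emb s)
          ((1 + inner ℝ s σ : ℝ)⁻¹ • emb σ) t) *
        absPow ε (-((n : ℂ) + 1) / 2 - I * lam) (1 + inner ℝ s σ) *
        homPart (-lam) ε w (emb σ)) (𝓝[>] 0) (𝓝 (J ((1 + inner ℝ s σ : ℝ)⁻¹ • emb σ) *
      absPow ε (-((n : ℂ) + 1) / 2 - I * lam) (1 + inner ℝ s σ) *
      homPart (-lam) ε w (emb σ))) := by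
    filter_upwards [ae_one_add_inner_ne_zero s] with σ hp
    exact (((integrable_and_tendsto_radial_truncSymbol (emb_ne_zero s)
      (smul_ne_zero (inv_ne_zero hp) (emb_ne_zero σ)) (hJ _ (by
        rw [inner_smul_right, inner_emb_emb, inv_mul_cancel₀ hp])) hχ).2).mul_const _).mul_const _
  have hsmall : ∀ᶠ δ : ℝ in 𝓝[>] 0, 0 < δ ∧ √δ * M ≤ 1 := by
    have h3 := tendsto_sqrt_mul_nhdsGT_zero (zero_lt_one.trans_le hM1)
    filter_upwards [self_mem_nhdsWithin,
      (h3.mono_right nhdsWithin_le_nhds).eventually (ge_mem_nhds one_pos)] with δ h4 h5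
    exact ⟨Set.mem_Ioi.mp h4, h5⟩
  have hint : Integrable fun σ : E n =>
      |B| * c ^ e * |Cw| * 2 ^ (n + 1) * (1 + ‖σ‖) ^ (-((n : ℝ) + 1)) :=
    (integrable_one_add_norm (by rw [finrank_E]; linarith)).const_mul _
  have hmeas : ∀ᶠ δ : ℝ in 𝓝[>] 0, AEStronglyMeasurable (fun σ : E n =>
      (∫ t, radialIntegrand κ ε (homExp n lam) (truncSymbol χ δ H) (emb s)
          ((1 + inner ℝ s σ : ℝ)⁻¹ • emb σ) t) *
        absPow ε (-((n : ℂ) + 1) / 2 - I * lam) (1 + inner ℝ s σ) *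
        homPart (-lam) ε w (emb σ)) := by
    filter_upwards [self_mem_nhdsWithin] with δ hδ
    exact (h1 δ (Set.mem_Ioi.mp hδ)).aestronglyMeasurable
  have hlim := tendsto_integral_filter_of_dominated_convergence _ hmeas
    (hsmall.mono fun δ hδ => hbound δ hδ.1 hδ.2) hint hpt
  refine ⟨?_, tendsto_nhds_unique hlim h2⟩
  obtain ⟨u, hu⟩ := exists_seq_tendsto (𝓝[>] (0 : ℝ))
  have hev := hu.eventually (hsmall.and hmeas)
  obtain ⟨N, hN⟩ := hev.exists_forall_of_atTop
  have hu' : Tendsto (fun k => u (k + N)) atTop (𝓝[>] (0 : ℝ)) :=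
    hu.comp (tendsto_add_atTop_nat N)
  refine hint.mono' (aestronglyMeasurable_of_tendsto_ae atTop
    (fun k => (hN (k + N) (Nat.le_add_left _ _)).2)
    (hpt.mono fun σ hσ => hσ.comp hu')) ?_
  filter_upwards [hpt, ae_all_iff.mpr fun k => hbound (u (k + N))
    (hN (k + N) (Nat.le_add_left _ _)).1.1 (hN (k + N) (Nat.le_add_left _ _)).1.2] with σ h4 h5
  exact le_of_tendsto (h4.comp hu').norm (Eventually.of_forall h5)

end ProjectiveKernel

/-! ### Rapidly decreasing amplitudes -/

section Amplitude

variable {m : ℕ}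

/-- Amplitudes `a(x,ξ)` all of whose derivatives decay rapidly as `|x| → ∞`, uniformly in `ξ`. -/
structure IsRapidAmplitude (a : E m × E m → ℂ) : Prop where
  smooth : ContDiff ℝ ∞ a
  bound : ∀ k M : ℕ, ∃ C, ∀ p, (1 + ‖p.1‖) ^ M * ‖iteratedFDeriv ℝ k a p‖ ≤ C

theorem IsRapidAmplitude.add {a b : E m × E m → ℂ} (ha : IsRapidAmplitude a)
    (hb : IsRapidAmplitude b) : IsRapidAmplitude (fun p => a p + b p) := by
  refine ⟨ha.smooth.add hb.smooth, fun k M => ?_⟩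
  obtain ⟨C, hC⟩ := ha.bound k M
  obtain ⟨C', hC'⟩ := hb.bound k M
  refine ⟨C + C', fun p => ?_⟩
  rw [fun_iteratedFDeriv_add_apply (ha.smooth.contDiffAt.of_le (mod_cast le_top))
    (hb.smooth.contDiffAt.of_le (mod_cast le_top))]
  refine (mul_le_mul_of_nonneg_left (norm_add_le _ _) (by positivity)).trans ?_
  rw [mul_add]
  exact add_le_add (hC p) (hC' p)

/-- The class is stable under multiplication by functions of `x` of temperate growth. -/
theorem IsRapidAmplitude.mul_fst {a : E m × E m → ℂ} (ha : IsRapidAmplitude a) {b : E m → ℂ}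
    (hb : b.HasTemperateGrowth) : IsRapidAmplitude (fun p => b p.1 * a p) := by
  have hbs : ContDiff ℝ ∞ (fun p : E m × E m => b p.1) := hb.1.comp contDiff_fst
  refine ⟨hbs.mul ha.smooth, fun k M => ?_⟩
  choose N B hB using hb.2
  choose C hC using ha.bound
  have hB' : ∀ (i : ℕ) (p : E m × E m), ‖iteratedFDeriv ℝ i (fun p : E m × E m => b p.1) p‖ ≤
      |B i| * (1 + ‖p.1‖) ^ N i := fun i p => by
    refine (norm_iteratedFDeriv_comp_clm_le hb.1 (ContinuousLinearMap.fst ℝ (E m) (E m)) i p).trans ?_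
    have h1 : ‖ContinuousLinearMap.fst ℝ (E m) (E m)‖ ^ i ≤ 1 :=
      pow_le_one₀ (norm_nonneg _) (ContinuousLinearMap.norm_fst_le ..)
    calc _ ≤ 1 * (B i * (1 + ‖p.1‖) ^ N i) := by
          gcongr
          exact hB i p.1
      _ ≤ _ := by
          rw [one_mul]
          gcongr
          exact le_abs_self _
  refine ⟨∑ i ∈ Finset.range (k + 1), (k.choose i : ℝ) * |B i| * C (k - i) (M + N i), fun p => ?_⟩
  have h := norm_iteratedFDeriv_mul_le (N := ∞) hbs ha.smooth p (n := k) (mod_cast le_top)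
  calc _ ≤ (1 + ‖p.1‖) ^ M * ∑ i ∈ Finset.range (k + 1), (k.choose i : ℝ) *
          ‖iteratedFDeriv ℝ i (fun p : E m × E m => b p.1) p‖ * ‖iteratedFDeriv ℝ (k - i) a p‖ := by
        gcongr
    _ ≤ (1 + ‖p.1‖) ^ M * ∑ i ∈ Finset.range (k + 1), (k.choose i : ℝ) *
          (|B i| * (1 + ‖p.1‖) ^ N i) * ‖iteratedFDeriv ℝ (k - i) a p‖ := by
        gcongr with i _
        exact hB' i p
    _ = ∑ i ∈ Finset.range (k + 1), (k.choose i : ℝ) * |B i| *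
          ((1 + ‖p.1‖) ^ (M + N i) * ‖iteratedFDeriv ℝ (k - i) a p‖) := by
        rw [Finset.mul_sum]
        refine Finset.sum_congr rfl fun i _ => ?_
        rw [pow_add]; ring
    _ ≤ _ := by
        gcongr with i _
        exact hC _ _ p

theorem IsRapidAmplitude.fderiv_apply {a : E m × E m → ℂ} (ha : IsRapidAmplitude a)
    (v : E m × E m) : IsRapidAmplitude (fun p => fderiv ℝ a p v) := by
  refine ⟨contDiff_fderiv_apply_const ha.smooth v, fun k M => ?_⟩
  obtain ⟨C, hC⟩ := ha.bound (k + 1) M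
  refine ⟨‖ContinuousLinearMap.apply ℝ ℂ v‖ * C, fun p => ?_⟩
  have hs : ContDiff ℝ ∞ (fderiv ℝ a) := ha.smooth.fderiv_right (m := ∞) (by simp)
  have h := (ContinuousLinearMap.apply ℝ ℂ v).norm_iteratedFDeriv_comp_left (n := k)
    (hs.contDiffAt (x := p)) (mod_cast le_top)
  rw [norm_iteratedFDeriv_fderiv] at h
  calc _ ≤ (1 + ‖p.1‖) ^ M * (‖ContinuousLinearMap.apply ℝ ℂ v‖ *
        ‖iteratedFDeriv ℝ (k + 1) a p‖) := by
        gcongr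
        exact h
    _ ≤ _ := by
        rw [mul_left_comm]
        gcongr
        exact hC p

theorem norm_iteratedFDeriv_partial_fst_le {G : E m × E m → ℂ} (hG : ContDiff ℝ ∞ G) (k : ℕ)
    (x ξ : E m) :
    ‖iteratedFDeriv ℝ k (fun x => G (x, ξ)) x‖ ≤ ‖iteratedFDeriv ℝ k G (x, ξ)‖ := by
  have hs : ContDiff ℝ ∞ (fun p : E m × E m => G (p + (0, ξ))) :=
    hG.comp (contDiff_id.add contDiff_const)
  have h := norm_iteratedFDeriv_comp_clm_le hs (ContinuousLinearMap.inl ℝ (E m) (E m)) k x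
  have he : (fun x => G (x, ξ)) =
      fun x => G (ContinuousLinearMap.inl ℝ (E m) (E m) x + (0, ξ)) := by
    ext x; simp
  rw [he]
  refine h.trans ?_
  rw [iteratedFDeriv_comp_add_right]
  have hn : ‖ContinuousLinearMap.inl ℝ (E m) (E m)‖ ≤ 1 :=
    ContinuousLinearMap.opNorm_le_bound _ zero_le_one fun v => by simp [Prod.norm_def]
  simp only [ContinuousLinearMap.inl_apply, Prod.mk_add_mk, zero_add, add_zero]
  exact mul_le_of_le_one_left (norm_nonneg _) (pow_le_one₀ (norm_nonneg _) hn)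

theorem IsRapidAmplitude.exists_slice_bound {a : E m × E m → ℂ} (ha : IsRapidAmplitude a)
    (k M : ℕ) : ∃ C, ∀ x ξ : E m,
      (1 + ‖x‖) ^ M * ‖iteratedFDeriv ℝ k (fun x => a (x, ξ)) x‖ ≤ C := by
  obtain ⟨C, hC⟩ := ha.bound k M
  refine ⟨C, fun x ξ => le_trans ?_ (hC (x, ξ))⟩
  gcongr
  exact norm_iteratedFDeriv_partial_fst_le ha.smooth k x ξ

/-- The partial functions `x ↦ a(x,ξ)`. -/
def IsRapidAmplitude.slice {a : E m × E m → ℂ} (ha : IsRapidAmplitude a) (ξ : E m) :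
    𝓢(E m, ℂ) where
  toFun x := a (x, ξ)
  smooth' := ha.smooth.comp (contDiff_id.prodMk contDiff_const)
  decay' M k := by
    obtain ⟨C, hC⟩ := ha.exists_slice_bound k M
    refine ⟨C, fun x => le_trans ?_ (hC x ξ)⟩
    gcongr
    linarith

/-- The integral `∫ a(x,ξ) e^{-2iπ⟨x,ξ⟩} dx`. -/
def ampInt (a : E m × E m → ℂ) (ξ : E m) : ℂ := ∫ x, a (x, ξ) * phase (-ξ) x

theorem le_one_add_norm_rpow {C b : ℝ} {M : ℕ} {x : E m} (h : (1 + ‖x‖) ^ M * b ≤ C) :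
    b ≤ C * (1 + ‖x‖) ^ (-(M : ℝ)) := by
  rw [Real.rpow_neg (by positivity), Real.rpow_natCast, ← div_eq_mul_inv,
    le_div_iff₀ (by positivity), mul_comm]
  exact h

theorem integrable_one_add_norm_rpow : Integrable fun x : E m => (1 + ‖x‖) ^ (-((m + 1 : ℕ) : ℝ)) :=
  integrable_one_add_norm (by rw [finrank_E]; push_cast; linarith)

theorem IsRapidAmplitude.exists_pow_mul_norm_ampInt_le {a : E m × E m → ℂ}
    (ha : IsRapidAmplitude a) (k : ℕ) : ∃ C, ∀ ξ : E m, ‖ξ‖ ^ k * ‖ampInt a ξ‖ ≤ C := by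
  obtain ⟨C, hC⟩ := ha.exists_slice_bound k (m + 1)
  refine ⟨∫ x : E m, C * (1 + ‖x‖) ^ (-((m + 1 : ℕ) : ℝ)), fun ξ => ?_⟩
  have h1 : ampInt a ξ = 𝓕 (ha.slice ξ : E m → ℂ) ξ := by
    have := integral_mul_phase_eq_fourier (ha.slice ξ : E m → ℂ) (-ξ)
    rw [neg_neg] at this
    exact this
  rw [h1]
  refine (pow_mul_norm_fourier_le (ha.slice ξ) k ξ).trans ?_
  refine integral_mono (by simpa using (ha.slice ξ).integrable_pow_mul_iteratedFDeriv volume 0 k)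
    (integrable_one_add_norm_rpow.const_mul C) fun x => le_one_add_norm_rpow (hC x ξ)

/-- The amplitude of the derivative of `ampInt a` in the direction `v`. -/
def ampDeriv (a : E m × E m → ℂ) (v : E m) : E m × E m → ℂ :=
  fun p => fderiv ℝ a p (0, v) + (-2 * Real.pi * I * ((inner ℝ p.1 v : ℝ) : ℂ)) * a p

theorem IsRapidAmplitude.ampDeriv {a : E m × E m → ℂ} (ha : IsRapidAmplitude a) (v : E m) :
    IsRapidAmplitude (ampDeriv a v) := by
  refine (ha.fderiv_apply (0, v)).add (ha.mul_fst (b := fun x =>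
    -2 * Real.pi * I * ((inner ℝ x v : ℝ) : ℂ)) ?_)
  have h : (fun x : E m => -2 * Real.pi * I * ((inner ℝ x v : ℝ) : ℂ)) =
      ((-2 * Real.pi * I : ℂ) • Complex.ofRealCLM.comp (innerSL ℝ v) : E m →L[ℝ] ℂ) := by
    ext x
    simp [real_inner_comm]
  rw [h]
  exact ContinuousLinearMap.hasTemperateGrowth _

theorem differentiableAt_and_fderiv_ampInt {a : E m × E m → ℂ} (ha : IsRapidAmplitude a) (ξ : E m) :
    DifferentiableAt ℝ (ampInt a) ξ ∧ ∀ v, fderiv ℝ (ampInt a) ξ v = ampInt (ampDeriv a v) ξ := by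
  set c : ℂ := -2 * Real.pi * I with hc
  set ℓ : E m → E m →L[ℝ] ℂ := fun x => c • Complex.ofRealCLM.comp (innerSL ℝ x) with hℓ
  have hph : ∀ x ξ : E m, phase (-ξ) x = exp (ℓ x ξ) := by
    intro x ξ
    simp [phase, hℓ, hc, real_inner_comm]
  set D : E m → E m → E m →L[ℝ] ℂ := fun ξ x =>
    a (x, ξ) • (phase (-ξ) x • ℓ x) +
      phase (-ξ) x • (fderiv ℝ a (x, ξ)).comp (ContinuousLinearMap.inr ℝ (E m) (E m)) with hD
  have hder : ∀ x ξ : E m, HasFDerivAt (fun ξ => a (x, ξ) * phase (-ξ) x) (D ξ x) ξ := by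
    intro x ξ
    have h1 : HasFDerivAt (fun ξ => a (x, ξ))
        ((fderiv ℝ a (x, ξ)).comp (ContinuousLinearMap.inr ℝ (E m) (E m))) ξ :=
      ((ha.smooth.differentiable (by simp)).differentiableAt.hasFDerivAt).comp ξ
        (hasFDerivAt_prodMk_right x ξ)
    have h2 : HasFDerivAt (fun ξ => phase (-ξ) x) (phase (-ξ) x • ℓ x) ξ := by
      simp only [hph]
      exact (ℓ x).hasFDerivAt.cexp
    exact h1.mul h2
  have hℓn : ∀ x, ‖ℓ x‖ ≤ 2 * Real.pi * ‖x‖ := by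
    intro x
    refine ContinuousLinearMap.opNorm_le_bound _ (by positivity) fun y => ?_
    have h1 := abs_real_inner_le_norm x y
    have h2 : ‖ℓ x y‖ = 2 * Real.pi * |inner ℝ x y| := by
      simp [hℓ, hc, abs_of_pos Real.pi_pos]
    rw [h2, mul_assoc (2 * Real.pi)]
    exact mul_le_mul_of_nonneg_left h1 (by positivity)
  have hac : Continuous a := ha.smooth.continuous
  have hfc : Continuous (fderiv ℝ a) := ha.smooth.continuous_fderiv (by simp)
  have hphc : ∀ ξ : E m, Continuous fun x => phase (-ξ) x := fun ξ => continuous_phase (-ξ)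
  have hℓc : Continuous ℓ := by
    have : Continuous fun x : E m => innerSL ℝ x := (innerSL ℝ).continuous
    exact ((ContinuousLinearMap.compL ℝ (E m) ℝ ℂ Complex.ofRealCLM).continuous.comp this).const_smul c
  have hDc : ∀ ξ, Continuous (D ξ) := by
    intro ξ
    have h1 := hphc ξ
    have h2 : Continuous fun x : E m => a (x, ξ) := by fun_prop
    have h3 : Continuous fun x : E m => (fderiv ℝ a (x, ξ)).comp
        (ContinuousLinearMap.inr ℝ (E m) (E m)) :=
      ((ContinuousLinearMap.compL ℝ (E m) (E m × E m) ℂ).flip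
        (ContinuousLinearMap.inr ℝ (E m) (E m))).continuous.comp
        (hfc.comp (continuous_id.prodMk continuous_const))
    exact (h2.smul (h1.smul hℓc)).add (h1.smul h3)
  obtain ⟨C₀, h₀⟩ := ha.bound 0 (m + 2)
  obtain ⟨C₁, h₁⟩ := ha.bound 1 (m + 1)
  have hDb : ∀ x ξ, ‖D ξ x‖ ≤ (C₀ * (2 * Real.pi) + C₁) * (1 + ‖x‖) ^ (-((m + 1 : ℕ) : ℝ)) := by
    intro x ξ
    refine le_one_add_norm_rpow ?_
    have hx0 : 0 ≤ ‖x‖ := norm_nonneg x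
    have h3 := h₀ (x, ξ)
    have h4 := h₁ (x, ξ)
    rw [norm_iteratedFDeriv_zero] at h3
    rw [← norm_iteratedFDeriv_fderiv (n := 0), norm_iteratedFDeriv_zero] at h4
    have hn : ‖ContinuousLinearMap.inr ℝ (E m) (E m)‖ ≤ 1 :=
      ContinuousLinearMap.opNorm_le_bound _ zero_le_one fun v => by simp [Prod.norm_def]
    have h5 : ‖D ξ x‖ ≤ ‖a (x, ξ)‖ * (2 * Real.pi * (1 + ‖x‖)) + ‖fderiv ℝ a (x, ξ)‖ := by
      refine (norm_add_le _ _).trans ?_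
      rw [norm_smul (a (x, ξ)), norm_smul _ (ℓ x), norm_smul (phase (-ξ) x), norm_phase, one_mul,
        one_mul]
      gcongr
      · refine (hℓn x).trans ?_
        gcongr
        linarith
      · refine (ContinuousLinearMap.opNorm_comp_le _ _).trans ?_
        exact mul_le_of_le_one_right (norm_nonneg _) hn
    calc _ ≤ (1 + ‖x‖) ^ (m + 1) *
          (‖a (x, ξ)‖ * (2 * Real.pi * (1 + ‖x‖)) + ‖fderiv ℝ a (x, ξ)‖) := by gcongr
      _ = ((1 + ‖x‖) ^ (m + 2) * ‖a (x, ξ)‖) * (2 * Real.pi) +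
          (1 + ‖x‖) ^ (m + 1) * ‖fderiv ℝ a (x, ξ)‖ := by ring
      _ ≤ _ := by
          gcongr
  have hint : ∀ ξ, Integrable (D ξ) := fun ξ =>
    (integrable_one_add_norm_rpow.const_mul _).mono' (hDc ξ).aestronglyMeasurable
      (Eventually.of_forall fun x => hDb x ξ)
  have hF : ∀ ξ, Integrable (fun x => a (x, ξ) * phase (-ξ) x) := fun ξ =>
    ((ha.slice ξ).integrable.norm).mono' (by
      have h1 := hphc ξ
      exact Continuous.aestronglyMeasurable (by fun_prop)) (Eventually.of_forall fun x => by
      rw [norm_mul, norm_phase, mul_one]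
      rfl)
  have hmain := hasFDerivAt_integral_of_dominated_of_fderiv_le (x₀ := ξ) (s := Set.univ)
    (F := fun ξ x => a (x, ξ) * phase (-ξ) x) (F' := D) univ_mem
    (Eventually.of_forall fun ξ => (hF ξ).aestronglyMeasurable) (hF ξ)
    (hDc ξ).aestronglyMeasurable (Eventually.of_forall fun x ξ _ => hDb x ξ)
    (integrable_one_add_norm_rpow.const_mul _) (Eventually.of_forall fun x ξ _ => hder x ξ)
  refine ⟨hmain.differentiableAt, fun v => ?_⟩
  rw [show fderiv ℝ (ampInt a) ξ = ∫ x, D ξ x from hmain.fderiv,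
    ContinuousLinearMap.integral_apply (hint ξ)]
  refine integral_congr_ae (Eventually.of_forall fun x => ?_)
  simp [hD, hℓ, hc, ampDeriv]
  ring

theorem clm_eq_sum_smulRightL (f : E m →L[ℝ] ℂ) :
    f = ∑ j, ContinuousLinearMap.smulRightL ℝ (E m) ℂ (EuclideanSpace.proj j)
      (f (EuclideanSpace.single j (1 : ℝ))) := by
  ext y
  have hy : y = ∑ j, y j • EuclideanSpace.single j (1 : ℝ) := by
    ext i
    simp [Pi.single_apply]
  conv_lhs => rw [hy]
  simp [sum_apply]

/-- Oscillating integrals with rapidly decaying amplitudes are Schwartz functions. The derivatives in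
`ξ` are integrals of the same kind, and integrations by parts in `x` give the decay. -/
theorem contDiff_and_exists_bound_ampInt (k : ℕ) : ∀ a : E m × E m → ℂ, IsRapidAmplitude a →
    ContDiff ℝ k (ampInt a) ∧
      ∀ N : ℕ, ∃ C, ∀ ξ : E m, ‖ξ‖ ^ N * ‖iteratedFDeriv ℝ k (ampInt a) ξ‖ ≤ C := by
  induction k with
  | zero =>
    intro a ha
    refine ⟨contDiff_zero.mpr (continuous_iff_continuousAt.mpr fun ξ =>
      (differentiableAt_and_fderiv_ampInt ha ξ).1.continuousAt), fun N => ?_⟩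
    simp only [norm_iteratedFDeriv_zero]
    exact ha.exists_pow_mul_norm_ampInt_le N
  | succ k ih =>
    intro a ha
    set e : Fin m → E m := fun j => EuclideanSpace.single j (1 : ℝ) with he
    set L : Fin m → ℂ →L[ℝ] (E m →L[ℝ] ℂ) := fun j =>
      ContinuousLinearMap.smulRightL ℝ (E m) ℂ (EuclideanSpace.proj j) with hL
    have hfd : fderiv ℝ (ampInt a) = fun ξ => ∑ j, L j (ampInt (ampDeriv a (e j)) ξ) := by
      ext1 ξ
      rw [clm_eq_sum_smulRightL (fderiv ℝ (ampInt a) ξ)]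
      exact Finset.sum_congr rfl fun j _ => congrArg _ ((differentiableAt_and_fderiv_ampInt ha ξ).2 _)
    have hsm : ∀ j, ContDiff ℝ k (ampInt (ampDeriv a (e j))) := fun j =>
      (ih _ (ha.ampDeriv (e j))).1
    have hLs : ∀ j ∈ Finset.univ, ContDiff ℝ k (fun ξ => L j (ampInt (ampDeriv a (e j)) ξ)) :=
      fun j _ => (L j).contDiff.comp (hsm j)
    refine ⟨?_, fun N => ?_⟩
    · rw [Nat.cast_succ, contDiff_succ_iff_fderiv]
      refine ⟨fun ξ => (differentiableAt_and_fderiv_ampInt ha ξ).1, by simp, ?_⟩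
      rw [hfd]
      exact ContDiff.sum hLs
    · choose C hC using fun j => (ih _ (ha.ampDeriv (e j))).2 N
      refine ⟨∑ j, ‖L j‖ * C j, fun ξ => ?_⟩
      rw [← norm_iteratedFDeriv_fderiv, hfd, iteratedFDeriv_fun_sum_apply fun j hj =>
        (hLs j hj).contDiffAt]
      refine (mul_le_mul_of_nonneg_left (norm_sum_le _ _) (by positivity)).trans ?_
      rw [Finset.mul_sum]
      refine Finset.sum_le_sum fun j _ => ?_
      have h := (L j).norm_iteratedFDeriv_comp_left (n := k) (hsm j).contDiffAt (x := ξ) le_rfl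
      calc _ ≤ ‖ξ‖ ^ N * (‖L j‖ * ‖iteratedFDeriv ℝ k (ampInt (ampDeriv a (e j))) ξ‖) := by
            gcongr
            exact h
        _ ≤ _ := by
            rw [mul_left_comm]
            gcongr
            exact hC j ξ

end Amplitude

/-! ### Flat functions -/

section FlatFunctions

variable {n : ℕ} {H : E (n + 1) × E (n + 1) → ℂ}

theorem IsFlat.exists_bound {m : ℕ} {v : 𝓢(E m, ℂ)} (hv : IsFlat v) (k j M : ℕ) :
    ∃ C, ∀ x : E m, x ≠ 0 →
      (1 + ‖x‖) ^ M * (‖x‖ + ‖x‖⁻¹) ^ k * ‖iteratedFDeriv ℝ j v x‖ ≤ C := by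
  obtain ⟨c, hc⟩ := hv j k
  obtain ⟨C, hC0, hC⟩ := schwartz_one_add_norm_pow_mul_le v (M + k) j
  refine ⟨max (2 ^ M * 2 ^ k * c) (2 ^ k * C), fun x hx => ?_⟩
  have h0 : 0 < ‖x‖ := norm_pos_iff.mpr hx
  rcases le_total ‖x‖ 1 with h | h
  · refine le_trans ?_ (le_max_left _ _)
    have h1 : ‖x‖ + ‖x‖⁻¹ ≤ 2 * ‖x‖⁻¹ := by
      have := (one_le_inv₀ h0).mpr h
      linarith
    calc _ ≤ (1 + 1) ^ M * (2 * ‖x‖⁻¹) ^ k * (c * ‖x‖ ^ k) := by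
          gcongr
          exact hc x h
      _ = _ := by
          rw [mul_pow, inv_pow]
          field_simp
          norm_num
          ring
  · refine le_trans ?_ (le_max_right _ _)
    have h1 : ‖x‖ + ‖x‖⁻¹ ≤ 2 * (1 + ‖x‖) := by
      have := inv_le_one_of_one_le₀ h
      linarith
    calc _ ≤ (1 + ‖x‖) ^ M * (2 * (1 + ‖x‖)) ^ k * ‖iteratedFDeriv ℝ j v x‖ := by gcongr
      _ = 2 ^ k * ((1 + ‖x‖) ^ (M + k) * ‖iteratedFDeriv ℝ j v x‖) := by
          rw [mul_pow, pow_add]; ring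
      _ ≤ _ := by
          gcongr
          exact hC x

/-- The derivatives of `H` are singular at most like a power of `|x|` at `x = 0`, which the flatness
of `v` compensates. -/
theorem isRapidAmplitude_mul_flat (hH : IsInvariantSymbol H) {v : 𝓢(E (n + 1), ℂ)}
    (hv : IsFlat v) : IsRapidAmplitude (fun p => H p * v p.1) := by
  have hvs : ContDiff ℝ ∞ (fun p : E (n + 1) × E (n + 1) => v p.1) :=
    (v.smooth ⊤).comp contDiff_fst
  have hs : ContDiff ℝ ∞ (fun p => H p * v p.1) := hH.smooth.mul hvs
  refine ⟨hs, fun k M => ?_⟩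
  choose B hB0 hB using hH.exists_joint_bound
  choose C hC using fun i j => hv.exists_bound i j M
  have hv' : ∀ (i : ℕ) (p : E (n + 1) × E (n + 1)),
      ‖iteratedFDeriv ℝ i (fun p : E (n + 1) × E (n + 1) => v p.1) p‖ ≤
        ‖iteratedFDeriv ℝ i v p.1‖ := fun i p => by
    refine (norm_iteratedFDeriv_comp_clm_le (v.smooth ⊤)
      (ContinuousLinearMap.fst ℝ (E (n + 1)) (E (n + 1))) i p).trans ?_
    exact mul_le_of_le_one_left (norm_nonneg _)
      (pow_le_one₀ (norm_nonneg _) (ContinuousLinearMap.norm_fst_le ..))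
  have hmain : ∀ p : E (n + 1) × E (n + 1), p.1 ≠ 0 →
      (1 + ‖p.1‖) ^ M * ‖iteratedFDeriv ℝ k (fun p => H p * v p.1) p‖ ≤
      ∑ i ∈ Finset.range (k + 1), (k.choose i : ℝ) * B i * C i (k - i) := by
    intro p hp
    have h := norm_iteratedFDeriv_mul_le (N := ∞) hH.smooth hvs p (n := k) (mod_cast le_top)
    calc _ ≤ (1 + ‖p.1‖) ^ M * ∑ i ∈ Finset.range (k + 1), (k.choose i : ℝ) *
            ‖iteratedFDeriv ℝ i H p‖ *
            ‖iteratedFDeriv ℝ (k - i) (fun p : E (n + 1) × E (n + 1) => v p.1) p‖ := by gcongr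
      _ ≤ (1 + ‖p.1‖) ^ M * ∑ i ∈ Finset.range (k + 1), (k.choose i : ℝ) *
            ((‖p.1‖ + ‖p.1‖⁻¹) ^ i * B i) * ‖iteratedFDeriv ℝ (k - i) v p.1‖ := by
          gcongr with i _
          · have := hB0 i
            positivity
          · exact hB i p hp
          · exact hv' _ p
      _ = ∑ i ∈ Finset.range (k + 1), (k.choose i : ℝ) * B i *
            ((1 + ‖p.1‖) ^ M * (‖p.1‖ + ‖p.1‖⁻¹) ^ i * ‖iteratedFDeriv ℝ (k - i) v p.1‖) := by
          rw [Finset.mul_sum]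
          exact Finset.sum_congr rfl fun i _ => by ring
      _ ≤ _ := by
          gcongr with i _
          · have := hB0 i
            positivity
          · exact hC _ _ _ hp
  refine ⟨∑ i ∈ Finset.range (k + 1), (k.choose i : ℝ) * B i * C i (k - i), fun p => ?_⟩
  -- the bound extends to `x = 0` by continuity
  have hclosed : IsClosed {p : E (n + 1) × E (n + 1) |
      (1 + ‖p.1‖) ^ M * ‖iteratedFDeriv ℝ k (fun p => H p * v p.1) p‖ ≤
      ∑ i ∈ Finset.range (k + 1), (k.choose i : ℝ) * B i * C i (k - i)} := by
    have hc := (hs.continuous_iteratedFDeriv (m := k) (mod_cast le_top)).norm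
    exact isClosed_le (((continuous_const.add continuous_fst.norm).pow M).mul hc) continuous_const
  have hdense : Dense {p : E (n + 1) × E (n + 1) | p.1 ≠ 0} := by
    have h1 : Dense ({0}ᶜ : Set (E (n + 1))) := dense_compl_singleton 0
    exact h1.preimage isOpenMap_fst
  exact (hclosed.closure_subset_iff.mpr fun p hp => hmain p hp) (hdense p)

/-- For flat `v`, the function `𝓕 (Op₁(H) v)` is a Schwartz function. -/
theorem exists_schwartz_fourierOp1 (hH : IsInvariantSymbol H) {v : 𝓢(E (n + 1), ℂ)}
    (hv : IsFlat v) : ∃ g : 𝓢(E (n + 1), ℂ), (g : E (n + 1) → ℂ) = fourierOp1 H v := by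
  have ha := isRapidAmplitude_mul_flat hH hv
  have he : fourierOp1 H v = ampInt (fun p => H p * v p.1) := by
    ext ξ
    refine integral_congr_ae (Eventually.of_forall fun x => ?_)
    simp [phase, real_inner_comm]
    ring
  refine ⟨⟨ampInt (fun p => H p * v p.1), ?_, fun N k => ?_⟩, he.symm⟩
  · exact contDiff_infty.mpr fun k => (contDiff_and_exists_bound_ampInt k _ ha).1
  · exact (contDiff_and_exists_bound_ampInt k _ ha).2 N

/-- Every homogeneous component of a Schwartz function is one of a flat Schwartz function: multiply it
by a cutoff function of `|x|`, supported in an annulus. -/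
theorem exists_flat_homPart_eq (lam : ℝ) (ε : Fin 2) (v : 𝓢(E (n + 1), ℂ)) :
    ∃ v' : 𝓢(E (n + 1), ℂ), IsFlat v' ∧
      ∀ x : E (n + 1), x ≠ 0 → homPart lam ε v' x = homPart lam ε v x := by
  let f : ContDiffBump (1 : ℝ) := ⟨1 / 4, 1 / 2, by norm_num, by norm_num⟩
  have hf0 : ∀ t : ℝ, f t ≠ 0 → 1 / 2 < t ∧ t < 3 / 2 := fun t ht => by
    have h1 : t ∈ Metric.ball (1 : ℝ) (1 / 2) := f.support_eq ▸ ht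
    rw [Metric.mem_ball, Real.dist_eq, abs_lt] at h1
    constructor <;> linarith
  -- the factor `|t|` makes up for the homogeneity of degree `-1` of the integrand in the radial
  -- direction
  set κ : ℝ → ℝ := fun t => |t| * f (t ^ 2) with hκ
  have hκc : Continuous κ := by
    have := f.continuous
    fun_prop
  have hκs : HasCompactSupport κ := by
    refine HasCompactSupport.intro (isCompact_closedBall (0 : ℝ) 2) fun t ht => ?_
    by_contra h
    have h1 := (hf0 _ (right_ne_zero_of_mul h)).2
    rw [Metric.mem_closedBall, dist_zero_right, Real.norm_eq_abs, not_le] at ht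
    nlinarith [sq_abs t]
  set c : ℝ := ∫ t, κ t with hc
  have hc0 : 0 < c := hκc.integral_pos_of_hasCompactSupport_nonneg_nonzero hκs
    (fun t => mul_nonneg (abs_nonneg t) f.nonneg) (x := 1) (by
      have : f 1 = 1 := f.one_of_mem_closedBall (by simp [f.rIn_pos.le])
      simp [hκ, this])
  set q : E (n + 1) → ℝ := fun y => ‖y‖ ^ 2 * f (‖y‖ ^ 2) with hq
  have hqs : ContDiff ℝ ∞ q := by
    have h1 : ContDiff ℝ ∞ fun y : E (n + 1) => ‖y‖ ^ 2 := contDiff_norm_sq ℝ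
    exact h1.mul (f.contDiff.comp h1)
  set V : E (n + 1) → ℂ := fun y => (4 * Real.pi / c : ℝ) * ((q y : ℝ) : ℂ) * homPart lam ε v y
    with hV
  have hV0 : ∀ y : E (n + 1), ‖y‖ < 1 / 2 → V y = 0 := fun y hy => by
    have h1 : f (‖y‖ ^ 2) = 0 := by
      by_contra h
      have := (hf0 _ h).1
      nlinarith [norm_nonneg y]
    simp [hV, hq, h1]
  have hVs : ContDiff ℝ ∞ V := by
    refine contDiff_iff_contDiffAt.mpr fun y => ?_
    rcases lt_or_ge ‖y‖ (1 / 2) with h | h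
    · have he : V =ᶠ[𝓝 y] fun _ => 0 := by
        filter_upwards [(isOpen_lt continuous_norm continuous_const).mem_nhds h] with z hz
        exact hV0 z hz
      exact contDiffAt_const.congr_of_eventuallyEq he
    · have hy : y ∈ ({0}ᶜ : Set (E (n + 1))) := by
        rintro rfl
        norm_num at h
      have h1 := (contDiffOn_homPart lam ε v).contDiffAt (isOpen_compl_singleton.mem_nhds hy)
      exact (contDiffAt_const.mul
        (Complex.ofRealCLM.contDiff.comp hqs).contDiffAt).mul h1
  have hVc : HasCompactSupport V := by
    refine HasCompactSupport.intro (isCompact_closedBall (0 : E (n + 1)) 2) fun y hy => ?_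
    have h1 : f (‖y‖ ^ 2) = 0 := by
      by_contra h
      have h1 := (hf0 _ h).2
      rw [Metric.mem_closedBall, dist_zero_right, not_le] at hy
      nlinarith
    simp [hV, hq, h1]
  set v' : 𝓢(E (n + 1), ℂ) := hVc.toSchwartzMap hVs with hv'
  have hv'V : ∀ y, v' y = V y := fun _ => rfl
  refine ⟨v', fun k N => ?_, fun x hx => ?_⟩
  · obtain ⟨C, hC⟩ := exists_norm_iteratedFDeriv_le_of_eq_zero v' (ρ := 1 / 2) (by norm_num)
      (fun y hy => hV0 y hy) k N
    exact ⟨C, fun x _ => hC x⟩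
  · have hx0 : 0 < ‖x‖ := norm_pos_iff.mpr hx
    have h1 : ∀ᵐ t : ℝ, absPow ε (homExp n lam) t * v' (t • x) =
        ((4 * Real.pi / c : ℝ) : ℂ) * homPart lam ε v x * ((‖x‖ * κ (t * ‖x‖) : ℝ) : ℂ) := by
      filter_upwards [ae_ne_zero_real] with t ht
      have ht0 : ((|t| : ℝ) : ℂ) ≠ 0 := by simpa using ht
      have h2 : absPow ε (homExp n lam) t * absPow ε (-((n : ℂ) + 1) / 2 - I * lam) t =
          ((|t| : ℝ) : ℂ)⁻¹ := by
        rw [absPow_sign_mul_self _ _ _ ht, show homExp n lam + (-((n : ℂ) + 1) / 2 - I * lam) = -1 by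
          rw [homExp]; ring, Complex.cpow_neg_one]
      have h3 : q (t • x) = |t| * (‖x‖ * κ (t * ‖x‖)) := by
        simp only [hq, hκ, norm_smul, Real.norm_eq_abs, mul_pow, sq_abs, abs_mul, abs_norm]
        rw [← sq_abs t]; ring
      rw [hv'V, hV]
      simp only [homPart_smul lam ε v ht, h3]
      push_cast
      rw [show ∀ A B P k1 h : ℂ, A * (B * ((|t| : ℝ) * k1) * (P * h)) =
        B * h * k1 * ((A * P) * (|t| : ℝ)) by intros; ring, h2, inv_mul_cancel₀ ht0]
      ring
    have h4 : ∫ t : ℝ, ((‖x‖ * κ (t * ‖x‖) : ℝ) : ℂ) = c := by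
      rw [integral_complex_ofReal, integral_const_mul]
      rw [Measure.integral_comp_mul_right κ ‖x‖, smul_eq_mul, abs_inv, abs_norm, ← mul_assoc,
        mul_inv_cancel₀ hx0.ne', one_mul]
    rw [homPart_eq, integral_congr_ae h1, integral_const_mul, h4]
    have hc' : (c : ℂ) ≠ 0 := by exact_mod_cast hc0.ne'
    have hpi : (Real.pi : ℂ) ≠ 0 := by exact_mod_cast Real.pi_ne_zero
    push_cast
    field_simp

end FlatFunctions

/-! ### Values of oscillatory integrals -/

section OscillatoryValue

variable {V : Type*} [NormedAddCommGroup V] [InnerProductSpace ℝ V] [FiniteDimensional ℝ V]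
  [MeasurableSpace V] [BorelSpace V]

open Classical in
/-- The value of an oscillatory integral; `0` if it does not exist. -/
def oscValue (F : V → ℂ) : ℂ := if h : ∃ J, HasOscIntegral F J then h.choose else 0

theorem hasOscIntegral_oscValue {F : V → ℂ} (h : ∃ J, HasOscIntegral F J) :
    HasOscIntegral F (oscValue F) := by
  rw [oscValue, dif_pos h]
  exact h.choose_spec

end OscillatoryValue

/-! ### The symbols `f` and `h` -/

section Symbols

variable {n : ℕ} {H : E (n + 1) × E (n + 1) → ℂ}

theorem fIntegrand_eq_radialIntegrand (lam : ℝ) (ε : Fin 2) (H : E (n + 1) × E (n + 1) → ℂ)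
    (x ξ : E (n + 1)) :
    fIntegrand lam ε H x ξ = radialIntegrand 1 ε (homExp n lam) H x ξ := by
  ext t
  simp [fIntegrand, radialIntegrand, phase, homExp]

theorem hIntegrand_eq_radialIntegrand (lam : ℝ) (ε : Fin 2) (H : E (n + 1) × E (n + 1) → ℂ)
    (x ξ : E (n + 1)) :
    hIntegrand lam ε H x ξ = radialIntegrand (-1) ε (homExp n (-lam)) (swapSymbol H) ξ x := by
  ext t
  simp [hIntegrand, radialIntegrand, phase, homExp, swapSymbol, sub_eq_add_neg]

theorem swapSymbol_truncSymbol {m : ℕ} (χ : 𝓢(ℝ, ℂ)) (δ : ℝ) (H : E m × E m → ℂ) :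
    swapSymbol (truncSymbol χ δ H) = truncSymbol χ δ (swapSymbol H) := by
  ext p
  simp only [swapSymbol, truncSymbol, mul_comm (‖p.2‖ ^ 2)]

theorem ne_zero_of_inner_eq_one {m : ℕ} {x ξ : E m} (h : inner ℝ x ξ = (1 : ℝ)) :
    x ≠ 0 ∧ ξ ≠ 0 := by
  constructor <;> rintro rfl <;> simp at h

/-- The symbol `f` of the standard calculus. -/
def stdSymbol (lam : ℝ) (ε : Fin 2) (H : E (n + 1) × E (n + 1) → ℂ) (x ξ : E (n + 1)) : ℂ :=
  (-1) ^ (ε : ℕ) * (intertwiningConst n (-lam) ε)⁻¹ * oscValue (fIntegrand lam ε H x ξ)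

/-- The symbol `h` of the antistandard calculus. -/
def antiSymbol (lam : ℝ) (ε : Fin 2) (H : E (n + 1) × E (n + 1) → ℂ) (x ξ : E (n + 1)) : ℂ :=
  (intertwiningConst n lam ε)⁻¹ * oscValue (hIntegrand lam ε H x ξ)

theorem hasOscIntegral_fIntegrand (hH : IsInvariantSymbol H) (lam : ℝ) (ε : Fin 2)
    {x : E (n + 1)} (hx : x ≠ 0) (ξ : E (n + 1)) :
    HasOscIntegral (radialIntegrand 1 ε (homExp n lam) H x ξ) (oscValue (fIntegrand lam ε H x ξ)) := by
  rw [fIntegrand_eq_radialIntegrand]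
  exact hasOscIntegral_oscValue (hH.exists_hasOscIntegral_radial one_ne_zero ε
    (neg_one_lt_homExp_re n lam) hx ξ)

theorem hasOscIntegral_hIntegrand (hH : IsInvariantSymbol H) (lam : ℝ) (ε : Fin 2)
    (x : E (n + 1)) {ξ : E (n + 1)} (hξ : ξ ≠ 0) :
    HasOscIntegral (radialIntegrand (-1) ε (homExp n (-lam)) (swapSymbol H) ξ x)
      (oscValue (hIntegrand lam ε H x ξ)) := by
  rw [hIntegrand_eq_radialIntegrand]
  exact hasOscIntegral_oscValue (hH.swap.exists_hasOscIntegral_radial (by norm_num) ε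
    (neg_one_lt_homExp_re n (-lam)) hξ x)

theorem isStdSymbol_stdSymbol (hH : IsInvariantSymbol H) (lam : ℝ) (ε : Fin 2) :
    IsStdSymbol lam ε H (stdSymbol lam ε H) := by
  intro x ξ h
  refine ⟨fun t ht => ?_, oscValue (fIntegrand lam ε H x ξ), ?_, rfl⟩
  · simp only [stdSymbol, fIntegrand_eq_radialIntegrand,
      radialIntegrand_smul_inv_smul x ξ (hH.invariant t ht)]
  · have := hasOscIntegral_fIntegrand hH lam ε (ne_zero_of_inner_eq_one h).1 ξ
    rwa [← fIntegrand_eq_radialIntegrand] at this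

theorem hIntegrand_smul_inv_smul {t : ℝ}
    (hH : ∀ x ξ : E (n + 1), H (t • x, t⁻¹ • ξ) = H (x, ξ)) (lam : ℝ) (ε : Fin 2)
    (x ξ : E (n + 1)) : hIntegrand lam ε H (t • x) (t⁻¹ • ξ) = hIntegrand lam ε H x ξ := by
  ext r
  rw [hIntegrand, smul_comm r, hH, hIntegrand]

theorem isAntiSymbol_antiSymbol (hH : IsInvariantSymbol H) (lam : ℝ) (ε : Fin 2) :
    IsAntiSymbol lam ε H (antiSymbol lam ε H) := by
  intro x ξ h
  refine ⟨fun t ht => ?_, oscValue (hIntegrand lam ε H x ξ), ?_, rfl⟩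
  · simp only [antiSymbol, hIntegrand_smul_inv_smul (hH.invariant t ht)]
  · have := hasOscIntegral_hIntegrand hH lam ε x (ne_zero_of_inner_eq_one h).2
    rwa [← hIntegrand_eq_radialIntegrand] at this

end Symbols

/-! ### The standard calculus -/

section StandardCalculus

variable {n : ℕ} {H : E (n + 1) × E (n + 1) → ℂ}

theorem op0_eq_stdOp_schwartz {m : ℕ} (H : E m × E m → ℂ) (v : 𝓢(E m, ℂ)) :
    op0 H v = stdOp 1 H (𝓕 v : 𝓢(E m, ℂ)) := by
  rw [op0_eq_stdOp, SchwartzMap.fourier_coe]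

theorem integrable_homIntegrand_op0 (hH : IsInvariantSymbol H) (v : 𝓢(E (n + 1), ℂ)) (lam : ℝ)
    (ε : Fin 2) {x : E (n + 1)} (hx : x ≠ 0) : Integrable (homIntegrand lam ε (op0 H v) x) := by
  rw [op0_eq_stdOp_schwartz]
  exact (integrable_and_hasOscIntegral_stdOp hH one_ne_zero _ lam ε hx).1

theorem hasOscIntegral_homPart_op0 (hH : IsInvariantSymbol H) (v : 𝓢(E (n + 1), ℂ)) (lam : ℝ)
    (ε : Fin 2) {x : E (n + 1)} (hx : x ≠ 0) :
    HasOscIntegral (fun ξ => H (x, ξ) * exp (2 * Real.pi * I * (inner ℝ x ξ : ℝ)) *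
      homPart (-lam) ε (𝓕 (v : E (n + 1) → ℂ)) ξ) (homPart lam ε (op0 H v) x) := by
  have h := (integrable_and_hasOscIntegral_stdOp hH one_ne_zero (𝓕 v) lam ε hx).2
  rw [← op0_eq_stdOp_schwartz] at h
  simpa only [one_smul, phase, SchwartzMap.fourier_coe] using h

/-- `(Op₀(H) v)_{iλ,ε} = Op₀(H) v_{iλ,ε}`. -/
theorem isOp0_homPart (hH : IsInvariantSymbol H) (v : 𝓢(E (n + 1), ℂ)) (lam : ℝ) (ε : Fin 2) :
    IsOp0 H (homPart lam ε v) (homPart lam ε (op0 H v)) :=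
  ⟨_, isFourierTransform_homPart lam ε v, fun _ hx => hasOscIntegral_homPart_op0 hH v lam ε hx⟩

/-- The component `(Op₀(H) v)^♭` depends only on `v^♭`. -/
theorem flatPart_op0_congr (hH : IsInvariantSymbol H) {lam : ℝ} {ε : Fin 2}
    {v v' : 𝓢(E (n + 1), ℂ)}
    (h : flatPart lam ε (v : E (n + 1) → ℂ) = flatPart lam ε v') :
    flatPart lam ε (op0 H v) = flatPart lam ε (op0 H v') := by
  ext s
  refine (hasOscIntegral_homPart_op0 hH v lam ε (emb_ne_zero s)).unique ?_
  refine (hasOscIntegral_homPart_op0 hH v' lam ε (emb_ne_zero s)).congr_ae ?_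
  filter_upwards [ae_ne_zero_E] with ξ hξ
  rw [homPart_fourier_congr (ae_homPart_eq_of_flatPart_eq h) hξ]

theorem neg_one_pow_mul_self (k : ℕ) : ((-1 : ℂ) ^ k) * (-1) ^ k = 1 := by
  rw [← mul_pow]; norm_num

/-- The induced operator is the standard calculus on projective space, with symbol `f`. -/
theorem isOpStd_flatPart (hH : IsInvariantSymbol H) {lam : ℝ} {ε : Fin 2}
    (hC : intertwiningConst n (-lam) ε ≠ 0) (v : 𝓢(E (n + 1), ℂ)) :
    IsOpStd lam ε H (stdSymbol lam ε H) (flatPart lam ε (v : E (n + 1) → ℂ))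
      (flatPart lam ε (op0 H v)) := by
  set c : ℂ := (-1) ^ (ε : ℕ) * (intertwiningConst n (-lam) ε)⁻¹ with hc
  have hcc : (-1) ^ (ε : ℕ) * intertwiningConst n (-lam) ε * c = 1 := by
    rw [hc, mul_mul_mul_comm, neg_one_pow_mul_self, mul_inv_cancel₀ hC, one_mul]
  have hθ : ∀ σ, theta lam ε (flatPart lam ε (v : E (n + 1) → ℂ)) σ =
      homPart (-lam) ε (𝓕 v : 𝓢(E (n + 1), ℂ)) (emb σ) := fun σ => by
    rw [theta_flatPart, SchwartzMap.fourier_coe, flatPart]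
  have hval : ∀ s, flatPart lam ε (op0 H v) s =
      homPart lam ε (stdOp 1 H (𝓕 v : 𝓢(E (n + 1), ℂ))) (emb s) := fun s => by
    rw [op0_eq_stdOp_schwartz, flatPart]
  refine ⟨fun χ hχ x ξ h => ?_, fun χ hχ s => ?_, fun s => ?_⟩
  · obtain ⟨hx, hξ⟩ := ne_zero_of_inner_eq_one h
    obtain ⟨h1, h2⟩ := integrable_and_tendsto_radial_truncSymbol hx hξ
      (hasOscIntegral_fIntegrand hH lam ε hx ξ) hχ
    simp only [fTrunc, fIntegrand_eq_radialIntegrand lam ε (truncSymbol _ _ _)]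
    exact ⟨h1, h2.const_mul _⟩
  · obtain ⟨h1, h2⟩ := integrable_and_tendsto_projective hH one_ne_zero (𝓕 v) lam ε hχ s
    have he : ∀ δ σ, opStdIntegrand lam ε (fTrunc lam ε χ H δ)
        (flatPart lam ε (v : E (n + 1) → ℂ)) s σ =
        c * ((∫ t, radialIntegrand 1 ε (homExp n lam) (truncSymbol χ δ H) (emb s)
          ((1 + inner ℝ s σ : ℝ)⁻¹ • emb σ) t) *
          absPow ε (-((n : ℂ) + 1) / 2 - I * lam) (1 + inner ℝ s σ) *
          homPart (-lam) ε (𝓕 v : 𝓢(E (n + 1), ℂ)) (emb σ)) := by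
      intro δ σ
      rw [opStdIntegrand, inCoord, fTrunc, hθ, fIntegrand_eq_radialIntegrand]
      ring
    refine ⟨fun δ hδ => ?_, ?_⟩
    · exact ((h1 δ hδ).const_mul c).congr (Eventually.of_forall fun σ => (he δ σ).symm)
    · rw [hval]
      refine h2.congr fun δ => ?_
      simp only [opStd, he]
      rw [integral_const_mul, ← mul_assoc, hcc, one_mul]
  · rintro ⟨b, hb, hu⟩
    obtain ⟨h1, h2⟩ := integrable_and_integral_projective hH one_ne_zero (𝓕 v) lam ε s
      (fun ξ _ => hasOscIntegral_fIntegrand hH lam ε (emb_ne_zero s) ξ) hb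
      (fun σ hσ => (hθ σ).symm.trans (hu σ hσ))
    have he : ∀ σ, opStdIntegrand lam ε (stdSymbol lam ε H)
        (flatPart lam ε (v : E (n + 1) → ℂ)) s σ =
        c * (oscValue (fIntegrand lam ε H (emb s) ((1 + inner ℝ s σ : ℝ)⁻¹ • emb σ)) *
          absPow ε (-((n : ℂ) + 1) / 2 - I * lam) (1 + inner ℝ s σ) *
          homPart (-lam) ε (𝓕 v : 𝓢(E (n + 1), ℂ)) (emb σ)) := by
      intro σ
      rw [opStdIntegrand, inCoord, stdSymbol, hθ]
      ring
    refine ⟨(h1.const_mul c).congr (Eventually.of_forall fun σ => (he σ).symm), ?_⟩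
    simp only [opStd, he]
    rw [integral_const_mul, ← mul_assoc, hcc, one_mul, h2, hval]

end StandardCalculus

/-! ### The antistandard calculus -/

section AntistandardCalculus

variable {n : ℕ} {H : E (n + 1) × E (n + 1) → ℂ}

/-- For flat `v`, `Op₁(H) v` is a Schwartz function. -/
theorem exists_schwartz_op1 (hH : IsInvariantSymbol H) {v : 𝓢(E (n + 1), ℂ)} (hv : IsFlat v) :
    ∃ w : 𝓢(E (n + 1), ℂ), (w : E (n + 1) → ℂ) = op1 H v ∧
      𝓕 (w : E (n + 1) → ℂ) = fourierOp1 H v := by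
  obtain ⟨g, hg⟩ := exists_schwartz_fourierOp1 hH hv
  refine ⟨𝓕⁻ g, ?_, ?_⟩
  · rw [SchwartzMap.fourierInv_coe, hg, op1]
  · rw [← SchwartzMap.fourier_coe, FourierTransform.fourier_fourierInv_eq, hg]

theorem hasOscIntegral_homPart_fourierOp1 (hH : IsInvariantSymbol H) (v : 𝓢(E (n + 1), ℂ))
    (lam : ℝ) (ε : Fin 2) {ξ : E (n + 1)} (hξ : ξ ≠ 0) :
    HasOscIntegral (fun x => H (x, ξ) * exp (-2 * Real.pi * I * (inner ℝ x ξ : ℝ)) *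
      homPart lam ε v x) (homPart (-lam) ε (fourierOp1 H v) ξ) := by
  have h := (integrable_and_hasOscIntegral_stdOp hH.swap (κ := -1) (by norm_num) v (-lam) ε hξ).2
  rw [← fourierOp1_eq_stdOp, neg_neg] at h
  refine h.congr_ae (Eventually.of_forall fun x => ?_)
  simp [swapSymbol, phase, real_inner_comm]

/-- `(Op₁(H) v)_{iλ,ε} = Op₁(H) v_{iλ,ε}`. -/
theorem isOp1_homPart (hH : IsInvariantSymbol H) {v : 𝓢(E (n + 1), ℂ)} (hv : IsFlat v) (lam : ℝ)
    (ε : Fin 2) : IsOp1 H (homPart lam ε v) (homPart lam ε (op1 H v)) := by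
  obtain ⟨w, hw, hwf⟩ := exists_schwartz_op1 hH hv
  have h := isFourierTransform_homPart lam ε w
  rw [hw] at hwf h
  rw [hwf] at h
  exact ⟨_, h, fun ξ hξ => hasOscIntegral_homPart_fourierOp1 hH v lam ε hξ⟩

/-- The component `(Op₁(H) v)^♭`, `v` flat, depends only on `v^♭`. -/
theorem flatPart_op1_congr (hH : IsInvariantSymbol H) {lam : ℝ} {ε : Fin 2}
    {v v' : 𝓢(E (n + 1), ℂ)} (hv : IsFlat v) (hv' : IsFlat v')
    (h : flatPart lam ε (v : E (n + 1) → ℂ) = flatPart lam ε v') :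
    flatPart lam ε (op1 H v) = flatPart lam ε (op1 H v') := by
  obtain ⟨w, hw, hwf⟩ := exists_schwartz_op1 hH hv
  obtain ⟨w', hw', hwf'⟩ := exists_schwartz_op1 hH hv'
  ext s
  rw [← hw, ← hw']
  refine homPart_congr_of_fourier ?_ (emb_ne_zero s)
  filter_upwards [ae_ne_zero_E] with ξ hξ
  rw [hwf, hwf']
  refine (hasOscIntegral_homPart_fourierOp1 hH v lam ε hξ).unique ?_
  refine (hasOscIntegral_homPart_fourierOp1 hH v' lam ε hξ).congr_ae ?_
  filter_upwards [ae_ne_zero_E] with x hx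
  rw [homPart_eq_of_flatPart_eq h hx]

theorem exists_flat_of_mem_flatClass {lam : ℝ} {ε : Fin 2} {u : E n → ℂ}
    (hu : u ∈ flatClass n lam ε) :
    ∃ v : 𝓢(E (n + 1), ℂ), IsFlat v ∧ flatPart lam ε (v : E (n + 1) → ℂ) = u := by
  obtain ⟨v, rfl⟩ := hu
  obtain ⟨v', hv', h⟩ := exists_flat_homPart_eq lam ε v
  exact ⟨v', hv', funext fun s => h _ (emb_ne_zero s)⟩

/-- In the coordinates `(s,σ)`, the integrand of `h` is a radial integrand at the point `(σ,1)`. -/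
theorem hIntegrand_coord (H : E (n + 1) × E (n + 1) → ℂ)
    (hH : ∀ t : ℝ, t ≠ 0 → ∀ x ξ : E (n + 1), H (t • x, t⁻¹ • ξ) = H (x, ξ)) (lam : ℝ) (ε : Fin 2)
    {s σ : E n} (hp : (1 + inner ℝ σ s : ℝ) ≠ 0) :
    hIntegrand lam ε H (emb s) ((1 + inner ℝ s σ : ℝ)⁻¹ • emb σ) =
      hIntegrand lam ε H ((1 + inner ℝ σ s : ℝ)⁻¹ • emb s) (emb σ) := by
  have h := hIntegrand_smul_inv_smul (hH _ hp) lam ε ((1 + inner ℝ σ s : ℝ)⁻¹ • emb s) (emb σ)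
  rw [smul_inv_smul₀ hp] at h
  rw [real_inner_comm σ s]
  exact h

/-- The induced operator is the antistandard calculus on projective space, with symbol `h`. The
estimates are those of the standard calculus, with the two variables exchanged and `λ` replaced by
`-λ`. -/
theorem isOpAnti_flatPart (hH : IsInvariantSymbol H) {lam : ℝ} {ε : Fin 2}
    (hC : intertwiningConst n lam ε ≠ 0) {v : 𝓢(E (n + 1), ℂ)} (hv : IsFlat v) :
    IsOpAnti lam ε H (antiSymbol lam ε H) (flatPart lam ε (v : E (n + 1) → ℂ))
      (flatPart lam ε (op1 H v)) := by
  obtain ⟨w, hw, hwf⟩ := exists_schwartz_op1 hH hv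
  set c : ℂ := (intertwiningConst n lam ε)⁻¹ with hc
  have hcc : intertwiningConst n lam ε * c = 1 := mul_inv_cancel₀ hC
  have hval : ∀ σ, theta lam ε (flatPart lam ε (op1 H v)) σ =
      homPart (-lam) ε (stdOp (-1) (swapSymbol H) v) (emb σ) := fun σ => by
    rw [← hw, theta_flatPart, hwf, fourierOp1_eq_stdOp, flatPart]
  refine ⟨⟨w, by rw [← hw]⟩, fun χ hχ x ξ h => ?_, fun χ hχ σ => ?_, fun σ => ?_⟩
  · obtain ⟨hx, hξ⟩ := ne_zero_of_inner_eq_one h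
    obtain ⟨h1, h2⟩ := integrable_and_tendsto_radial_truncSymbol hξ hx
      (hasOscIntegral_hIntegrand hH lam ε x hξ) hχ
    simp only [hTrunc, hIntegrand_eq_radialIntegrand lam ε (truncSymbol _ _ _),
      swapSymbol_truncSymbol]
    exact ⟨h1, h2.const_mul _⟩
  · obtain ⟨h1, h2⟩ := integrable_and_tendsto_projective hH.swap (κ := -1) (by norm_num) v (-lam) ε
      hχ σ
    have he : ∀ δ, opAntiIntegrand lam ε (hTrunc lam ε χ H δ)
        (flatPart lam ε (v : E (n + 1) → ℂ)) σ =ᵐ[volume] fun s =>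
        c * ((∫ t, radialIntegrand (-1) ε (homExp n (-lam)) (truncSymbol χ δ (swapSymbol H)) (emb σ)
          ((1 + inner ℝ σ s : ℝ)⁻¹ • emb s) t) *
          absPow ε (-((n : ℂ) + 1) / 2 - I * ((-lam : ℝ) : ℂ)) (1 + inner ℝ σ s) *
          homPart (-(-lam)) ε v (emb s)) := by
      intro δ
      filter_upwards [ae_one_add_inner_ne_zero σ] with s hp
      rw [opAntiIntegrand, inCoord, hTrunc, hIntegrand_coord _
        (fun t ht => truncSymbol_invariant hH χ δ ht) lam ε hp, hIntegrand_eq_radialIntegrand,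
        swapSymbol_truncSymbol, flatPart, real_inner_comm σ s, neg_neg]
      push_cast
      rw [mul_neg, sub_neg_eq_add]
      ring
    refine ⟨fun δ hδ => ?_, ?_⟩
    · exact ((h1 δ hδ).const_mul c).congr (he δ).symm
    · rw [hval]
      refine h2.congr fun δ => ?_
      rw [thetaOpAnti, integral_congr_ae (he δ), integral_const_mul, ← mul_assoc, hcc, one_mul]
  · rintro ⟨b, hb, hu⟩
    obtain ⟨h1, h2⟩ := integrable_and_integral_projective hH.swap (κ := -1) (by norm_num) v (-lam) ε
      σ (fun x _ => hasOscIntegral_hIntegrand hH lam ε x (emb_ne_zero σ)) hb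
      (fun s hs => by
        rw [neg_neg]
        exact hu s (by rwa [real_inner_comm]))
    have he : opAntiIntegrand lam ε (antiSymbol lam ε H)
        (flatPart lam ε (v : E (n + 1) → ℂ)) σ =ᵐ[volume] fun s =>
        c * (oscValue (hIntegrand lam ε H ((1 + inner ℝ σ s : ℝ)⁻¹ • emb s) (emb σ)) *
          absPow ε (-((n : ℂ) + 1) / 2 - I * ((-lam : ℝ) : ℂ)) (1 + inner ℝ σ s) *
          homPart (-(-lam)) ε v (emb s)) := by
      filter_upwards [ae_one_add_inner_ne_zero σ] with s hp
      rw [opAntiIntegrand, inCoord, antiSymbol, hIntegrand_coord _ hH.invariant lam ε hp, flatPart,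
        real_inner_comm σ s, neg_neg]
      push_cast
      rw [mul_neg, sub_neg_eq_add]
      ring
    refine ⟨(h1.const_mul c).congr he.symm, ?_⟩
    rw [thetaOpAnti, integral_congr_ae he, integral_const_mul, ← mul_assoc, hcc, one_mul, h2, hval]

end AntistandardCalculus

end ProjPseudo

end

theorem proposition2p2 (n : ℕ)
    (H : ProjPseudo.E (n + 1) × ProjPseudo.E (n + 1) → ℂ)
    (hH : ProjPseudo.IsInvariantSymbol H) :
    -- `Op₀(H)` maps `𝓕 𝓢_flat` to `L²`, and `Op₁(H)` maps `𝓢_flat` to `L²`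
    (∀ v : 𝓢(ProjPseudo.E (n + 1), ℂ), ProjPseudo.IsFlat v →
      MemLp (ProjPseudo.op0 H (𝓕 (v : ProjPseudo.E (n + 1) → ℂ))) 2 ∧
      Integrable (ProjPseudo.fourierOp1 H v) ∧
      MemLp (ProjPseudo.op1 H v) 2) ∧
    -- `(Op₀(H) v)_{iλ,ε} = Op₀(H) v_{iλ,ε}`
    (∀ v : 𝓢(ProjPseudo.E (n + 1), ℂ), ∀ (lam : ℝ) (ε : Fin 2),
      (∀ x : ProjPseudo.E (n + 1), x ≠ 0 →
        Integrable (ProjPseudo.homIntegrand lam ε (ProjPseudo.op0 H v) x)) ∧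
      ProjPseudo.IsOp0 H (ProjPseudo.homPart lam ε v)
        (ProjPseudo.homPart lam ε (ProjPseudo.op0 H v))) ∧
    -- `(Op₁(H) v)_{iλ,ε} = Op₁(H) v_{iλ,ε}`
    (∀ v : 𝓢(ProjPseudo.E (n + 1), ℂ), ProjPseudo.IsFlat v → ∀ (lam : ℝ) (ε : Fin 2),
      (∀ x : ProjPseudo.E (n + 1), x ≠ 0 →
        Integrable (ProjPseudo.homIntegrand lam ε (ProjPseudo.op1 H v) x)) ∧
      ProjPseudo.IsOp1 H (ProjPseudo.homPart lam ε v)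
        (ProjPseudo.homPart lam ε (ProjPseudo.op1 H v))) ∧
    -- the operator `A_{iλ,ε}` exists and is `Op_{iλ,ε}(f)`
    (∀ (lam : ℝ) (ε : Fin 2),
      ∃ A : (ProjPseudo.E n → ℂ) → (ProjPseudo.E n → ℂ),
        (∀ v : 𝓢(ProjPseudo.E (n + 1), ℂ),
          ProjPseudo.flatPart lam ε (ProjPseudo.op0 H v) = A (ProjPseudo.flatPart lam ε v)) ∧
        (ProjPseudo.intertwiningConst n (-lam) ε ≠ 0 →
          ∃ f : ProjPseudo.E (n + 1) → ProjPseudo.E (n + 1) → ℂ,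
            ProjPseudo.IsStdSymbol lam ε H f ∧
            ∀ u ∈ ProjPseudo.flatClass n lam ε, ProjPseudo.IsOpStd lam ε H f u (A u))) ∧
    -- the operator `B_{iλ,ε}` exists and is `Op^∨_{iλ,ε}(h)`
    (∀ (lam : ℝ) (ε : Fin 2),
      ∃ B : (ProjPseudo.E n → ℂ) → (ProjPseudo.E n → ℂ),
        (∀ v : 𝓢(ProjPseudo.E (n + 1), ℂ), ProjPseudo.IsFlat v →
          ProjPseudo.flatPart lam ε (ProjPseudo.op1 H v) = B (ProjPseudo.flatPart lam ε v)) ∧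
        (ProjPseudo.intertwiningConst n lam ε ≠ 0 →
          ∃ h : ProjPseudo.E (n + 1) → ProjPseudo.E (n + 1) → ℂ,
            ProjPseudo.IsAntiSymbol lam ε H h ∧
            ∀ u ∈ ProjPseudo.flatClass n lam ε, ProjPseudo.IsOpAnti lam ε H h u (B u))) := by
  classical
  refine ⟨fun v hv => ⟨?_, ?_, ?_⟩, fun v lam ε => ⟨fun x hx => ?_, ?_⟩,
    fun v hv lam ε => ⟨fun x hx => ?_, ?_⟩, fun lam ε => ?_, fun lam ε => ?_⟩
  · have h := ProjPseudo.memLp_stdOp hH (κ := 1) (by simp) (𝓕 (𝓕 v))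
    rwa [← ProjPseudo.op0_eq_stdOp_schwartz, SchwartzMap.fourier_coe] at h
  · obtain ⟨g, hg⟩ := ProjPseudo.exists_schwartz_fourierOp1 hH hv
    exact hg ▸ g.integrable
  · obtain ⟨w, hw, -⟩ := ProjPseudo.exists_schwartz_op1 hH hv
    exact hw ▸ w.memLp 2
  · exact ProjPseudo.integrable_homIntegrand_op0 hH v lam ε hx
  · exact ProjPseudo.isOp0_homPart hH v lam ε
  · obtain ⟨w, hw, -⟩ := ProjPseudo.exists_schwartz_op1 hH hv
    exact hw ▸ ProjPseudo.integrable_homIntegrand w lam ε hx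
  · exact ProjPseudo.isOp1_homPart hH hv lam ε
  · -- `A` is defined through an arbitrary representative, on which it does not depend
    set A : (ProjPseudo.E n → ℂ) → (ProjPseudo.E n → ℂ) := fun u =>
      if h : u ∈ ProjPseudo.flatClass n lam ε then
        ProjPseudo.flatPart lam ε (ProjPseudo.op0 H h.choose) else 0 with hA
    have hAv : ∀ v : 𝓢(ProjPseudo.E (n + 1), ℂ), ProjPseudo.flatPart lam ε (ProjPseudo.op0 H v) =
        A (ProjPseudo.flatPart lam ε v) := fun v => by
      have h : ProjPseudo.flatPart lam ε (v : ProjPseudo.E (n + 1) → ℂ) ∈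
        ProjPseudo.flatClass n lam ε := ⟨v, rfl⟩
      rw [hA]
      simp only [dif_pos h]
      exact ProjPseudo.flatPart_op0_congr hH h.choose_spec.symm
    refine ⟨A, hAv, fun hC => ⟨_, ProjPseudo.isStdSymbol_stdSymbol hH lam ε, ?_⟩⟩
    rintro u ⟨v, rfl⟩
    rw [← hAv]
    exact ProjPseudo.isOpStd_flatPart hH hC v
  · -- likewise for `B`, by means of flat representatives
    set B : (ProjPseudo.E n → ℂ) → (ProjPseudo.E n → ℂ) := fun u =>
      if h : u ∈ ProjPseudo.flatClass n lam ε then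
        ProjPseudo.flatPart lam ε
          (ProjPseudo.op1 H (ProjPseudo.exists_flat_of_mem_flatClass h).choose) else 0 with hB
    have hBv : ∀ v : 𝓢(ProjPseudo.E (n + 1), ℂ), ProjPseudo.IsFlat v →
        ProjPseudo.flatPart lam ε (ProjPseudo.op1 H v) =
        B (ProjPseudo.flatPart lam ε v) := fun v hv => by
      have h : ProjPseudo.flatPart lam ε (v : ProjPseudo.E (n + 1) → ℂ) ∈
        ProjPseudo.flatClass n lam ε := ⟨v, rfl⟩
      obtain ⟨h1, h2⟩ := (ProjPseudo.exists_flat_of_mem_flatClass h).choose_spec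
      rw [hB]
      simp only [dif_pos h]
      exact ProjPseudo.flatPart_op1_congr hH hv h1 h2.symm
    refine ⟨B, hBv, fun hC => ⟨_, ProjPseudo.isAntiSymbol_antiSymbol hH lam ε, fun u hu => ?_⟩⟩
    obtain ⟨v, hv, rfl⟩ := ProjPseudo.exists_flat_of_mem_flatClass hu
    rw [← hBv v hv]
    exact ProjPseudo.isOpAnti_flatPart hH hC hv
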